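/- Let $p$ be a prime and let $\mathbb C_p$ be the completion of an algebraic closure of $\mathbb Q_p$; write $\mathbb P=\mathbb C_p\cup\{\infty\}$, with the chordal metric, and let rational maps $R\in\mathbb C_p(z)$ act on $\mathbb P$. A *critical point* of $R$ is a point where the local degree of $R$ is greater than $1$. A point is *recurrent* if it is accumulated by its forward orbit. A point $z$ is an *unramified preimage* of $w$ under $R$ if for some $n\ge 1$ we have $R^n(z)=w$ and $R^n$ has local degree $1$ at $z$; the point $w$ is *unramified* for $R$ if it has infinitely many unramified preimages. A fixed point is *repelling* if its multiplier has absolute value greater than $1$. Let $K\subset\mathbb C_p$ be a finite extension of $\mathbb Q_p$ and let $B\subset\mathbb C_p$ be an (open or closed) ball. A holomorphic function on $B$ is one given on all of $B$ by a convergent power series, and it is *defined over $K$* if its power series at some point of $B\cap K$ has coefficients in $K$. A *one-parameter family of rational maps with marked critical point, defined over $K$*, consists of rational maps $R_t$ ($t\in B$), of degree independent of $t$, and of points $c_t\in\mathbb P$ ($t\in B$), where $c_t$ is a critical point of $R_t$ for every $t\in B$, the coefficients of $R_t$ are holomorphic functions of $t\in B$ defined over $K$ (that is, $R_t=P_t/Q_t$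 in lowest terms with such coefficients for the polynomials $P_t,Q_t$), and $t\mapsto c_t$ is a holomorphic function from $B$ to $\mathbb P$ defined over $K$ (that is, $c_t=[f(t):g(t)]$ with $f,g$ holomorphic on $B$, defined over $K$ and without common zeros). It has a *Misiurewicz bifurcation* at $t_0\in B$ if there is an integer $\ell\ge 1$ such that 1. $R_{t_0}^\ell(c_{t_0})$ is a repelling fixed point of $R_{t_0}$; 2. $c_{t_0}$ is unramified for $R_{t_0}$; 3. for some $t\in B$, the point $R_t^\ell(c_t)$ is not a fixed point of $R_t$; 4. the local degree of $R_t^\ell$ at $c_t$ is constant for $t$ close to $t_0$. **Theorem A.** Let $(R,c)$ be a one-parameter family of rational maps with marked critical point over a ball $B$, defined over a finite extension of $\mathbb Q_p$, which has a Misiurewicz bifurcation at some parameter in $B$. Then there is a parameter $t\in B$ such that the coefficients of $R_t$ are algebraic over $\mathbb Q_p$ and $R_t$ has a critical point that is recurrent and not periodic. -/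

import Mathlib

open Polynomial OnePoint Filter Topology

noncomputable section

namespace PadicDyn

/-! ### The projective line and rational maps

The projective line over a field `F` is `F ∪ {∞}`, written `OnePoint F`.  Only the underlying set of
`OnePoint F` is used; closeness of points is always measured by the chordal distance below. -/

section RationalMaps

variable {F : Type*} [Field F]

open Classical in
/-- The point of the projective line with homogeneous coordinates `[x : y]`, that is `x / y`. -/
def projPoint (x y : F) : OnePoint F := if y = 0 then ∞ else ((x / y : F) : OnePoint F)

/-- The degree of a rational map. -/
def ratDegree (R : RatFunc F) : ℕ := max R.num.natDegree R.denom.natDegree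

/-- The self-map of the projective line given by a rational function. -/
def toMap (R : RatFunc F) : OnePoint F → OnePoint F
  | ∞ => projPoint (R.num.coeff (ratDegree R)) (R.denom.coeff (ratDegree R))
  | (z : F) => projPoint (R.num.eval z) (R.denom.eval z)

/-- The polynomial whose zeros in `F` are the solutions `x` of `R x = w`. -/
def fiberPoly (R : RatFunc F) : OnePoint F → F[X]
  | ∞ => R.denom
  | (w : F) => R.num - C w * R.denom

/-- The local degree of `R` at `z`: the multiplicity of `z` as a solution of the equation
`R x = R z`.  At `∞` this is the multiplicity of `∞` as a zero of the corresponding form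
of degree `ratDegree R`. -/
def localDegree (R : RatFunc F) (z : OnePoint F) : ℕ :=
  match z with
  | ∞ => ratDegree R - (fiberPoly R (toMap R ∞)).natDegree
  | (x : F) => (fiberPoly R (toMap R (x : OnePoint F))).rootMultiplicity x

/-- A critical point of a rational map is a point where the local degree is bigger than one. -/
def IsCriticalPt (R : RatFunc F) (z : OnePoint F) : Prop := 1 < localDegree R z

/-- The `n`-th iterate of `R`, as a rational function; `ratIterate R (n + 1)` is `R` composed
with `ratIterate R n`. -/
def ratIterate (R : RatFunc F) : ℕ → RatFunc F
  | 0 => RatFunc.X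
  | n + 1 => RatFunc.eval RatFunc.C (ratIterate R n) R

/-- The derivative `R' (a)` at a point `a` of `F` that is not a pole. -/
def derivAt (R : RatFunc F) (a : F) : F :=
  (R.num.derivative.eval a * R.denom.eval a - R.num.eval a * R.denom.derivative.eval a) /
    (R.denom.eval a) ^ 2

/-- The multiplier of a fixed point of `R`; at `∞` it is computed in the coordinate `1 / z`, that
is, as the derivative at `0` of `1 / R (1 / z)`. -/
def multiplier (R : RatFunc F) : OnePoint F → F
  | ∞ => derivAt (RatFunc.eval RatFunc.C (RatFunc.X)⁻¹ R)⁻¹ 0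
  | (a : F) => derivAt R a

/-- `z` is an unramified preimage of `w`: for some `n ≥ 1` we have `R ^ n (z) = w` and the local
degree of `R ^ n` at `z` is one. -/
def IsUnramifiedPreimage (R : RatFunc F) (z w : OnePoint F) : Prop :=
  ∃ n : ℕ, 1 ≤ n ∧ (toMap R)^[n] z = w ∧ localDegree (ratIterate R n) z = 1

/-- A point is unramified if it has infinitely many unramified preimages. -/
def IsUnramified (R : RatFunc F) (w : OnePoint F) : Prop :=
  {z : OnePoint F | IsUnramifiedPreimage R z w}.Infinite

/-- `z` is a periodic point of `R`. -/
def IsPeriodic (R : RatFunc F) (z : OnePoint F) : Prop :=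
  ∃ n : ℕ, 1 ≤ n ∧ (toMap R)^[n] z = z

end RationalMaps

section Metric

variable {F : Type*} [NormedField F]

/-- The chordal distance on the projective line. -/
def chordal : OnePoint F → OnePoint F → ℝ
  | ∞, ∞ => 0
  | ∞, (w : F) => 1 / max 1 ‖w‖
  | (z : F), ∞ => 1 / max 1 ‖z‖
  | (z : F), (w : F) => ‖z - w‖ / (max 1 ‖z‖ * max 1 ‖w‖)

/-- `a` is a repelling fixed point of `R`. -/
def IsRepellingFixedPt (R : RatFunc F) (a : OnePoint F) : Prop :=
  toMap R a = a ∧ 1 < ‖multiplier R a‖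

/-- `z` is recurrent: it is accumulated by its forward orbit. -/
def IsRecurrent (R : RatFunc F) (z : OnePoint F) : Prop :=
  ∀ ε : ℝ, 0 < ε → ∃ᶠ n : ℕ in atTop, chordal ((toMap R)^[n] z) z < ε

end Metric

/-! ### Holomorphic families over `ℂ_[p]` -/

section Families

variable {p : ℕ} [Fact p.Prime]

/-- An open or closed ball of positive radius in `ℂ_[p]`. -/
def IsBall (B : Set ℂ_[p]) : Prop :=
  ∃ (a : ℂ_[p]) (r : ℝ), 0 < r ∧ (B = Metric.ball a r ∨ B = Metric.closedBall a r)

/-- `f` is holomorphic on the ball `B` and defined over the subfield `K`: around some point of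
`B` in `K`, it is given on all of `B` by a convergent power series with coefficients in `K`.
For `K = ⊤` this says that `f` is holomorphic on `B`. -/
def HolomorphicOver (K : IntermediateField ℚ_[p] ℂ_[p]) (B : Set ℂ_[p]) (f : ℂ_[p] → ℂ_[p]) :
    Prop :=
  ∃ ζ : ℂ_[p], ζ ∈ B ∧ ζ ∈ K ∧ ∃ a : ℕ → ℂ_[p], (∀ n, a n ∈ K) ∧
    ∀ t ∈ B, HasSum (fun n : ℕ => a n * (t - ζ) ^ n) (f t)

/-- `t ↦ R t`, for `t ∈ B`, is a one parameter family of rational maps defined over `K`: all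
`R t` have the same degree, and `R t = P t / Q t` in lowest terms, where the coefficients of
`P t` and `Q t` are holomorphic functions of `t` on `B` that are defined over `K`. -/
def IsRationalFamilyOver (K : IntermediateField ℚ_[p] ℂ_[p]) (B : Set ℂ_[p])
    (R : ℂ_[p] → RatFunc ℂ_[p]) : Prop :=
  ∃ P Q : ℂ_[p] → ℂ_[p][X],
    (∀ i : ℕ, HolomorphicOver K B (fun t => (P t).coeff i)) ∧
    (∀ i : ℕ, HolomorphicOver K B (fun t => (Q t).coeff i)) ∧
    (∀ t ∈ B, Q t ≠ 0 ∧ IsCoprime (P t) (Q t) ∧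
      R t = algebraMap ℂ_[p][X] (RatFunc ℂ_[p]) (P t) /
        algebraMap ℂ_[p][X] (RatFunc ℂ_[p]) (Q t)) ∧
    ∃ D : ℕ, ∀ t ∈ B, ratDegree (R t) = D

/-- `c` is a holomorphic function from `B` to the projective line that is defined over `K`: it
is given in homogeneous coordinates by `[f : g]`, where `f` and `g` are holomorphic on `B`,
defined over `K`, and have no common zero in `B`. -/
def HolomorphicToLineOver (K : IntermediateField ℚ_[p] ℂ_[p]) (B : Set ℂ_[p])
    (c : ℂ_[p] → OnePoint ℂ_[p]) : Prop :=
  ∃ f g : ℂ_[p] → ℂ_[p], HolomorphicOver K B f ∧ HolomorphicOver K B g ∧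
    ∀ t ∈ B, (f t ≠ 0 ∨ g t ≠ 0) ∧ c t = projPoint (f t) (g t)

/-- `(R, c)` is a one parameter family of rational maps with marked critical point, over the
ball `B`, and it is defined over `K`. -/
structure IsMarkedFamilyOver (K : IntermediateField ℚ_[p] ℂ_[p]) (B : Set ℂ_[p])
    (R : ℂ_[p] → RatFunc ℂ_[p]) (c : ℂ_[p] → OnePoint ℂ_[p]) : Prop where
  family : IsRationalFamilyOver K B R
  marked : HolomorphicToLineOver K B c
  critical : ∀ t ∈ B, IsCriticalPt (R t) (c t)

/-- `(R, c)` has a Misiurewicz bifurcation at the parameter `t₀` of `B`. -/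
def HasMisiurewiczBifurcation (B : Set ℂ_[p]) (R : ℂ_[p] → RatFunc ℂ_[p])
    (c : ℂ_[p] → OnePoint ℂ_[p]) (t₀ : ℂ_[p]) : Prop :=
  t₀ ∈ B ∧ ∃ ℓ : ℕ, 1 ≤ ℓ ∧
    IsRepellingFixedPt (R t₀) ((toMap (R t₀))^[ℓ] (c t₀)) ∧
    IsUnramified (R t₀) (c t₀) ∧
    (∃ t ∈ B, toMap (R t) ((toMap (R t))^[ℓ] (c t)) ≠ (toMap (R t))^[ℓ] (c t)) ∧
    ∃ d : ℕ, ∀ᶠ t in 𝓝[B] t₀, localDegree (ratIterate (R t) ℓ) (c t) = d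

/-- The coefficients of the rational map `R` are algebraic over `ℚ_[p]`.  (The numerator and the
denominator are taken in lowest terms, with monic denominator.) -/
def HasAlgebraicCoeffs (R : RatFunc ℂ_[p]) : Prop :=
  ∀ i : ℕ, IsAlgebraic ℚ_[p] (R.num.coeff i) ∧ IsAlgebraic ℚ_[p] (R.denom.coeff i)

end Families

end PadicDyn

end

/-!
Near a Misiurewicz parameter `t₀` the marked critical point can be made to return to itself closer
and closer, along nested parameter balls; the point is to keep the limit parameter algebraic. This
is possible because a finite extension of `ℚ_[p]` is complete: if all constructions take place in
one such field `k`, then the limit lies in `k`.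

**Algebraic setting.** Points of the projective line are represented by vectors and rational maps
by pairs of homogeneous forms (`FormPair`, `IsLift`). The local degree is the order of a contact
polynomial (`IsLift.localDegree_eq`) and multiplicative along orbits
(`IsLift.localDegree_iterate_eq_prod`). The parameter `t₀` is a zero of a nonzero power series over
a finite extension of `ℚ_[p]`, hence algebraic (`isAlgebraic_parameter`), so after enlarging the
field of definition all coefficients are power series centered at `t₀` (`holRing_recenter`).

**Preimages of the critical point.** Of any two points, one has preimages arbitrarily close to a
given repelling fixed point, since a polynomial without zeros near a point has a small logarithmic
derivative there, whereas iteration at a repelling point makes derivatives grow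
(`IsLift.exists_preimage_near`). Applied to two unramified preimages of the critical point, this
gives an unramified preimage `z₀` of the critical point close to the repelling fixed point
(`IsLift.exists_unramified_preimage_near`).

**Local model.** In analytic coordinates (`AnalyticFamily.exists_fixed_point_coordinate`,
`AnalyticFamily.exists_critical_coordinate`, `AnalyticFamily.exists_return_coordinate`) the family
becomes a `LocalModel`: the critical point is sent by `y ↦ (t - t₀) ^ m * U t + y ^ d * u t y` to a
neighborhood of the fixed point, there the map is multiplication by `q t X`, and a further iterate
takes a neighborhood of `z₀` bijectively to one of the critical point. Constancy of the local
degree is what makes the second summand divisible by `y ^ d` for all `t`.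

**Closer and closer returns.** The critical point has a preimage `ω` near itself, defined over a
finite extension (`LocalModel.exists_preimage_near`, `LocalModel.exists_returnSystem`). A `Stage` is
a parameter ball together with an itinerary that takes the critical value back to the critical
point, approximately linearly in the parameter (slope `L`) and in the coordinate (slope `E`); the
first one comes from an orbit that spends a long time near the fixed point
(`LocalModel.exists_stage`). At a suitable nearby parameter the critical value is taken instead to
a point of small coordinate `h` with `E * A * h ^ d ≈ ω`, which is then sent near `ω` and back to
the critical point; this loop has slope `β`. It is solvability of `E * A * h ^ d = ω` in `k` that
might force an extension of `k` at every stage. But if the loop is followed exactly `d` times, then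
`E` is replaced by `E * β ^ d` and `h / β` solves the new equation. Hence the construction can be
repeated forever over the same field (`Stage.next`), and the nested parameter balls meet in a
parameter of `k` at which the critical point makes returns of size `‖h‖ → 0`, all of them nonzero
(`exists_recurrent_parameter`). A critical point with such returns is recurrent and not periodic
(`isRecurrent_and_not_isPeriodic`).

The integers `d` and `m` may be divisible by `p`; the estimates therefore carry the factors
`‖(d : Ω)‖` and `‖(m : Ω)‖`. A map is called approximately linear when its error is at most `θ`
times the linear term, where `θ` is small compared to `‖(d : Ω)‖`.
-/

noncomputable section

namespace PadicDyn

/-! ### Approximately linear maps over an ultrametric field -/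

section Ultrametric

variable {Ω : Type*} [NormedField Ω] [IsUltrametricDist Ω]

theorem norm_add_le_of_le {a b : Ω} {C : ℝ} (ha : ‖a‖ ≤ C) (hb : ‖b‖ ≤ C) : ‖a + b‖ ≤ C :=
  (IsUltrametricDist.norm_add_le_max a b).trans (max_le ha hb)

theorem norm_sub_le_of_le {a b : Ω} {C : ℝ} (ha : ‖a‖ ≤ C) (hb : ‖b‖ ≤ C) : ‖a - b‖ ≤ C := by
  rw [sub_eq_add_neg]
  exact norm_add_le_of_le ha (by rwa [norm_neg])

theorem norm_sub_le_of_le_of_le {a b c : Ω} {C : ℝ} (h₁ : ‖a - b‖ ≤ C) (h₂ : ‖b - c‖ ≤ C) :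
    ‖a - c‖ ≤ C := by
  rw [← sub_add_sub_cancel a b c]
  exact norm_add_le_of_le h₁ h₂

theorem norm_le_of_sub_le {a b : Ω} {C : ℝ} (h : ‖a - b‖ ≤ C) (hb : ‖b‖ ≤ C) : ‖a‖ ≤ C := by
  rw [← sub_add_cancel a b]
  exact norm_add_le_of_le h hb

/-- A vector is as long as any vector whose distance to it is small relative to its length. -/
theorem norm_eq_of_sub_le {a b : Ω} {θ : ℝ} (hθ : θ < 1) (h : ‖a - b‖ ≤ θ * ‖b‖) :
    ‖a‖ = ‖b‖ := by
  rcases eq_or_ne b 0 with rfl | hb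
  · simp only [norm_zero, mul_zero, sub_zero] at h
    rw [norm_zero]
    exact le_antisymm h (norm_nonneg a)
  · have hb' : 0 < ‖b‖ := norm_pos_iff.2 hb
    have hlt : ‖a - b‖ < ‖b‖ := by nlinarith
    have h2 := IsUltrametricDist.norm_add_eq_max_of_norm_ne_norm hlt.ne
    rw [sub_add_cancel, max_eq_right hlt.le] at h2
    exact h2

/-- Newton's method in a complete subfield `k`: a map that is approximately linear of slope `L` on
a ball takes every value in the ball of radius `R` around the value at the center. -/
theorem exists_eq_of_approxLinear [CompleteSpace Ω] {k : Subfield Ω}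
    (hk : IsClosed (k : Set Ω)) {φ : Ω → Ω}
    {L t₀ y : Ω} {R θ : ℝ} (hθ0 : 0 ≤ θ) (hθ : θ < 1) (hR : 0 ≤ R) (hL : L ∈ k) (hL0 : L ≠ 0)
    (ht₀ : t₀ ∈ k) (hφ : ∀ t ∈ k, ‖L‖ * ‖t - t₀‖ ≤ R → φ t ∈ k)
    (happ : ∀ t ∈ k, ∀ t' ∈ k, ‖L‖ * ‖t - t₀‖ ≤ R → ‖L‖ * ‖t' - t₀‖ ≤ R →
      ‖φ t - φ t' - L * (t - t')‖ ≤ θ * (‖L‖ * ‖t - t'‖))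
    (hy : y ∈ k) (hyr : ‖y - φ t₀‖ ≤ R) :
    ∃ t ∈ k, ‖L‖ * ‖t - t₀‖ ≤ R ∧ φ t = y := by
  have hLp : 0 < ‖L‖ := norm_pos_iff.2 hL0
  set s : Set Ω := {t | t ∈ k ∧ ‖L‖ * ‖t - t₀‖ ≤ R} with hs
  have hsc : IsComplete s := by
    have hcl : IsClosed {t : Ω | ‖L‖ * ‖t - t₀‖ ≤ R} :=
      isClosed_le (by fun_prop) continuous_const
    exact (hk.inter hcl).isComplete
  set F : Ω → Ω := fun t => t - (φ t - y) / L with hF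
  have hFF : ∀ t ∈ s, ∀ t' ∈ s, ‖F t - F t'‖ ≤ θ * ‖t - t'‖ := by
    rintro t ⟨htk, ht⟩ t' ⟨htk', ht'⟩
    have h1 : F t - F t' = -((φ t - φ t' - L * (t - t')) / L) := by
      simp only [hF]; field_simp; ring
    rw [h1, norm_neg, norm_div, div_le_iff₀ hLp]
    calc _ ≤ _ := happ t htk t' htk' ht ht'
      _ = _ := by ring
  have hF0 : ‖L‖ * ‖F t₀ - t₀‖ ≤ R := by
    have h1 : F t₀ - t₀ = (y - φ t₀) / L := by simp only [hF]; field_simp; ring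
    rw [h1, norm_div, mul_div_cancel₀ _ hLp.ne']
    exact hyr
  have ht₀s : t₀ ∈ s := ⟨ht₀, by simpa using hR⟩
  have hmaps : Set.MapsTo F s s := by
    intro t ht
    refine ⟨k.sub_mem ht.1 (k.div_mem (k.sub_mem (hφ t ht.1 ht.2) hy) hL), ?_⟩
    have h1 := hFF t ht t₀ ht₀s
    have h2 : ‖L‖ * ‖F t - F t₀‖ ≤ R := by
      have h3 : ‖L‖ * ‖F t - F t₀‖ ≤ θ * (‖L‖ * ‖t - t₀‖) := by nlinarith
      have h4 : 0 ≤ ‖L‖ * ‖t - t₀‖ := by positivity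
      nlinarith [ht.2]
    rw [← norm_mul] at h2 hF0 ⊢
    have h5 : L * (F t - t₀) = L * (F t - F t₀) + L * (F t₀ - t₀) := by ring
    rw [h5]
    exact norm_add_le_of_le h2 hF0
  have hcon : ContractingWith ⟨θ, hθ0⟩ (hmaps.restrict F s s) := by
    refine ⟨by exact_mod_cast hθ, LipschitzWith.of_dist_le_mul ?_⟩
    rintro ⟨t, ht⟩ ⟨t', ht'⟩
    simp only [Subtype.dist_eq, Set.MapsTo.val_restrict_apply, dist_eq_norm]
    exact hFF t ht t' ht'
  obtain ⟨t, hts, hfix, -⟩ := hcon.exists_fixedPoint' hsc hmaps ht₀s (edist_ne_top _ _)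
  refine ⟨t, hts.1, hts.2, ?_⟩
  have h1 : t - (φ t - y) / L = t := hfix
  have h2 : (φ t - y) / L = 0 := by simpa using h1
  rcases div_eq_zero_iff.1 h2 with h | h
  · exact sub_eq_zero.1 h
  · exact absurd h hL0

/-- A product of `i + j` factors at relative distance at most `e` from `h` is at relative distance
at most `e` from `h ^ (i + j)`. -/
theorem norm_pow_mul_pow_sub_le {y y' h : Ω} {e : ℝ} (he0 : 0 ≤ e) (he : e ≤ 1)
    (hy : ‖y - h‖ ≤ e * ‖h‖) (hy' : ‖y' - h‖ ≤ e * ‖h‖) (i j : ℕ) :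
    ‖y ^ i * y' ^ j - h ^ (i + j)‖ ≤ e * ‖h‖ ^ (i + j) := by
  have hh : 0 ≤ ‖h‖ := norm_nonneg h
  have key : ∀ (z : Ω), ‖z - h‖ ≤ e * ‖h‖ → ∀ (m : ℕ) (x : Ω) (n : ℕ),
      ‖x - h ^ n‖ ≤ e * ‖h‖ ^ n → ‖z ^ m * x - h ^ (m + n)‖ ≤ e * ‖h‖ ^ (m + n) := by
    intro z hz m x n hx
    have hzn : ‖z‖ ≤ ‖h‖ := norm_le_of_sub_le (hz.trans (by nlinarith)) le_rfl
    induction m with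
    | zero => simpa using hx
    | succ m ih =>
      have h1 : z ^ (m + 1) * x - h ^ (m + 1 + n) =
          z * (z ^ m * x - h ^ (m + n)) + (z - h) * h ^ (m + n) := by ring
      rw [h1]
      refine norm_add_le_of_le ?_ ?_
      · rw [norm_mul]
        calc ‖z‖ * ‖z ^ m * x - h ^ (m + n)‖ ≤ ‖h‖ * (e * ‖h‖ ^ (m + n)) :=
              mul_le_mul hzn ih (norm_nonneg _) hh
          _ = _ := by ring
      · rw [norm_mul, norm_pow]
        calc ‖z - h‖ * ‖h‖ ^ (m + n) ≤ e * ‖h‖ * ‖h‖ ^ (m + n) := by gcongr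
          _ = _ := by ring
  refine key y hy i _ j ?_
  simpa using key y' hy' j 1 0 (by simpa using he0)

/-- Near a point `h`, the map `y ↦ y ^ d` is approximately linear of slope `d * h ^ (d - 1)`. -/
theorem norm_pow_sub_pow_sub_le {y y' h : Ω} {e : ℝ} (he0 : 0 ≤ e) (he : e ≤ 1)
    (hy : ‖y - h‖ ≤ e * ‖h‖) (hy' : ‖y' - h‖ ≤ e * ‖h‖) (d : ℕ) :
    ‖y ^ d - y' ^ d - d * h ^ (d - 1) * (y - y')‖ ≤ e * ‖h‖ ^ (d - 1) * ‖y - y'‖ := by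
  have h1 : y ^ d - y' ^ d - d * h ^ (d - 1) * (y - y') =
      (∑ i ∈ Finset.range d, (y ^ i * y' ^ (d - 1 - i) - h ^ (d - 1))) * (y - y') := by
    rw [Finset.sum_sub_distrib, sub_mul, geom_sum₂_mul]
    simp
  rw [h1, norm_mul]
  gcongr
  refine IsUltrametricDist.norm_sum_le_of_forall_le_of_nonneg (by positivity) ?_
  intro i hi
  have hi' : i + (d - 1 - i) = d - 1 := by have := Finset.mem_range.1 hi; omega
  have := norm_pow_mul_pow_sub_le he0 he hy hy' i (d - 1 - i)
  rwa [hi'] at this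

end Ultrametric

/-! ### Critical returns -/

section Returns

variable {Ω : Type*} [NormedField Ω] [IsUltrametricDist Ω] {X : Type*}

/-- A parametrized system with a returning critical point, in coordinates. For every parameter
`t` the point `P t y` has coordinate `y` near the critical point `P t 0`, and `Q t w` has
coordinate `w` near the image `Q t 0` of the critical point under the `ℓ`-th iterate. In these
coordinates that iterate is `g t`, which is close to `y ↦ A * y ^ d`; near `ω` the `q`-th iterate
is `f t`, which is approximately linear of slope `σ` and maps a neighborhood of `ω` to the ball of
radius `ρ` about the critical point. The constants `θ`, `Λ` measure the accuracy of these
approximations in the coordinate and in the parameter, and everything is defined over `k`. -/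
structure ReturnSystem (k : Subfield Ω) (D : Set Ω) (T : Ω → X → X) (P Q : Ω → Ω → X)
    (g f : Ω → Ω → Ω) (ℓ q d : ℕ) (A ω σ : Ω) (θ η η' ρ Λ : ℝ) : Prop where
  closed : IsClosed (k : Set Ω)
  A_mem : A ∈ k
  ω_mem : ω ∈ k
  σ_mem : σ ∈ k
  A_ne : A ≠ 0
  ω_ne : ω ≠ 0
  σ_ne : σ ≠ 0
  d_pos : 1 ≤ d
  d_ne : (d : Ω) ≠ 0
  θ_pos : 0 < θ
  θ_le : θ ≤ 1 / 2
  η_pos : 0 < η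
  η_le : η ≤ 1 / 2
  η'_le : η' ≤ 1 / 2
  θ_le' : θ ≤ ‖(d : Ω)‖ * η'
  Λ_nonneg : 0 ≤ Λ
  ρ_eq : ρ = ‖(d : Ω)‖ * ‖σ‖ * ‖ω‖ * η
  ω_le : ‖ω‖ ≤ ρ
  g_mem : ∀ t ∈ k, t ∈ D → ∀ y ∈ k, ‖y‖ ≤ ρ → g t y ∈ k
  g_fine : ∀ t ∈ k, t ∈ D → ∀ t' ∈ k, t' ∈ D → ∀ h ∈ k, ‖h‖ ≤ ρ → ∀ y ∈ k, ∀ y' ∈ k,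
    ‖y - h‖ ≤ η * ‖h‖ → ‖y' - h‖ ≤ η * ‖h‖ →
    ‖g t y - g t' y' - d * A * h ^ (d - 1) * (y - y')‖ ≤
      max (θ * (‖(d : Ω)‖ * ‖A‖ * ‖h‖ ^ (d - 1) * ‖y - y'‖)) (Λ * ‖h‖ ^ d * ‖t - t'‖)
  g_coarse : ∀ t ∈ k, t ∈ D → ∀ h ∈ k, ‖h‖ ≤ ρ → ∀ y ∈ k, ∀ y' ∈ k,
    ‖y - h‖ ≤ η' * ‖h‖ → ‖y' - h‖ ≤ η' * ‖h‖ →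
    ‖g t y - g t y' - d * A * h ^ (d - 1) * (y - y')‖ ≤
      1 / 2 * (‖(d : Ω)‖ * ‖A‖ * ‖h‖ ^ (d - 1) * ‖y - y'‖)
  g_val : ∀ t ∈ k, t ∈ D → ∀ h ∈ k, ‖h‖ ≤ ρ → ‖g t h - A * h ^ d‖ ≤ θ * (‖A‖ * ‖h‖ ^ d)
  f_mem : ∀ t ∈ k, t ∈ D → ∀ x ∈ k, ‖x - ω‖ ≤ ‖(d : Ω)‖ * η * ‖ω‖ → f t x ∈ k
  f_est : ∀ t ∈ k, t ∈ D → ∀ t' ∈ k, t' ∈ D → ∀ x ∈ k, ∀ x' ∈ k,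
    ‖x - ω‖ ≤ ‖(d : Ω)‖ * η * ‖ω‖ → ‖x' - ω‖ ≤ ‖(d : Ω)‖ * η * ‖ω‖ →
    ‖f t x - f t' x' - σ * (x - x')‖ ≤ max (θ * (‖σ‖ * ‖x - x'‖)) (Λ * ‖t - t'‖)
  f_bound : ∀ t ∈ k, t ∈ D → ∀ x ∈ k, ‖x - ω‖ ≤ ‖(d : Ω)‖ * η * ‖ω‖ → ‖f t x‖ ≤ ρ
  dyn_g : ∀ t ∈ k, t ∈ D → ∀ y ∈ k, ‖y‖ ≤ ρ → (T t)^[ℓ] (P t y) = Q t (g t y)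
  dyn_f : ∀ t ∈ k, t ∈ D → ∀ x ∈ k, ‖x - ω‖ ≤ ‖(d : Ω)‖ * η * ‖ω‖ →
    (T t)^[q] (P t x) = P t (f t x)

/-- The `n`-th iterate takes the point of coordinate `w` near the critical value to the point of
coordinate `ψ t w` near the critical point. On the product of the balls of radii `ρ / ‖L‖` around
the parameter `τ` and `ρ / ‖E‖` around `0` the map `ψ` is approximately linear, of slope `L` in
the parameter and `E` in the coordinate. -/
structure Stage (k : Subfield Ω) (D : Set Ω) (T : Ω → X → X) (P Q : Ω → Ω → X) (θ ρ : ℝ)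
    (τ L E : Ω) (ψ : Ω → Ω → Ω) (n : ℕ) : Prop where
  τ_mem : τ ∈ k
  L_mem : L ∈ k
  E_mem : E ∈ k
  L_ne : L ≠ 0
  E_ne : E ≠ 0
  sub : ∀ t ∈ k, ‖L‖ * ‖t - τ‖ ≤ ρ → t ∈ D
  mem : ∀ t ∈ k, ‖L‖ * ‖t - τ‖ ≤ ρ → ∀ w ∈ k, ‖E‖ * ‖w‖ ≤ ρ → ψ t w ∈ k
  est : ∀ t ∈ k, ‖L‖ * ‖t - τ‖ ≤ ρ → ∀ t' ∈ k, ‖L‖ * ‖t' - τ‖ ≤ ρ →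
    ∀ w ∈ k, ‖E‖ * ‖w‖ ≤ ρ → ∀ w' ∈ k, ‖E‖ * ‖w'‖ ≤ ρ →
    ‖ψ t w - ψ t' w' - L * (t - t') - E * (w - w')‖ ≤
      θ * max (‖L‖ * ‖t - t'‖) (‖E‖ * ‖w - w'‖)
  center : ‖ψ τ 0‖ ≤ ρ
  dyn : ∀ t ∈ k, ‖L‖ * ‖t - τ‖ ≤ ρ → ∀ w ∈ k, ‖E‖ * ‖w‖ ≤ ρ →
    (T t)^[n] (Q t w) = P t (ψ t w)

variable {k : Subfield Ω} {D : Set Ω} {T : Ω → X → X} {P Q : Ω → Ω → X}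
    {g f : Ω → Ω → Ω} {ℓ q d : ℕ} {A ω σ : Ω} {θ η η' ρ Λ : ℝ}

omit [IsUltrametricDist Ω] in
theorem ReturnSystem.ρ_pos (S : ReturnSystem k D T P Q g f ℓ q d A ω σ θ η η' ρ Λ) : 0 < ρ :=
  (norm_pos_iff.2 S.ω_ne).trans_le S.ω_le

/-- The map of a stage expands distances by at most its slopes. -/
theorem Stage.lip {τ L E : Ω} {ψ : Ω → Ω → Ω} {n : ℕ} (hψ : Stage k D T P Q θ ρ τ L E ψ n)
    (hθ : θ ≤ 1 / 2) {t t' w w' : Ω} (ht : t ∈ k) (htτ : ‖L‖ * ‖t - τ‖ ≤ ρ)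
    (ht' : t' ∈ k) (htτ' : ‖L‖ * ‖t' - τ‖ ≤ ρ) (hw : w ∈ k) (hwρ : ‖E‖ * ‖w‖ ≤ ρ)
    (hw' : w' ∈ k) (hwρ' : ‖E‖ * ‖w'‖ ≤ ρ) :
    ‖ψ t w - ψ t' w'‖ ≤ max (‖L‖ * ‖t - t'‖) (‖E‖ * ‖w - w'‖) := by
  have h := hψ.est t ht htτ t' ht' htτ' w hw hwρ w' hw' hwρ'
  set m := max (‖L‖ * ‖t - t'‖) (‖E‖ * ‖w - w'‖) with hm
  have hm0 : 0 ≤ m := le_max_of_le_left (by positivity)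
  have h1 : ‖ψ t w - ψ t' w' - L * (t - t') - E * (w - w')‖ ≤ m := h.trans (by nlinarith)
  have h2 : ‖ψ t w - ψ t' w' - L * (t - t')‖ ≤ m :=
    norm_le_of_sub_le h1 (by rw [norm_mul]; exact le_max_right _ _)
  exact norm_le_of_sub_le h2 (by rw [norm_mul]; exact le_max_left _ _)

set_option maxHeartbeats 1000000 in
/-- Following the itinerary of the critical value once more: if a stage `y` takes the critical
value near the point of coordinate `h`, which returns under `ψ` to the domain of `f`, then the
composition `f ∘ ψ ∘ g ∘ y` is a stage whose slopes are those of `y` times the slope of the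
composition `f ∘ ψ ∘ g` at `h`. -/
theorem Stage.comp (S : ReturnSystem k D T P Q g f ℓ q d A ω σ θ η η' ρ Λ)
    {τ L E : Ω} {ψ : Ω → Ω → Ω} {n : ℕ} (hψ : Stage k D T P Q θ ρ τ L E ψ n)
    {h t₂ : Ω} (hh : h ∈ k)
    (hhE : ‖E‖ * (‖A‖ * ‖h‖ ^ d) = ‖ω‖) (hhρ : ‖h‖ ≤ ρ)
    (hh1 : ‖h‖ ≤ θ * (‖(d : Ω)‖ * ‖ω‖)) (hh2 : ‖h‖ ≤ θ * (‖(d : Ω)‖ * ‖σ‖ * ‖ω‖))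
    (hΛ1 : Λ * ρ ≤ θ * (‖(d : Ω)‖ * ‖A‖ * ‖L‖)) (hΛ2 : Λ ≤ ‖L‖)
    (htgt : ∀ t ∈ k, ‖L‖ * ‖t - t₂‖ ≤ η * ‖h‖ →
      ‖L‖ * ‖t - τ‖ ≤ ρ ∧ ‖ψ t (g t h) - ω‖ ≤ ‖(d : Ω)‖ * η * ‖ω‖)
    {τ' L' E' : Ω} {y : Ω → Ω → Ω} {n' : ℕ} (hy : Stage k D T P Q θ ρ τ' L' E' y n')
    (hLL' : ‖L‖ ≤ ‖L'‖) {t' : Ω} (ht' : t' ∈ k) (htτ' : ‖L'‖ * ‖t' - τ'‖ ≤ ρ)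
    (hyt' : y t' 0 = h) (htt' : ‖L‖ * ‖t' - t₂‖ ≤ η * ‖h‖) :
    Stage k D T P Q θ ρ t' (L' * (d * A * h ^ (d - 1) * E * σ))
        (E' * (d * A * h ^ (d - 1) * E * σ)) (fun t w => f t (ψ t (g t (y t w))))
        (q + (n + (ℓ + n'))) ∧
      2 ≤ ‖d * A * h ^ (d - 1) * E * σ‖ ∧
      ∀ t ∈ k, ‖L' * (d * A * h ^ (d - 1) * E * σ)‖ * ‖t - t'‖ ≤ ρ →
        ‖L'‖ * ‖t - τ'‖ ≤ ρ ∧ ‖L‖ * ‖t - t₂‖ ≤ η * ‖h‖ := by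
  have hθ := S.θ_pos
  have hθ2 := S.θ_le
  have hθ1 : θ ≤ 1 := by linarith
  have hη := S.η_pos
  have hη2 := S.η_le
  have hρ := S.ρ_pos
  have hd0 : 0 < ‖(d : Ω)‖ := norm_pos_iff.2 S.d_ne
  have hd1 : ‖(d : Ω)‖ ≤ 1 := IsUltrametricDist.norm_natCast_le_one Ω d
  have hω0 : 0 < ‖ω‖ := norm_pos_iff.2 S.ω_ne
  have hσ0 : 0 < ‖σ‖ := norm_pos_iff.2 S.σ_ne
  have hA0 : 0 < ‖A‖ := norm_pos_iff.2 S.A_ne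
  have hE0 : 0 < ‖E‖ := norm_pos_iff.2 hψ.E_ne
  have hL0 : 0 < ‖L‖ := norm_pos_iff.2 hψ.L_ne
  have hL'0 : 0 < ‖L'‖ := norm_pos_iff.2 hy.L_ne
  have hE'0 : 0 < ‖E'‖ := norm_pos_iff.2 hy.E_ne
  have hd' : d ≠ 0 := by have := S.d_pos; omega
  have hh0 : h ≠ 0 := by
    rintro rfl
    rw [norm_zero, zero_pow hd', mul_zero, mul_zero] at hhE
    exact hω0.ne hhE
  have hh0' : 0 < ‖h‖ := norm_pos_iff.2 hh0
  have hpow : ‖h‖ ^ d = ‖h‖ ^ (d - 1) * ‖h‖ := by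
    rw [← pow_succ]; congr 1; omega
  have hpow0 : 0 < ‖h‖ ^ (d - 1) := pow_pos hh0' _
  set γ : Ω := d * A * h ^ (d - 1) with hγ
  have hγn : ‖γ‖ = ‖(d : Ω)‖ * ‖A‖ * ‖h‖ ^ (d - 1) := by
    rw [hγ, norm_mul, norm_mul, norm_pow]
  have hγ0 : 0 < ‖γ‖ := by rw [hγn]; positivity
  set β : Ω := γ * E * σ with hβ
  have hβn : ‖β‖ = ‖γ‖ * ‖E‖ * ‖σ‖ := by rw [hβ, norm_mul, norm_mul]
  have hγE : ‖γ‖ * ‖E‖ * ‖h‖ = ‖(d : Ω)‖ * ‖ω‖ := by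
    rw [hγn, ← hhE, hpow]; ring
  have hβh : ‖β‖ * ‖h‖ = ‖(d : Ω)‖ * ‖σ‖ * ‖ω‖ := by
    rw [hβn, mul_right_comm, hγE]; ring
  -- the slope `β` of the loop stretches the ball of radius `η * ‖h‖` exactly to radius `ρ`
  have hβη : ‖β‖ * (η * ‖h‖) = ρ := by
    rw [S.ρ_eq, ← hβh]; ring
  -- the slopes at `h` are so large that they absorb all errors coming from the parameter
  have hβ1 : 1 ≤ θ * ‖β‖ := by
    have : 1 * ‖h‖ ≤ (θ * ‖β‖) * ‖h‖ := by rw [mul_assoc, hβh, one_mul]; exact hh2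
    exact le_of_mul_le_mul_right this hh0'
  have hγ1 : 1 ≤ θ * (‖γ‖ * ‖E‖) := by
    have : 1 * ‖h‖ ≤ (θ * (‖γ‖ * ‖E‖)) * ‖h‖ := by
      rw [mul_assoc, hγE, one_mul]; exact hh1
    exact le_of_mul_le_mul_right this hh0'
  have hβ2 : 2 ≤ ‖β‖ := by
    have : θ * ‖β‖ ≤ 1 / 2 * ‖β‖ := by gcongr
    linarith
  have hβ0 : 0 < ‖β‖ := by linarith
  have hηh : η * ‖h‖ ≤ ρ := (mul_le_of_le_one_left hh0'.le (by linarith)).trans hhρ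
  -- the parameters of the new stage
  have hpar : ∀ t ∈ k, ‖L' * β‖ * ‖t - t'‖ ≤ ρ →
      ‖L'‖ * ‖t - t'‖ ≤ η * ‖h‖ ∧ ‖L'‖ * ‖t - τ'‖ ≤ ρ ∧ ‖L‖ * ‖t - t₂‖ ≤ η * ‖h‖ := by
    intro t _ h1
    have h2 : ‖L'‖ * ‖t - t'‖ ≤ η * ‖h‖ := by
      rw [norm_mul, ← hβη] at h1
      have : ‖β‖ * (‖L'‖ * ‖t - t'‖) ≤ ‖β‖ * (η * ‖h‖) := by linarith
      exact le_of_mul_le_mul_left this hβ0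
    refine ⟨h2, ?_, ?_⟩
    · have h3 := h2.trans hηh
      rw [← norm_mul, mul_sub] at h3 htτ' ⊢
      exact norm_sub_le_of_le_of_le h3 htτ'
    · have h3 : ‖L‖ * ‖t - t'‖ ≤ η * ‖h‖ :=
        (mul_le_mul_of_nonneg_right hLL' (norm_nonneg _)).trans h2
      rw [← norm_mul, mul_sub] at h3 htt' ⊢
      exact norm_sub_le_of_le_of_le h3 htt'
  have hcoord : ∀ w : Ω, ‖E' * β‖ * ‖w‖ ≤ ρ → ‖E'‖ * ‖w‖ ≤ η * ‖h‖ := by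
    intro w h1
    rw [norm_mul, ← hβη] at h1
    have : ‖β‖ * (‖E'‖ * ‖w‖) ≤ ‖β‖ * (η * ‖h‖) := by linarith
    exact le_of_mul_le_mul_left this hβ0
  have hk0 : (0 : Ω) ∈ k := k.zero_mem
  have h00 : ‖E'‖ * ‖(0 : Ω)‖ ≤ ρ := by simpa using hρ.le
  -- the successive coordinates stay in the domains of `g`, `ψ` and `f`
  have hdom : ∀ t ∈ k, ‖L' * β‖ * ‖t - t'‖ ≤ ρ → ∀ w ∈ k, ‖E' * β‖ * ‖w‖ ≤ ρ →
      y t w ∈ k ∧ ‖y t w - h‖ ≤ η * ‖h‖ ∧ ‖y t w‖ ≤ ρ ∧ t ∈ D ∧ ‖L‖ * ‖t - τ‖ ≤ ρ ∧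
      g t (y t w) ∈ k ∧ ‖E‖ * ‖g t (y t w)‖ ≤ ρ ∧ ψ t (g t (y t w)) ∈ k ∧
      ‖ψ t (g t (y t w)) - ω‖ ≤ ‖(d : Ω)‖ * η * ‖ω‖ := by
    intro t ht htρ w hw hwρ
    obtain ⟨h1, h2, h3⟩ := hpar t ht htρ
    have h4 := hcoord w hwρ
    have hyk : y t w ∈ k := hy.mem t ht h2 w hw (h4.trans hηh)
    have hyh : ‖y t w - h‖ ≤ η * ‖h‖ := by
      rw [← hyt']
      refine (hy.lip hθ2 ht h2 ht' htτ' hw (h4.trans hηh) hk0 h00).trans ?_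
      rw [hyt', sub_zero]
      exact max_le h1 h4
    have hyρ : ‖y t w‖ ≤ ρ := norm_le_of_sub_le (hyh.trans hηh) hhρ
    have htD : t ∈ D := hy.sub t ht h2
    obtain ⟨h5, h6⟩ := htgt t ht h3
    have hgk : g t (y t w) ∈ k := S.g_mem t ht htD _ hyk hyρ
    have hgh : g t h ∈ k := S.g_mem t ht htD _ hh hhρ
    have hghn : ‖g t h‖ = ‖A‖ * ‖h‖ ^ d := by
      have := S.g_val t ht htD h hh hhρ
      rw [← norm_pow, ← norm_mul] at this ⊢
      exact norm_eq_of_sub_le (by linarith) this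
    have hgdiff : ‖E‖ * ‖g t (y t w) - g t h‖ ≤ ‖(d : Ω)‖ * η * ‖ω‖ := by
      have h7 := S.g_fine t ht htD t ht htD h hh hhρ (y t w) hyk h hh hyh
        (by rw [sub_self, norm_zero]; positivity)
      rw [sub_self, norm_zero, mul_zero, ← hγ, ← hγn, max_eq_left (by positivity)] at h7
      have h8 : ‖g t (y t w) - g t h‖ ≤ ‖γ‖ * ‖y t w - h‖ := by
        refine norm_le_of_sub_le (h7.trans ?_) (norm_mul _ _).le
        exact mul_le_of_le_one_left (by positivity) hθ1
      calc ‖E‖ * ‖g t (y t w) - g t h‖ ≤ ‖E‖ * (‖γ‖ * (η * ‖h‖)) := by gcongr; exact h8.trans (by gcongr)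
        _ = η * (‖γ‖ * ‖E‖ * ‖h‖) := by ring
        _ = _ := by rw [hγE]; ring
    have hEgh : ‖E‖ * ‖g t h‖ ≤ ρ := by rw [hghn, hhE]; exact S.ω_le
    have hdω : ‖(d : Ω)‖ * η * ‖ω‖ ≤ ρ := by
      have h9 : ‖(d : Ω)‖ * η ≤ 1 := mul_le_one₀ hd1 hη.le (by linarith)
      exact (mul_le_of_le_one_left hω0.le h9).trans S.ω_le
    have hEg : ‖E‖ * ‖g t (y t w)‖ ≤ ρ := by
      have h9 := hgdiff.trans hdω
      rw [← norm_mul] at h9 hEgh ⊢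
      rw [mul_sub] at h9
      exact norm_le_of_sub_le h9 hEgh
    refine ⟨hyk, hyh, hyρ, htD, h5, hgk, hEg, hψ.mem t ht h5 _ hgk hEg, ?_⟩
    refine norm_sub_le_of_le_of_le ?_ h6
    refine (hψ.lip hθ2 ht h5 ht h5 hgk hEg hgh hEgh).trans ?_
    rw [sub_self, norm_zero, mul_zero]
    exact max_le (by positivity) hgdiff
  refine ⟨⟨ht', k.mul_mem hy.L_mem ?_, k.mul_mem hy.E_mem ?_, mul_ne_zero hy.L_ne (norm_pos_iff.1 hβ0),
    mul_ne_zero hy.E_ne (norm_pos_iff.1 hβ0), ?_, ?_, ?_, ?_, ?_⟩, hβ2, ?_⟩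
  · exact k.mul_mem (k.mul_mem (k.mul_mem (k.mul_mem (natCast_mem k d) S.A_mem)
      (k.pow_mem hh _)) hψ.E_mem) S.σ_mem
  · exact k.mul_mem (k.mul_mem (k.mul_mem (k.mul_mem (natCast_mem k d) S.A_mem)
      (k.pow_mem hh _)) hψ.E_mem) S.σ_mem
  · intro t ht htρ
    exact hy.sub t ht (hpar t ht htρ).2.1
  · intro t ht htρ w hw hwρ
    obtain ⟨-, -, -, htD, -, -, -, h8, h9⟩ := hdom t ht htρ w hw hwρ
    exact S.f_mem t ht htD _ h8 h9
  · intro t ht htρ t₁ ht₁ htρ₁ w hw hwρ w₁ hw₁ hwρ₁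
    obtain ⟨a1, a2, a3, a4, a5, a6, a7, a8, a9⟩ := hdom t ht htρ w hw hwρ
    obtain ⟨b1, b2, b3, b4, b5, b6, b7, b8, b9⟩ := hdom t₁ ht₁ htρ₁ w₁ hw₁ hwρ₁
    have c1 := (hpar t ht htρ).2.1
    have c2 := (hpar t₁ ht₁ htρ₁).2.1
    have c3 := (hcoord w hwρ).trans hηh
    have c4 := (hcoord w₁ hwρ₁).trans hηh
    -- the error of the composition is estimated one factor at a time: `y`, then `g`, `ψ` and `f`,
    -- each relative to the product of the slopes of the factors so far
    set m := max (‖L'‖ * ‖t - t₁‖) (‖E'‖ * ‖w - w₁‖) with hm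
    have hm0 : 0 ≤ m := le_max_of_le_left (by positivity)
    have hLm : ‖L'‖ * ‖t - t₁‖ ≤ m := le_max_left _ _
    have hLm' : ‖L‖ * ‖t - t₁‖ ≤ m :=
      (mul_le_mul_of_nonneg_right hLL' (norm_nonneg _)).trans hLm
    have ey := hy.est t ht c1 t₁ ht₁ c2 w hw c3 w₁ hw₁ c4
    have ly := hy.lip hθ2 ht c1 ht₁ c2 hw c3 hw₁ c4
    rw [← hm] at ey ly
    have eg := S.g_fine t ht a4 t₁ ht₁ b4 h hh hhρ _ a1 _ b1 a2 b2
    rw [← hγ, ← hγn] at eg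
    have eg' : ‖g t (y t w) - g t₁ (y t₁ w₁) - γ * (y t w - y t₁ w₁)‖ ≤ θ * (‖γ‖ * m) := by
      refine eg.trans (max_le (by gcongr) ?_)
      have h1 : Λ * ‖h‖ ≤ θ * (‖(d : Ω)‖ * ‖A‖ * ‖L‖) :=
        (mul_le_mul_of_nonneg_left hhρ S.Λ_nonneg).trans hΛ1
      calc Λ * ‖h‖ ^ d * ‖t - t₁‖ = (Λ * ‖h‖) * (‖h‖ ^ (d - 1) * ‖t - t₁‖) := by
            rw [hpow]; ring
        _ ≤ (θ * (‖(d : Ω)‖ * ‖A‖ * ‖L‖)) * (‖h‖ ^ (d - 1) * ‖t - t₁‖) := by gcongr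
        _ = θ * (‖γ‖ * (‖L‖ * ‖t - t₁‖)) := by rw [hγn]; ring
        _ ≤ _ := by gcongr
    have lg : ‖g t (y t w) - g t₁ (y t₁ w₁)‖ ≤ ‖γ‖ * m := by
      refine norm_le_of_sub_le (eg'.trans ?_) ?_
      · exact mul_le_of_le_one_left (by positivity) hθ1
      · rw [norm_mul]; gcongr
    have eψ := hψ.est t ht a5 t₁ ht₁ b5 _ a6 a7 _ b6 b7
    have hEγ : m ≤ θ * (‖γ‖ * ‖E‖) * m := le_mul_of_one_le_left hm0 hγ1
    have hEγ1 : m ≤ ‖γ‖ * ‖E‖ * m := by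
      refine hEγ.trans ?_
      rw [mul_assoc]
      exact mul_le_of_le_one_left (by positivity) hθ1
    have eψ' : ‖ψ t (g t (y t w)) - ψ t₁ (g t₁ (y t₁ w₁)) - γ * E * (y t w - y t₁ w₁)‖ ≤
        θ * (‖γ‖ * ‖E‖ * m) := by
      have h1 : ψ t (g t (y t w)) - ψ t₁ (g t₁ (y t₁ w₁)) - γ * E * (y t w - y t₁ w₁) =
          (ψ t (g t (y t w)) - ψ t₁ (g t₁ (y t₁ w₁)) - L * (t - t₁) -
            E * (g t (y t w) - g t₁ (y t₁ w₁))) + (L * (t - t₁) +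
            E * (g t (y t w) - g t₁ (y t₁ w₁) - γ * (y t w - y t₁ w₁))) := by ring
      rw [h1]
      refine norm_add_le_of_le (eψ.trans ?_) (norm_add_le_of_le ?_ ?_)
      · refine mul_le_mul_of_nonneg_left (max_le (hLm'.trans hEγ1) ?_) hθ.le
        calc _ ≤ ‖E‖ * (‖γ‖ * m) := by gcongr
          _ = _ := by ring
      · rw [norm_mul]
        refine (hLm'.trans hEγ).trans (le_of_eq (by ring))
      · rw [norm_mul]
        calc _ ≤ ‖E‖ * (θ * (‖γ‖ * m)) := by gcongr
          _ = _ := by ring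
    have lψ : ‖ψ t (g t (y t w)) - ψ t₁ (g t₁ (y t₁ w₁))‖ ≤ ‖γ‖ * ‖E‖ * m := by
      refine norm_le_of_sub_le (eψ'.trans ?_) ?_
      · exact mul_le_of_le_one_left (by positivity) hθ1
      · rw [norm_mul, norm_mul]; gcongr
    have ef := S.f_est t ht a4 t₁ ht₁ b4 _ a8 _ b8 a9 b9
    have hgoal : θ * max (‖L' * β‖ * ‖t - t₁‖) (‖E' * β‖ * ‖w - w₁‖) = θ * (‖β‖ * m) := by
      rw [hm, norm_mul L', norm_mul E', mul_max_of_nonneg _ _ (norm_nonneg β)]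
      congr 2 <;> ring
    rw [hgoal]
    have h2 : f t (ψ t (g t (y t w))) - f t₁ (ψ t₁ (g t₁ (y t₁ w₁))) - L' * β * (t - t₁) -
        E' * β * (w - w₁) =
        (f t (ψ t (g t (y t w))) - f t₁ (ψ t₁ (g t₁ (y t₁ w₁))) -
          σ * (ψ t (g t (y t w)) - ψ t₁ (g t₁ (y t₁ w₁)))) +
        (σ * (ψ t (g t (y t w)) - ψ t₁ (g t₁ (y t₁ w₁)) - γ * E * (y t w - y t₁ w₁)) +
        β * (y t w - y t₁ w₁ - L' * (t - t₁) - E' * (w - w₁))) := by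
      rw [hβ]; ring
    show ‖f t (ψ t (g t (y t w))) - f t₁ (ψ t₁ (g t₁ (y t₁ w₁))) - L' * β * (t - t₁) -
        E' * β * (w - w₁)‖ ≤ _
    rw [h2]
    refine norm_add_le_of_le (ef.trans (max_le ?_ ?_)) (norm_add_le_of_le ?_ ?_)
    · calc _ ≤ θ * (‖σ‖ * (‖γ‖ * ‖E‖ * m)) := by gcongr
        _ = _ := by rw [hβn]; ring
    · calc Λ * ‖t - t₁‖ ≤ ‖L‖ * ‖t - t₁‖ := by gcongr
        _ ≤ 1 * m := by rw [one_mul]; exact hLm'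
        _ ≤ θ * ‖β‖ * m := by gcongr
        _ = _ := by ring
    · rw [norm_mul]
      calc _ ≤ ‖σ‖ * (θ * (‖γ‖ * ‖E‖ * m)) := by gcongr
        _ = _ := by rw [hβn]; ring
    · rw [norm_mul]
      calc _ ≤ ‖β‖ * (θ * m) := by gcongr
        _ = _ := by ring
  · have htt : ‖L' * β‖ * ‖t' - t'‖ ≤ ρ := by simpa using hρ.le
    have h0 : ‖E' * β‖ * ‖(0 : Ω)‖ ≤ ρ := by simpa using hρ.le
    obtain ⟨-, -, -, htD, -, -, -, h8, h9⟩ := hdom t' ht' htt 0 hk0 h0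
    exact S.f_bound t' ht' htD _ h8 h9
  · intro t ht htρ w hw hwρ
    obtain ⟨a1, a2, a3, a4, a5, a6, a7, a8, a9⟩ := hdom t ht htρ w hw hwρ
    rw [Function.iterate_add_apply, Function.iterate_add_apply, Function.iterate_add_apply,
      hy.dyn t ht (hpar t ht htρ).2.1 w hw ((hcoord w hwρ).trans hηh), S.dyn_g t ht a4 _ a1 a3,
      hψ.dyn t ht a5 _ a6 a7, S.dyn_f t ht a4 _ a8 a9]
  · intro t ht htρ
    exact (hpar t ht htρ).2

set_option maxHeartbeats 1000000 in
/-- From a stage of slopes `L`, `E` to one whose slopes are multiplied by `β ^ d`, where `β` is the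
slope of the loop through the point of coordinate about `h`. The loop is followed exactly `d`
times, so that the equation `E * A * h ^ d = ω`, whose solution `h` lies in `k`, is again solvable
in `k` at the next stage. -/
theorem Stage.next [CompleteSpace Ω] (S : ReturnSystem k D T P Q g f ℓ q d A ω σ θ η η' ρ Λ)
    {τ L E : Ω} {ψ : Ω → Ω → Ω} {n : ℕ} (hψ : Stage k D T P Q θ ρ τ L E ψ n)
    {h₀ : Ω} (hh₀ : h₀ ∈ k) (hE : E * (A * h₀ ^ d) = ω) (hhρ : ‖h₀‖ ≤ ρ)
    (hh1 : ‖h₀‖ ≤ θ * (‖(d : Ω)‖ * ‖ω‖)) (hh2 : ‖h₀‖ ≤ θ * (‖(d : Ω)‖ * ‖σ‖ * ‖ω‖))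
    (hh3 : ‖h₀‖ ≤ ‖(d : Ω)‖ * η * ‖ω‖)
    (hΛ1 : Λ * ρ ≤ θ * (‖(d : Ω)‖ * ‖A‖ * ‖L‖)) (hΛ2 : Λ ≤ ‖L‖) :
    ∃ (τ' L' E' : Ω) (ψ' : Ω → Ω → Ω) (n' : ℕ) (h' : Ω),
      Stage k D T P Q θ ρ τ' L' E' ψ' n' ∧ h' ∈ k ∧ E' * (A * h' ^ d) = ω ∧
      2 * ‖h'‖ ≤ ‖h₀‖ ∧ 2 * ‖L‖ ≤ ‖L'‖ ∧
      ∀ t ∈ k, ‖L'‖ * ‖t - τ'‖ ≤ ρ → ‖L‖ * ‖t - τ‖ ≤ ρ ∧ ‖ψ t 0‖ = ‖h₀‖ := by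
  have hθ := S.θ_pos
  have hθ2 := S.θ_le
  have hθ1 : θ ≤ 1 := by linarith
  have hη := S.η_pos
  have hη2 := S.η_le
  have hρ := S.ρ_pos
  have hd0 : 0 < ‖(d : Ω)‖ := norm_pos_iff.2 S.d_ne
  have hd1 : ‖(d : Ω)‖ ≤ 1 := IsUltrametricDist.norm_natCast_le_one Ω d
  have hω0 : 0 < ‖ω‖ := norm_pos_iff.2 S.ω_ne
  have hA0 : 0 < ‖A‖ := norm_pos_iff.2 S.A_ne
  have hE0 : 0 < ‖E‖ := norm_pos_iff.2 hψ.E_ne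
  have hL0 : 0 < ‖L‖ := norm_pos_iff.2 hψ.L_ne
  have hd' : d ≠ 0 := by have := S.d_pos; omega
  have hη'0 : 0 ≤ η' := by
    by_contra! hc
    have := S.θ_le'
    nlinarith
  have hη'1 : η' ≤ 1 := by have := S.η'_le; linarith
  have hh0 : h₀ ≠ 0 := by
    rintro rfl
    rw [zero_pow hd', mul_zero, mul_zero] at hE
    exact S.ω_ne hE.symm
  have hh0' : 0 < ‖h₀‖ := norm_pos_iff.2 hh0
  have hhE : ‖E‖ * (‖A‖ * ‖h₀‖ ^ d) = ‖ω‖ := by rw [← hE, norm_mul, norm_mul, norm_pow]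
  have hpow : ‖h₀‖ ^ d = ‖h₀‖ ^ (d - 1) * ‖h₀‖ := by
    rw [← pow_succ]; congr 1; omega
  have hk0 : (0 : Ω) ∈ k := k.zero_mem
  have hE00 : ‖E‖ * ‖(0 : Ω)‖ ≤ ρ := by simpa using hρ.le
  have hττ : ‖L‖ * ‖τ - τ‖ ≤ ρ := by simpa using hρ.le
  -- the map `t ↦ ψ t 0` is approximately linear on the whole parameter ball
  have hsurj : ∀ {τ₁ L₁ E₁ : Ω} {ψ₁ : Ω → Ω → Ω} {n₁ : ℕ} (_ : Stage k D T P Q θ ρ τ₁ L₁ E₁ ψ₁ n₁),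
      ∀ z ∈ k, ‖z‖ ≤ ρ → ∃ t ∈ k, ‖L₁‖ * ‖t - τ₁‖ ≤ ρ ∧ ψ₁ t 0 = z := by
    intro τ₁ L₁ E₁ ψ₁ n₁ h₁ z hz hzρ
    have h0 : ‖E₁‖ * ‖(0 : Ω)‖ ≤ ρ := by simpa using hρ.le
    refine exists_eq_of_approxLinear S.closed (φ := fun t => ψ₁ t 0) hθ.le (by linarith) hρ.le
      h₁.L_mem h₁.L_ne h₁.τ_mem (fun t ht htρ => h₁.mem t ht htρ 0 hk0 h0) ?_ hz
      (norm_sub_le_of_le hzρ h₁.center)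
    intro t ht t' ht' htρ htρ'
    have := h₁.est t ht htρ t' ht' htρ' 0 hk0 h0 0 hk0 h0
    rwa [sub_self (0 : Ω), mul_zero, sub_zero, norm_zero, mul_zero,
      max_eq_left (by positivity)] at this
  -- at `t₁` the stage takes the critical value exactly to the critical point
  obtain ⟨t₁, ht₁, ht₁ρ, hψt₁⟩ := hsurj hψ 0 hk0 (by simpa using hρ.le)
  have ht₁D := hψ.sub t₁ ht₁ ht₁ρ
  -- the exact solution `h` of `ψ t₁ (g t₁ h) = ω` near `h₀`
  set γ₀ : Ω := d * A * h₀ ^ (d - 1) with hγ₀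
  have hγ₀n : ‖γ₀‖ = ‖(d : Ω)‖ * ‖A‖ * ‖h₀‖ ^ (d - 1) := by
    rw [hγ₀, norm_mul, norm_mul, norm_pow]
  have hγ₀0 : γ₀ ≠ 0 := mul_ne_zero (mul_ne_zero S.d_ne S.A_ne) (pow_ne_zero _ hh0)
  have hγ₀p : 0 < ‖γ₀‖ := norm_pos_iff.2 hγ₀0
  have hγE : ‖γ₀‖ * ‖E‖ * ‖h₀‖ = ‖(d : Ω)‖ * ‖ω‖ := by rw [hγ₀n, ← hhE, hpow]; ring
  have hrad : ∀ y : Ω, ‖E * γ₀‖ * ‖y - h₀‖ ≤ ‖(d : Ω)‖ * ‖ω‖ * η' → ‖y - h₀‖ ≤ η' * ‖h₀‖ := by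
    intro y hy
    rw [← hγE, norm_mul] at hy
    have : (‖E‖ * ‖γ₀‖) * ‖y - h₀‖ ≤ (‖E‖ * ‖γ₀‖) * (η' * ‖h₀‖) := by linarith
    exact le_of_mul_le_mul_left this (by positivity)
  have hself : ‖h₀ - h₀‖ ≤ η' * ‖h₀‖ := by rw [sub_self, norm_zero]; positivity
  have hgval : ∀ t ∈ k, t ∈ D → ‖E‖ * ‖g t h₀‖ = ‖ω‖ := by
    intro t ht htD
    have := S.g_val t ht htD h₀ hh₀ hhρ
    rw [← norm_pow, ← norm_mul] at this
    rw [norm_eq_of_sub_le (by linarith) this, norm_mul, norm_pow, hhE]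
  have hdom : ∀ y ∈ k, ‖y - h₀‖ ≤ η' * ‖h₀‖ →
      ‖y‖ ≤ ρ ∧ g t₁ y ∈ k ∧ ‖E‖ * ‖g t₁ y‖ ≤ ρ := by
    intro y hy hyh
    have h1 : ‖y‖ ≤ ‖h₀‖ :=
      norm_le_of_sub_le (hyh.trans (mul_le_of_le_one_left hh0'.le hη'1)) le_rfl
    refine ⟨h1.trans hhρ, S.g_mem t₁ ht₁ ht₁D y hy (h1.trans hhρ), ?_⟩
    have h2 := S.g_coarse t₁ ht₁ ht₁D h₀ hh₀ hhρ y hy h₀ hh₀ hyh hself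
    rw [← hγ₀, ← hγ₀n] at h2
    have h3 : ‖g t₁ y - g t₁ h₀‖ ≤ ‖γ₀‖ * ‖y - h₀‖ :=
      norm_le_of_sub_le (h2.trans (mul_le_of_le_one_left (by positivity) (by norm_num)))
        (norm_mul _ _).le
    have h4 : ‖E‖ * ‖g t₁ y - g t₁ h₀‖ ≤ ρ := by
      calc ‖E‖ * ‖g t₁ y - g t₁ h₀‖ ≤ ‖E‖ * (‖γ₀‖ * (η' * ‖h₀‖)) := by
            gcongr; exact h3.trans (by gcongr)
        _ = η' * (‖γ₀‖ * ‖E‖ * ‖h₀‖) := by ring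
        _ = η' * ‖(d : Ω)‖ * ‖ω‖ := by rw [hγE]; ring
        _ ≤ ‖ω‖ := mul_le_of_le_one_left hω0.le (mul_le_one₀ hη'1 hd0.le hd1)
        _ ≤ ρ := S.ω_le
    have h5 := (hgval t₁ ht₁ ht₁D).le.trans S.ω_le
    rw [← norm_mul] at h4 h5 ⊢
    rw [mul_sub] at h4
    exact norm_le_of_sub_le h4 h5
  obtain ⟨h, hh, hhrad, hhω⟩ : ∃ h ∈ k, ‖E * γ₀‖ * ‖h - h₀‖ ≤ ‖(d : Ω)‖ * ‖ω‖ * η' ∧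
      ψ t₁ (g t₁ h) = ω := by
    refine exists_eq_of_approxLinear S.closed (φ := fun y => ψ t₁ (g t₁ y)) (θ := 1 / 2)
      (by norm_num) (by norm_num) (by positivity) ?_ (mul_ne_zero hψ.E_ne hγ₀0) hh₀ ?_ ?_
      S.ω_mem ?_
    · exact k.mul_mem hψ.E_mem
        (k.mul_mem (k.mul_mem (natCast_mem k d) S.A_mem) (k.pow_mem hh₀ _))
    · intro y hy hyr
      obtain ⟨-, h2, h3⟩ := hdom y hy (hrad y hyr)
      exact hψ.mem t₁ ht₁ ht₁ρ _ h2 h3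
    · intro y hy y' hy' hyr hyr'
      obtain ⟨-, a2, a3⟩ := hdom y hy (hrad y hyr)
      obtain ⟨-, b2, b3⟩ := hdom y' hy' (hrad y' hyr')
      have e1 := hψ.est t₁ ht₁ ht₁ρ t₁ ht₁ ht₁ρ _ a2 a3 _ b2 b3
      rw [sub_self, mul_zero, sub_zero, norm_zero, mul_zero, max_eq_right (by positivity)] at e1
      have e2 := S.g_coarse t₁ ht₁ ht₁D h₀ hh₀ hhρ y hy y' hy' (hrad y hyr) (hrad y' hyr')
      rw [← hγ₀, ← hγ₀n] at e2
      have e3 : ‖g t₁ y - g t₁ y'‖ ≤ ‖γ₀‖ * ‖y - y'‖ :=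
        norm_le_of_sub_le (e2.trans (mul_le_of_le_one_left (by positivity) (by norm_num)))
          (norm_mul _ _).le
      have e4 : ψ t₁ (g t₁ y) - ψ t₁ (g t₁ y') - E * γ₀ * (y - y') =
          (ψ t₁ (g t₁ y) - ψ t₁ (g t₁ y') - E * (g t₁ y - g t₁ y')) +
          E * (g t₁ y - g t₁ y' - γ₀ * (y - y')) := by ring
      show ‖ψ t₁ (g t₁ y) - ψ t₁ (g t₁ y') - E * γ₀ * (y - y')‖ ≤ _
      rw [e4, norm_mul E γ₀]
      refine norm_add_le_of_le (e1.trans ?_) ?_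
      · calc θ * (‖E‖ * ‖g t₁ y - g t₁ y'‖) ≤ 1 / 2 * (‖E‖ * (‖γ₀‖ * ‖y - y'‖)) := by gcongr
          _ = _ := by ring
      · rw [norm_mul]
        calc _ ≤ ‖E‖ * (1 / 2 * (‖γ₀‖ * ‖y - y'‖)) := by gcongr
          _ = _ := by ring
    · obtain ⟨-, a2, a3⟩ := hdom h₀ hh₀ hself
      have e1 := hψ.est t₁ ht₁ ht₁ρ t₁ ht₁ ht₁ρ _ a2 a3 0 hk0 hE00
      rw [sub_self, mul_zero, sub_zero, norm_zero, mul_zero, max_eq_right (by positivity),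
        hψt₁, sub_zero, sub_zero, hgval t₁ ht₁ ht₁D] at e1
      have e2 := S.g_val t₁ ht₁ ht₁D h₀ hh₀ hhρ
      have e3 : ‖E * g t₁ h₀ - ω‖ ≤ θ * ‖ω‖ := by
        rw [← hE, ← mul_sub, norm_mul, hE, ← hhE]
        calc _ ≤ ‖E‖ * (θ * (‖A‖ * ‖h₀‖ ^ d)) := by gcongr
          _ = _ := by ring
      have e4 := norm_sub_le_of_le_of_le e1 e3
      rw [norm_sub_rev]
      refine e4.trans ?_
      calc θ * ‖ω‖ ≤ ‖(d : Ω)‖ * η' * ‖ω‖ := by gcongr; exact S.θ_le'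
        _ = _ := by ring
  have hhn : ‖h‖ = ‖h₀‖ := by
    refine norm_eq_of_sub_le (θ := η') ?_ (hrad h hhrad)
    have := S.η'_le
    linarith
  obtain ⟨-, hgh, hEgh⟩ := hdom h hh (hrad h hhrad)
  -- at `t₂` it takes the critical value to the point of coordinate `h`; the next stage lives nearby
  obtain ⟨t₂, ht₂, ht₂ρ, hψt₂⟩ := hsurj hψ h hh (hhn.le.trans hhρ)
  have ht₂D := hψ.sub t₂ ht₂ ht₂ρ
  have ht₂₁ : ‖L‖ * ‖t₂ - t₁‖ ≤ ‖h₀‖ := by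
    have e1 := hψ.est t₂ ht₂ ht₂ρ t₁ ht₁ ht₁ρ 0 hk0 hE00 0 hk0 hE00
    rw [hψt₁, hψt₂, sub_zero, sub_zero, mul_zero, sub_zero, norm_zero, mul_zero,
      max_eq_left (by positivity), ← norm_mul] at e1
    rw [← norm_mul, ← norm_eq_of_sub_le (by linarith) e1, hhn]
  have hη₀ : η * ‖h₀‖ ≤ ‖h₀‖ := mul_le_of_le_one_left hh0'.le (by linarith)
  have htgt : ∀ t ∈ k, ‖L‖ * ‖t - t₂‖ ≤ η * ‖h‖ →
      ‖L‖ * ‖t - τ‖ ≤ ρ ∧ ‖ψ t (g t h) - ω‖ ≤ ‖(d : Ω)‖ * η * ‖ω‖ := by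
    intro t ht htr
    rw [hhn] at htr
    have e1 : ‖L‖ * ‖t - τ‖ ≤ ρ := by
      have h1 := (htr.trans hη₀).trans hhρ
      rw [← norm_mul, mul_sub] at h1 ht₂ρ ⊢
      exact norm_sub_le_of_le_of_le h1 ht₂ρ
    have e2 : ‖L‖ * ‖t - t₁‖ ≤ ‖h₀‖ := by
      have h1 := htr.trans hη₀
      rw [← norm_mul, mul_sub] at h1 ht₂₁ ⊢
      exact norm_sub_le_of_le_of_le h1 ht₂₁
    refine ⟨e1, ?_⟩
    have htD := hψ.sub t ht e1
    have e3 : ‖E‖ * ‖g t h - g t₁ h‖ ≤ ‖h₀‖ := by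
      have h1 := S.g_fine t ht htD t₁ ht₁ ht₁D h hh (hhn.le.trans hhρ) h hh h hh
        (by rw [sub_self, norm_zero]; positivity) (by rw [sub_self, norm_zero]; positivity)
      rw [sub_self, mul_zero, sub_zero, norm_zero, mul_zero, mul_zero,
        max_eq_right (mul_nonneg (mul_nonneg S.Λ_nonneg (by positivity)) (norm_nonneg _)),
        hhn] at h1
      have h2 : (‖A‖ * ‖L‖) * (‖E‖ * ‖g t h - g t₁ h‖) ≤ (‖A‖ * ‖L‖) * ‖h₀‖ := by
        calc (‖A‖ * ‖L‖) * (‖E‖ * ‖g t h - g t₁ h‖)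
            ≤ (‖A‖ * ‖L‖) * (‖E‖ * (Λ * ‖h₀‖ ^ d * ‖t - t₁‖)) := by gcongr
          _ = Λ * ‖ω‖ * (‖L‖ * ‖t - t₁‖) := by rw [← hhE]; ring
          _ ≤ Λ * ρ * ‖h₀‖ :=
              mul_le_mul (mul_le_mul_of_nonneg_left S.ω_le S.Λ_nonneg) e2 (by positivity)
                (mul_nonneg S.Λ_nonneg hρ.le)
          _ ≤ θ * (‖(d : Ω)‖ * ‖A‖ * ‖L‖) * ‖h₀‖ := by gcongr
          _ = (θ * ‖(d : Ω)‖) * ((‖A‖ * ‖L‖) * ‖h₀‖) := by ring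
          _ ≤ _ := mul_le_of_le_one_left (by positivity) (mul_le_one₀ hθ1 hd0.le hd1)
      exact le_of_mul_le_mul_left h2 (by positivity)
    have hgt : g t h ∈ k := S.g_mem t ht htD h hh (hhn.le.trans hhρ)
    have hEgt : ‖E‖ * ‖g t h‖ ≤ ρ := by
      have h1 := e3.trans hhρ
      rw [← norm_mul] at h1 hEgh ⊢
      rw [mul_sub] at h1
      exact norm_le_of_sub_le h1 hEgh
    have e4 := hψ.lip hθ2 ht e1 ht₁ ht₁ρ hgt hEgt hgh hEgh
    rw [hhω] at e4
    exact e4.trans (max_le (e2.trans hh3) (e3.trans hh3))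
  set β : Ω := d * A * h ^ (d - 1) * E * σ with hβ
  have hhE' : ‖E‖ * (‖A‖ * ‖h‖ ^ d) = ‖ω‖ := by rw [hhn, hhE]
  have hL2 : ∀ {L' : Ω}, ‖L‖ ≤ ‖L'‖ → 2 ≤ ‖β‖ → ‖L‖ ≤ ‖L' * β‖ := by
    intro L' h1 h2
    rw [norm_mul]
    nlinarith [norm_nonneg L']
  -- the loop through `h`, followed `i` times after the first passage
  have hloop : ∀ i : ℕ, ∃ (τ' : Ω) (y : Ω → Ω → Ω) (n' : ℕ) (t' : Ω),
      Stage k D T P Q θ ρ τ' (L * β ^ i) (E * β ^ i) y n' ∧ ‖L‖ ≤ ‖L * β ^ i‖ ∧ t' ∈ k ∧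
      ‖L * β ^ i‖ * ‖t' - τ'‖ ≤ ρ ∧ y t' 0 = h ∧ ‖L‖ * ‖t' - t₂‖ ≤ η * ‖h‖ := by
    intro i
    induction i with
    | zero =>
      refine ⟨τ, ψ, n, t₂, by simpa using hψ, by simp, ht₂, by simpa using ht₂ρ, hψt₂, ?_⟩
      rw [sub_self, norm_zero, mul_zero]
      positivity
    | succ i ih =>
      obtain ⟨τ', y, n', t', hy, hLL, ht', htτ', hyt', htt'⟩ := ih
      obtain ⟨hs, hβ2, hsub⟩ := Stage.comp S hψ hh hhE' (hhn.le.trans hhρ) (hhn.le.trans hh1)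
        (hhn.le.trans hh2) hΛ1 hΛ2 htgt hy hLL ht' htτ' hyt' htt'
      rw [← hβ] at hs hβ2 hsub
      obtain ⟨t'', ht'', htr'', hyt''⟩ := hsurj hs h hh (hhn.le.trans hhρ)
      refine ⟨_, _, _, t'', by simpa [pow_succ, mul_assoc] using hs, ?_, ht'', ?_, hyt'',
        (hsub t'' ht'' htr'').2⟩
      · have := hL2 hLL hβ2
        rwa [mul_assoc, ← pow_succ] at this
      · rwa [mul_assoc, ← pow_succ] at htr''
  obtain ⟨τ', y, n', t', hy, hLL, ht', htτ', hyt', htt'⟩ := hloop (d - 1)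
  obtain ⟨hs, hβ2, hsub⟩ := Stage.comp S hψ hh hhE' (hhn.le.trans hhρ) (hhn.le.trans hh1)
    (hhn.le.trans hh2) hΛ1 hΛ2 htgt hy hLL ht' htτ' hyt' htt'
  rw [← hβ] at hs hβ2 hsub
  have hβ0 : β ≠ 0 := norm_pos_iff.1 (by linarith)
  have hdd : d - 1 + 1 = d := by have := S.d_pos; omega
  rw [mul_assoc, mul_assoc, ← pow_succ, hdd] at hs
  rw [mul_assoc, ← pow_succ, hdd] at hsub
  have hβk : β ∈ k := k.mul_mem (k.mul_mem (k.mul_mem (k.mul_mem (natCast_mem k d) S.A_mem)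
      (k.pow_mem hh _)) hψ.E_mem) S.σ_mem
  -- as `E` has been multiplied by `β ^ d`, dividing `h₀` by `β` solves the equation again
  refine ⟨_, _, _, _, _, h₀ / β, hs, k.div_mem hh₀ hβk, ?_, ?_, ?_, ?_⟩
  · rw [← hE, div_pow]
    field_simp
  · rw [norm_div]
    have : ‖h₀‖ / ‖β‖ ≤ ‖h₀‖ / 2 := by gcongr
    linarith
  · rw [← hdd, pow_succ, ← mul_assoc, norm_mul]
    nlinarith [norm_nonneg L]
  · intro t ht htr
    have h1 := (hsub t ht htr).2
    obtain ⟨h2, -⟩ := htgt t ht h1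
    refine ⟨h2, ?_⟩
    have h3 := hψ.lip hθ2 ht h2 ht₂ ht₂ρ hk0 hE00 hk0 hE00
    rw [sub_self, norm_zero, mul_zero, max_eq_left (by positivity), hψt₂] at h3
    rw [← hhn]
    exact norm_eq_of_sub_le (by linarith) (h3.trans h1)

/-- Starting from one stage with `h₀` small, the stages can be continued indefinitely, and at
their common parameter the critical point returns arbitrarily close to itself without ever
hitting itself at these returns. -/
theorem exists_recurrent_parameter [CompleteSpace Ω]
    (S : ReturnSystem k D T P Q g f ℓ q d A ω σ θ η η' ρ Λ)
    (hg0 : ∀ t ∈ k, t ∈ D → g t 0 = 0)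
    {τ L E : Ω} {ψ : Ω → Ω → Ω} {n : ℕ} (hψ : Stage k D T P Q θ ρ τ L E ψ n)
    {h₀ : Ω} (hh₀ : h₀ ∈ k) (hE : E * (A * h₀ ^ d) = ω) (hhρ : ‖h₀‖ ≤ ρ)
    (hh1 : ‖h₀‖ ≤ θ * (‖(d : Ω)‖ * ‖ω‖)) (hh2 : ‖h₀‖ ≤ θ * (‖(d : Ω)‖ * ‖σ‖ * ‖ω‖))
    (hh3 : ‖h₀‖ ≤ ‖(d : Ω)‖ * η * ‖ω‖)
    (hΛ1 : Λ * ρ ≤ θ * (‖(d : Ω)‖ * ‖A‖ * ‖L‖)) (hΛ2 : Λ ≤ ‖L‖) :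
    ∃ t ∈ k, t ∈ D ∧ ∀ ε > 0, ∃ (m : ℕ) (y : Ω), y ≠ 0 ∧ ‖y‖ < ε ∧
      (T t)^[m] (P t 0) = P t y := by
  have hρ := S.ρ_pos
  have hd' : d ≠ 0 := by have := S.d_pos; omega
  -- a stage `(τ, L, E, ψ, n)` together with a solution `h ∈ k` of `E * A * h ^ d = ω`
  let V := {s : Ω × Ω × Ω × (Ω → Ω → Ω) × ℕ × Ω //
    Stage k D T P Q θ ρ s.1 s.2.1 s.2.2.1 s.2.2.2.1 s.2.2.2.2.1 ∧ s.2.2.2.2.2 ∈ k ∧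
    s.2.2.1 * (A * s.2.2.2.2.2 ^ d) = ω ∧ ‖s.2.2.2.2.2‖ ≤ ‖h₀‖ ∧ ‖L‖ ≤ ‖s.2.1‖}
  have hnext : ∀ s : V, ∃ s' : V, 2 * ‖s'.1.2.2.2.2.2‖ ≤ ‖s.1.2.2.2.2.2‖ ∧
      2 * ‖s.1.2.1‖ ≤ ‖s'.1.2.1‖ ∧ ∀ t ∈ k, ‖s'.1.2.1‖ * ‖t - s'.1.1‖ ≤ ρ →
        ‖s.1.2.1‖ * ‖t - s.1.1‖ ≤ ρ ∧ ‖s.1.2.2.2.1 t 0‖ = ‖s.1.2.2.2.2.2‖ := by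
    rintro ⟨⟨τ₁, L₁, E₁, ψ₁, n₁, h₁⟩, hs, hh, hEh, hhh, hL⟩
    dsimp only at hs hh hEh hhh hL
    have hθ := S.θ_pos
    obtain ⟨τ₂, L₂, E₂, ψ₂, n₂, h₂, a1, a2, a3, a4, a5, a6⟩ := Stage.next S hs hh hEh
      (hhh.trans hhρ) (hhh.trans hh1) (hhh.trans hh2) (hhh.trans hh3)
      (hΛ1.trans (by gcongr)) (hΛ2.trans hL)
    refine ⟨⟨⟨τ₂, L₂, E₂, ψ₂, n₂, h₂⟩, a1, a2, a3, ?_, ?_⟩, a4, a5, a6⟩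
    · dsimp only; linarith [norm_nonneg h₂]
    · dsimp only; linarith [norm_nonneg L₁]
  choose nx hnx1 hnx2 hnx3 using hnext
  let s : ℕ → V := fun i => Nat.rec ⟨(τ, L, E, ψ, n, h₀), hψ, hh₀, hE, le_rfl, le_rfl⟩
    (fun _ v => nx v) i
  have hs1 : ∀ i, s (i + 1) = nx (s i) := fun i => rfl
  have hL0 : 0 < ‖L‖ := norm_pos_iff.2 hψ.L_ne
  have hLi : ∀ i, 2 ^ i * ‖L‖ ≤ ‖(s i).1.2.1‖ := by
    intro i
    induction i with
    | zero => simp [s]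
    | succ i ih =>
      have := hnx2 (s i)
      rw [hs1, pow_succ]
      linarith
  have hhi : ∀ i, ‖(s i).1.2.2.2.2.2‖ ≤ (1 / 2) ^ i * ‖h₀‖ := by
    intro i
    induction i with
    | zero => simp [s]
    | succ i ih =>
      have := hnx1 (s i)
      rw [hs1, pow_succ]
      linarith
  have hnest : ∀ i j : ℕ, ∀ t ∈ k, ‖(s (i + j)).1.2.1‖ * ‖t - (s (i + j)).1.1‖ ≤ ρ →
      ‖(s i).1.2.1‖ * ‖t - (s i).1.1‖ ≤ ρ := by
    intro i j
    induction j with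
    | zero => intro t _ h; exact h
    | succ j ih =>
      intro t ht h
      exact ih t ht (hnx3 (s (i + j)) t ht h).1
  have hmem : ∀ i, (s i).1.1 ∈ k := fun i => (s i).2.1.τ_mem
  have hnest' : ∀ i j : ℕ, i ≤ j → ‖(s i).1.2.1‖ * ‖(s j).1.1 - (s i).1.1‖ ≤ ρ := by
    intro i j hij
    obtain ⟨m, rfl⟩ := Nat.exists_eq_add_of_le hij
    exact hnest i m _ (hmem _) (by simpa using hρ.le)
  -- the nested parameter balls shrink to a point, which lies in the closed field `k`
  have hcau : CauchySeq fun i => (s i).1.1 := by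
    refine cauchySeq_of_le_tendsto_0' (fun i => ρ / ‖L‖ * (1 / 2) ^ i) ?_ ?_
    · intro i j hij
      have h1 := hnest' i j hij
      have h2 := hLi i
      rw [dist_eq_norm, norm_sub_rev, div_mul_eq_mul_div, le_div_iff₀ hL0]
      have h3 : 2 ^ i * ‖L‖ * ‖(s j).1.1 - (s i).1.1‖ ≤ ρ :=
        (mul_le_mul_of_nonneg_right h2 (norm_nonneg _)).trans h1
      rw [one_div, inv_pow, ← div_eq_mul_inv, le_div_iff₀ (by positivity)]
      linarith
    · have := tendsto_pow_atTop_nhds_zero_of_lt_one (r := (1 / 2 : ℝ)) (by norm_num) (by norm_num)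
      simpa using this.const_mul (ρ / ‖L‖)
  obtain ⟨t, ht⟩ := cauchySeq_tendsto_of_complete hcau
  have htk : t ∈ k := S.closed.mem_of_tendsto ht (Eventually.of_forall hmem)
  have htball : ∀ i, ‖(s i).1.2.1‖ * ‖t - (s i).1.1‖ ≤ ρ := by
    intro i
    refine le_of_tendsto (((ht.sub_const _).norm).const_mul _) ?_
    filter_upwards [eventually_ge_atTop i] with j hij
    exact hnest' i j hij
  have htD : t ∈ D := hψ.sub t htk (htball 0)
  refine ⟨t, htk, htD, ?_⟩
  intro ε hε
  obtain ⟨i, hi⟩ : ∃ i : ℕ, (1 / 2 : ℝ) ^ i * ‖h₀‖ < ε := by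
    have := (tendsto_pow_atTop_nhds_zero_of_lt_one (r := (1 / 2 : ℝ)) (by norm_num)
      (by norm_num)).mul_const ‖h₀‖
    rw [zero_mul] at this
    exact (this.eventually (gt_mem_nhds hε)).exists
  have hE0 : ‖(s i).1.2.2.1‖ * ‖(0 : Ω)‖ ≤ ρ := by simpa using hρ.le
  -- the size of the return of stage `i` is read off on the parameter ball of the following stage
  have hv := (hnx3 (s i) t htk (htball (i + 1))).2
  refine ⟨(s i).1.2.2.2.2.1 + ℓ, (s i).1.2.2.2.1 t 0, ?_, ?_, ?_⟩
  · intro h0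
    rw [h0, norm_zero] at hv
    have h1 := (s i).2.2.2.1
    rw [norm_eq_zero.1 hv.symm, zero_pow hd', mul_zero, mul_zero] at h1
    exact S.ω_ne h1.symm
  · rw [hv]
    exact (hhi i).trans_lt hi
  · have h1 := S.dyn_g t htk htD 0 k.zero_mem (by simpa using hρ.le)
    rw [Function.iterate_add_apply, h1, hg0 t htk htD]
    exact (s i).2.1.dyn t htk (htball i) 0 k.zero_mem hE0

end Returns

/-! ### The local model of a Misiurewicz bifurcation -/

section Model

variable {Ω : Type*} [NormedField Ω] [IsUltrametricDist Ω]

/-- Composition of approximately linear maps depending on a parameter; `τ` bounds the distance of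
the two parameters. -/
theorem approx_comp {a a' b c c' S₁ S₂ : Ω} {θ C₁ C₂ τ : ℝ} (hθ0 : 0 ≤ θ) (hθ : θ ≤ 1)
    (hτ : 0 ≤ τ)
    (h₁ : ‖a - a' - S₁ * b‖ ≤ max (θ * (‖S₁‖ * ‖b‖)) (C₁ * τ))
    (h₂ : ‖c - c' - S₂ * (a - a')‖ ≤ max (θ * (‖S₂‖ * ‖a - a'‖)) (C₂ * τ)) :
    ‖c - c' - S₂ * S₁ * b‖ ≤ max (θ * (‖S₂ * S₁‖ * ‖b‖)) (max (‖S₂‖ * C₁) C₂ * τ) := by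
  have e : c - c' - S₂ * S₁ * b = (c - c' - S₂ * (a - a')) + S₂ * (a - a' - S₁ * b) := by ring
  have haa : ‖a - a'‖ ≤ max (‖S₁‖ * ‖b‖) (C₁ * τ) :=
    norm_le_of_sub_le (h₁.trans (max_le_max (mul_le_of_le_one_left (by positivity) hθ) le_rfl))
      (by rw [norm_mul]; exact le_max_left _ _)
  have hmul : ‖S₂‖ * max (θ * (‖S₁‖ * ‖b‖)) (C₁ * τ) ≤
      max (θ * (‖S₂ * S₁‖ * ‖b‖)) (max (‖S₂‖ * C₁) C₂ * τ) := by
    rw [mul_max_of_nonneg _ _ (norm_nonneg S₂), norm_mul]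
    refine max_le_max (le_of_eq (by ring)) ?_
    rw [← mul_assoc]
    gcongr
    exact le_max_left _ _
  rw [e]
  refine norm_add_le_of_le (h₂.trans (max_le ?_ ?_)) ?_
  · rcases le_total (‖S₁‖ * ‖b‖) (C₁ * τ) with h | h
    · rw [max_eq_right h] at haa
      refine le_max_of_le_right ?_
      calc θ * (‖S₂‖ * ‖a - a'‖) ≤ ‖S₂‖ * ‖a - a'‖ := mul_le_of_le_one_left (by positivity) hθ
        _ ≤ ‖S₂‖ * (C₁ * τ) := by gcongr
        _ = ‖S₂‖ * C₁ * τ := by ring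
        _ ≤ _ := by gcongr; exact le_max_left _ _
    · rw [max_eq_left h] at haa
      refine le_max_of_le_left ?_
      calc θ * (‖S₂‖ * ‖a - a'‖) ≤ θ * (‖S₂‖ * (‖S₁‖ * ‖b‖)) := by gcongr
        _ = _ := by rw [norm_mul]; ring
  · exact le_max_of_le_right (by gcongr; exact le_max_right _ _)
  · rw [norm_mul]
    exact (mul_le_mul_of_nonneg_left h₁ (norm_nonneg _)).trans hmul

/-- A map of the form `y ^ d * v` with `v` nearly constant is approximately linear near any point
`h` close to `0`. -/
theorem norm_pow_mul_sub_pow_mul_le {y y' h v v' A : Ω} {d : ℕ} {e θ B Λ τ : ℝ}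
    (hd : (d : Ω) ≠ 0) (he0 : 0 ≤ e) (he : e ≤ 1) (heθ : e ≤ θ * ‖(d : Ω)‖)
    (hd1 : 1 ≤ d)
    (hy : ‖y - h‖ ≤ e * ‖h‖) (hy' : ‖y' - h‖ ≤ e * ‖h‖)
    (hv : ‖v - A‖ ≤ θ * (‖(d : Ω)‖ * ‖A‖)) (hB : ‖h‖ * Λ ≤ θ * (‖(d : Ω)‖ * ‖A‖))
    (hvv : ‖v - v'‖ ≤ Λ * max τ ‖y - y'‖) (hΛB : Λ ≤ B) (hτ : 0 ≤ τ) :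
    ‖y ^ d * v - y' ^ d * v' - d * A * h ^ (d - 1) * (y - y')‖ ≤
      max (θ * (‖(d : Ω)‖ * ‖A‖ * ‖h‖ ^ (d - 1) * ‖y - y'‖)) (B * ‖h‖ ^ d * τ) := by
  have hdn : ‖(d : Ω)‖ ≤ 1 := IsUltrametricDist.norm_natCast_le_one Ω d
  have hd0 : 0 < ‖(d : Ω)‖ := norm_pos_iff.2 hd
  have hpow : ‖h‖ ^ d = ‖h‖ ^ (d - 1) * ‖h‖ := by
    rw [← pow_succ]; congr 1; omega
  have hp := norm_pow_sub_pow_sub_le he0 he hy hy' d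
  have hyn' : ‖y'‖ ≤ ‖h‖ :=
    norm_le_of_sub_le (hy'.trans (mul_le_of_le_one_left (norm_nonneg _) he)) le_rfl
  have hpd : ‖y ^ d - y' ^ d‖ ≤ ‖h‖ ^ (d - 1) * ‖y - y'‖ := by
    refine norm_le_of_sub_le (hp.trans ?_) ?_
    · rw [mul_assoc]
      exact mul_le_of_le_one_left (by positivity) he
    · rw [norm_mul, norm_mul, norm_pow, mul_assoc]
      exact mul_le_of_le_one_left (by positivity) hdn
  have e1 : y ^ d * v - y' ^ d * v' - d * A * h ^ (d - 1) * (y - y') =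
      A * (y ^ d - y' ^ d - d * h ^ (d - 1) * (y - y')) +
      ((v - A) * (y ^ d - y' ^ d) + y' ^ d * (v - v')) := by ring
  rw [e1]
  refine norm_add_le_of_le ?_ (norm_add_le_of_le ?_ ?_)
  · refine le_max_of_le_left ?_
    rw [norm_mul]
    calc ‖A‖ * _ ≤ ‖A‖ * (θ * ‖(d : Ω)‖ * ‖h‖ ^ (d - 1) * ‖y - y'‖) := by
          gcongr
          exact hp.trans (by gcongr)
      _ = _ := by ring
  · refine le_max_of_le_left ?_
    rw [norm_mul]
    calc _ ≤ θ * (‖(d : Ω)‖ * ‖A‖) * (‖h‖ ^ (d - 1) * ‖y - y'‖) := by gcongr; exact (norm_nonneg _).trans hv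
      _ = _ := by ring
  · rw [norm_mul, norm_pow]
    have h2 : ‖y'‖ ^ d * ‖v - v'‖ ≤ ‖h‖ ^ d * (Λ * max τ ‖y - y'‖) := by gcongr
    refine h2.trans ?_
    rcases le_total τ ‖y - y'‖ with hc | hc
    · rw [max_eq_right hc]
      refine le_max_of_le_left ?_
      calc ‖h‖ ^ d * (Λ * ‖y - y'‖) = (‖h‖ * Λ) * (‖h‖ ^ (d - 1) * ‖y - y'‖) := by rw [hpow]; ring
        _ ≤ θ * (‖(d : Ω)‖ * ‖A‖) * (‖h‖ ^ (d - 1) * ‖y - y'‖) := by gcongr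
        _ = _ := by ring
    · rw [max_eq_left hc]
      refine le_max_of_le_right ?_
      calc ‖h‖ ^ d * (Λ * τ) = Λ * ‖h‖ ^ d * τ := by ring
        _ ≤ _ := by gcongr

/-- The local form of a family of maps `T t` near a parameter `t₀` at which the critical point
`P t₀ 0` is sent to a repelling fixed point `Z t₀ 0`, which has a preimage of the critical point
nearby. The point `Z t X` has coordinate `X` near the fixed point `Z t 0`, where `T t` is
`X ↦ X * q t X`, and `P t y` has coordinate `y` near the critical point. The `ℓ`-th iterate is
`y ↦ (t - t₀) ^ m * U t + y ^ d * u t y` from the critical point to the fixed point, and the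
`N`-th one is `X ↦ s t X` from a neighborhood of `z₀` to one of the critical point. All of this is
defined over every field that belongs to the collection `C`. -/
structure LocalModel (C : Set (Subfield Ω)) (K : Subfield Ω) {X : Type*} (T : Ω → X → X)
    (P Z : Ω → Ω → X) (u q s : Ω → Ω → Ω) (U : Ω → Ω) (ℓ N d m : ℕ) (t₀ z₀ A lam M U₀ : Ω)
    (θ r Λ Λq : ℝ) : Prop where
  closed : ∀ k ∈ C, IsClosed (k : Set Ω)
  le : ∀ k ∈ C, K ≤ k
  K_mem : K ∈ C
  ext : ∀ k ∈ C, ∀ (x : Ω) (n : ℕ), n ≠ 0 → x ^ n ∈ k → ∃ k' ∈ C, k ≤ k' ∧ x ∈ k'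
  t₀_mem : t₀ ∈ K
  z₀_mem : z₀ ∈ K
  A_mem : A ∈ K
  lam_mem : lam ∈ K
  M_mem : M ∈ K
  U₀_mem : U₀ ∈ K
  z₀_ne : z₀ ≠ 0
  A_ne : A ≠ 0
  M_ne : M ≠ 0
  U₀_ne : U₀ ≠ 0
  one_lt_lam : 1 < ‖lam‖
  d_pos : 1 ≤ d
  m_pos : 1 ≤ m
  θ_pos : 0 < θ
  θ_le : θ ≤ ‖(d : Ω)‖ * (‖(d : Ω)‖ / 2)
  r_pos : 0 < r
  Λ_nonneg : 0 ≤ Λ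
  Λq_nonneg : 0 ≤ Λq
  Λq_le : Λq * ‖z₀‖ ≤ θ * ‖lam‖
  u_val : u t₀ 0 = A
  u_lip : ∀ t t' y y', ‖t - t₀‖ ≤ r → ‖t' - t₀‖ ≤ r → ‖y‖ ≤ r → ‖y'‖ ≤ r →
    ‖u t y - u t' y'‖ ≤ Λ * max ‖t - t'‖ ‖y - y'‖
  q_near : ∀ t x, ‖t - t₀‖ ≤ r → ‖x‖ ≤ ‖z₀‖ → ‖q t x - lam‖ ≤ θ * ‖lam‖
  q_lip : ∀ t t' x x', ‖t - t₀‖ ≤ r → ‖t' - t₀‖ ≤ r → ‖x‖ ≤ ‖z₀‖ → ‖x'‖ ≤ ‖z₀‖ →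
    ‖q t x - q t' x'‖ ≤ Λq * max ‖t - t'‖ ‖x - x'‖
  s_val : s t₀ z₀ = 0
  s_est : ∀ t t' x x', ‖t - t₀‖ ≤ r → ‖t' - t₀‖ ≤ r → ‖x - z₀‖ ≤ r → ‖x' - z₀‖ ≤ r →
    ‖s t x - s t' x' - M * (x - x')‖ ≤ max (θ * (‖M‖ * ‖x - x'‖)) (Λ * ‖t - t'‖)
  U_val : U t₀ = U₀
  U_lip : ∀ t t', ‖t - t₀‖ ≤ r → ‖t' - t₀‖ ≤ r → ‖U t - U t'‖ ≤ Λ * ‖t - t'‖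
  X_lip : ∀ t t', ‖t - t₀‖ ≤ r → ‖t' - t₀‖ ≤ r →
    ‖(t - t₀) ^ m * U t - (t' - t₀) ^ m * U t'‖ ≤ Λ * ‖t - t'‖
  u_mem : ∀ k ∈ C, ∀ t ∈ k, ∀ y ∈ k, ‖t - t₀‖ ≤ r → ‖y‖ ≤ r → u t y ∈ k
  q_mem : ∀ k ∈ C, ∀ t ∈ k, ∀ x ∈ k, ‖t - t₀‖ ≤ r → ‖x‖ ≤ ‖z₀‖ → q t x ∈ k
  s_mem : ∀ k ∈ C, ∀ t ∈ k, ∀ x ∈ k, ‖t - t₀‖ ≤ r → ‖x - z₀‖ ≤ r → s t x ∈ k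
  U_mem : ∀ k ∈ C, ∀ t ∈ k, ‖t - t₀‖ ≤ r → U t ∈ k
  dyn_u : ∀ t y, ‖t - t₀‖ ≤ r → ‖y‖ ≤ r →
    (T t)^[ℓ] (P t y) = Z t ((t - t₀) ^ m * U t + y ^ d * u t y)
  dyn_q : ∀ t x, ‖t - t₀‖ ≤ r → ‖x‖ ≤ ‖z₀‖ → T t (Z t x) = Z t (x * q t x)
  dyn_s : ∀ t x, ‖t - t₀‖ ≤ r → ‖x - z₀‖ ≤ r → (T t)^[N] (Z t x) = P t (s t x)

namespace LocalModel

variable {C : Set (Subfield Ω)} {K : Subfield Ω} {X : Type*} {T : Ω → X → X}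
    {P Z : Ω → Ω → X} {u q s : Ω → Ω → Ω} {U : Ω → Ω} {ℓ N d m : ℕ} {t₀ z₀ A lam M U₀ : Ω}
    {θ r Λ Λq : ℝ}

/-- The `n`-th iterate of `X ↦ X * q t X`. -/
def iter (q : Ω → Ω → Ω) (n : ℕ) (t x : Ω) : Ω := (fun x => x * q t x)^[n] x

omit [IsUltrametricDist Ω] in
theorem iter_succ (n : ℕ) (t x : Ω) : iter q (n + 1) t x = iter q n t x * q t (iter q n t x) :=
  Function.iterate_succ_apply' _ _ _

variable (H : LocalModel C K T P Z u q s U ℓ N d m t₀ z₀ A lam M U₀ θ r Λ Λq)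
include H

omit [IsUltrametricDist Ω] in
theorem d_ne : (d : Ω) ≠ 0 := by
  intro h
  have h1 := H.θ_le
  rw [h, norm_zero, zero_mul] at h1
  exact absurd H.θ_pos (not_lt.2 h1)

theorem θ_le_half : θ ≤ 1 / 2 := by
  have h1 : ‖(d : Ω)‖ ≤ 1 := IsUltrametricDist.norm_natCast_le_one Ω d
  have h2 := H.θ_le
  nlinarith [norm_nonneg (d : Ω)]

omit [IsUltrametricDist Ω] in
theorem pow_mul_le {n : ℕ} {x : Ω} (hx : ‖lam‖ ^ (n + 1) * ‖x‖ ≤ ‖z₀‖) :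
    ‖lam‖ ^ n * ‖x‖ ≤ ‖z₀‖ := by
  refine le_trans ?_ hx
  gcongr
  · exact H.one_lt_lam.le
  · omega

/-- As long as the orbit stays near the fixed point, each step multiplies its distance to the fixed
point by `‖lam‖`. -/
theorem norm_iter {n : ℕ} {t x : Ω} (ht : ‖t - t₀‖ ≤ r) (hx : ‖lam‖ ^ n * ‖x‖ ≤ ‖z₀‖) :
    ‖iter q n t x‖ = ‖lam‖ ^ n * ‖x‖ := by
  induction n with
  | zero => simp [iter]
  | succ n ih =>
    have h1 := ih (H.pow_mul_le hx)
    have h2 : ‖iter q n t x‖ ≤ ‖z₀‖ := h1.le.trans (H.pow_mul_le hx)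
    have h3 := norm_eq_of_sub_le (by linarith [H.θ_le_half]) (H.q_near t _ ht h2)
    rw [iter_succ, norm_mul, h3, h1, pow_succ]
    ring

/-- The iterates near the fixed point are approximately linear of slope `lam ^ n` in the coordinate.
Their dependence on the parameter is controlled by a constant that does not grow with `n`, because
`‖lam‖ ^ n * ‖x'‖` stays bounded by `‖z₀‖`. -/
theorem iter_est {n : ℕ} {t t' x x' : Ω} (ht : ‖t - t₀‖ ≤ r) (ht' : ‖t' - t₀‖ ≤ r)
    (hx : ‖lam‖ ^ n * ‖x‖ ≤ ‖z₀‖) (hx' : ‖lam‖ ^ n * ‖x'‖ ≤ ‖z₀‖) :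
    ‖iter q n t x - iter q n t' x' - lam ^ n * (x - x')‖ ≤
      max (θ * (‖lam ^ n‖ * ‖x - x'‖)) (Λq * (‖lam‖ ^ n * ‖x'‖) * ‖t - t'‖) := by
  have hθ := H.θ_pos
  have hlam := H.one_lt_lam
  have hΛ := H.Λq_nonneg
  induction n with
  | zero =>
    have : iter q 0 t x - iter q 0 t' x' - lam ^ 0 * (x - x') = 0 := by simp [iter]
    rw [this, norm_zero]
    positivity
  | succ n ih =>
    have i1 := ih (H.pow_mul_le hx) (H.pow_mul_le hx')
    have hn := H.norm_iter ht (H.pow_mul_le hx)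
    have hn' := H.norm_iter ht' (H.pow_mul_le hx')
    set a := iter q n t x with ha
    set a' := iter q n t' x' with ha'
    have hz : ‖a‖ ≤ ‖z₀‖ := hn.le.trans (H.pow_mul_le hx)
    have hz' : ‖a'‖ ≤ ‖z₀‖ := hn'.le.trans (H.pow_mul_le hx')
    have step : ‖a * q t a - a' * q t' a' - lam * (a - a')‖ ≤
        max (θ * (‖lam‖ * ‖a - a'‖)) (Λq * ‖a'‖ * ‖t - t'‖) := by
      have e : a * q t a - a' * q t' a' - lam * (a - a') =
          (q t a - lam) * (a - a') + a' * (q t a - q t' a') := by ring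
      rw [e]
      refine norm_add_le_of_le (le_max_of_le_left ?_) ?_
      · rw [norm_mul]
        calc _ ≤ θ * ‖lam‖ * ‖a - a'‖ := by gcongr; exact H.q_near t a ht hz
          _ = _ := by ring
      · rw [norm_mul]
        have h1 := H.q_lip t t' a a' ht ht' hz hz'
        rcases le_total ‖t - t'‖ ‖a - a'‖ with h | h
        · rw [max_eq_right h] at h1
          refine le_max_of_le_left ?_
          calc ‖a'‖ * ‖q t a - q t' a'‖ ≤ ‖z₀‖ * (Λq * ‖a - a'‖) := by gcongr
            _ = Λq * ‖z₀‖ * ‖a - a'‖ := by ring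
            _ ≤ θ * ‖lam‖ * ‖a - a'‖ := mul_le_mul_of_nonneg_right H.Λq_le (norm_nonneg _)
            _ = _ := by ring
        · rw [max_eq_left h] at h1
          refine le_max_of_le_right ?_
          calc ‖a'‖ * ‖q t a - q t' a'‖ ≤ ‖a'‖ * (Λq * ‖t - t'‖) := by gcongr
            _ = _ := by ring
    rw [iter_succ, iter_succ, ← ha, ← ha', pow_succ']
    rw [hn'] at step
    refine (approx_comp (S₁ := lam ^ n) (b := x - x') hθ.le (by linarith [H.θ_le_half])
      (norm_nonneg (t - t')) i1 step).trans (max_le_max le_rfl ?_)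
    gcongr
    refine max_le (le_of_eq (by ring)) ?_
    gcongr
    · exact hlam.le
    · omega

theorem iter_mem {k : Subfield Ω} (hk : k ∈ C) {n : ℕ} {t x : Ω} (htk : t ∈ k) (hxk : x ∈ k)
    (ht : ‖t - t₀‖ ≤ r) (hx : ‖lam‖ ^ n * ‖x‖ ≤ ‖z₀‖) : iter q n t x ∈ k := by
  induction n with
  | zero => exact hxk
  | succ n ih =>
    have h1 := H.norm_iter ht (H.pow_mul_le hx)
    rw [iter_succ]
    exact k.mul_mem (ih (H.pow_mul_le hx)) (H.q_mem k hk t htk _ (ih (H.pow_mul_le hx)) ht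
      (h1.le.trans (H.pow_mul_le hx)))

theorem dyn_iter {n : ℕ} {t x : Ω} (ht : ‖t - t₀‖ ≤ r) (hx : ‖lam‖ ^ n * ‖x‖ ≤ ‖z₀‖) :
    (T t)^[n] (Z t x) = Z t (iter q n t x) := by
  induction n with
  | zero => rfl
  | succ n ih =>
    have h1 := H.norm_iter ht (H.pow_mul_le hx)
    rw [Function.iterate_succ_apply', ih (H.pow_mul_le hx),
      H.dyn_q t _ ht (h1.le.trans (H.pow_mul_le hx)), iter_succ]

/-- The preimage of `z₀` under the `n`-th iterate along the orbit that tends to the fixed point. -/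
theorem exists_iter_eq [CompleteSpace Ω] (n : ℕ) :
    ∃ x ∈ K, ‖lam‖ ^ n * ‖x‖ = ‖z₀‖ ∧ iter q n t₀ x = z₀ := by
  have ht : ‖t₀ - t₀‖ ≤ r := by simpa using H.r_pos.le
  have hl0 : lam ≠ 0 := norm_pos_iff.1 (by linarith [H.one_lt_lam])
  have h0 : iter q n t₀ 0 = 0 := by
    rw [← norm_eq_zero, H.norm_iter ht (by simp), norm_zero, mul_zero]
  obtain ⟨x, hxk, hx, hxz⟩ := exists_eq_of_approxLinear (H.closed K H.K_mem)
    (φ := fun x => iter q n t₀ x) (t₀ := 0) (L := lam ^ n) (R := ‖z₀‖) (y := z₀)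
    H.θ_pos.le (by linarith [H.θ_le_half]) (norm_nonneg _)
    (K.pow_mem H.lam_mem n) (pow_ne_zero _ hl0) K.zero_mem
    (by
      intro x hx hxr
      rw [sub_zero, norm_pow] at hxr
      exact H.iter_mem H.K_mem H.t₀_mem hx ht hxr)
    (by
      intro x _ x' _ hxr hxr'
      rw [sub_zero, norm_pow] at hxr hxr'
      have := H.iter_est ht ht hxr hxr'
      rwa [sub_self, norm_zero, mul_zero, max_eq_left (mul_nonneg H.θ_pos.le (by positivity))] at this)
    H.z₀_mem (by rw [h0, sub_zero])
  rw [sub_zero, norm_pow] at hx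
  refine ⟨x, hxk, ?_, hxz⟩
  rw [← H.norm_iter ht hx]
  exact congrArg norm hxz

omit [IsUltrametricDist Ω] in
theorem u_near {δ : ℝ} (hδr : δ ≤ r) (hδ : Λ * δ ≤ θ * (‖(d : Ω)‖ * ‖A‖)) {t y : Ω}
    (ht : ‖t - t₀‖ ≤ δ) (hy : ‖y‖ ≤ δ) : ‖u t y - A‖ ≤ θ * (‖(d : Ω)‖ * ‖A‖) := by
  have h := H.u_lip t t₀ y 0 (ht.trans hδr) (by simpa using H.r_pos.le) (hy.trans hδr)
    (by simpa using H.r_pos.le)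
  rw [H.u_val, sub_zero] at h
  refine (h.trans ?_).trans hδ
  exact mul_le_mul_of_nonneg_left (max_le ht hy) H.Λ_nonneg

theorem norm_u {δ : ℝ} (hδr : δ ≤ r) (hδ : Λ * δ ≤ θ * (‖(d : Ω)‖ * ‖A‖)) {t y : Ω}
    (ht : ‖t - t₀‖ ≤ δ) (hy : ‖y‖ ≤ δ) : ‖u t y‖ = ‖A‖ := by
  have h1 : ‖(d : Ω)‖ ≤ 1 := IsUltrametricDist.norm_natCast_le_one Ω d
  refine norm_eq_of_sub_le (θ := θ) (by linarith [H.θ_le_half])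
    ((H.u_near hδr hδ ht hy).trans ?_)
  exact mul_le_mul_of_nonneg_left (mul_le_of_le_one_left (norm_nonneg _) h1) H.θ_pos.le

/-- Near every small `h` the map `y ↦ y ^ d * u t y` is approximately linear, of slope
`d * A * h ^ (d - 1)`. -/
theorem g_est {δ κ e : ℝ} (hδr : δ ≤ r) (hδ : Λ * δ ≤ θ * (‖(d : Ω)‖ * ‖A‖)) (hκ : θ ≤ κ)
    (he0 : 0 ≤ e) (he : e ≤ 1) (heκ : e ≤ κ * ‖(d : Ω)‖) {t t' y y' h : Ω}
    (ht : ‖t - t₀‖ ≤ δ) (ht' : ‖t' - t₀‖ ≤ δ) (hh : ‖h‖ ≤ δ) (hy : ‖y - h‖ ≤ e * ‖h‖)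
    (hy' : ‖y' - h‖ ≤ e * ‖h‖) :
    ‖y ^ d * u t y - y' ^ d * u t' y' - d * A * h ^ (d - 1) * (y - y')‖ ≤
      max (κ * (‖(d : Ω)‖ * ‖A‖ * ‖h‖ ^ (d - 1) * ‖y - y'‖)) (Λ * ‖h‖ ^ d * ‖t - t'‖) := by
  have hyn : ‖y‖ ≤ δ :=
    (norm_le_of_sub_le (hy.trans (mul_le_of_le_one_left (norm_nonneg _) he)) le_rfl).trans hh
  have hyn' : ‖y'‖ ≤ δ :=
    (norm_le_of_sub_le (hy'.trans (mul_le_of_le_one_left (norm_nonneg _) he)) le_rfl).trans hh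
  have hκ' : θ * (‖(d : Ω)‖ * ‖A‖) ≤ κ * (‖(d : Ω)‖ * ‖A‖) := by gcongr
  refine norm_pow_mul_sub_pow_mul_le H.d_ne he0 he heκ H.d_pos hy hy'
    ((H.u_near hδr hδ ht hyn).trans hκ') ?_
    (H.u_lip t t' y y' (ht.trans hδr) (ht'.trans hδr) (hyn.trans hδr) (hyn'.trans hδr)) le_rfl
    (norm_nonneg _)
  rw [mul_comm]
  exact ((mul_le_mul_of_nonneg_left hh H.Λ_nonneg).trans hδ).trans hκ'

omit [IsUltrametricDist Ω] in
theorem exists_le_pow (B : ℝ) : ∃ n : ℕ, B ≤ ‖lam‖ ^ n := by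
  obtain ⟨n, hn⟩ := pow_unbounded_of_one_lt B H.one_lt_lam
  exact ⟨n, hn.le⟩

/-- The critical point has a preimage of coordinate `ω` arbitrarily close to itself. -/
theorem exists_preimage_near [CompleteSpace Ω] [IsAlgClosed Ω] {δ ρ : ℝ} (hδr : δ ≤ r)
    (hδ : Λ * δ ≤ θ * (‖(d : Ω)‖ * ‖A‖)) (hδ0 : 0 < δ) (hρ : 0 < ρ) (hρδ : ρ ≤ δ) :
    ∃ k ∈ C, ∃ ω ∈ k, ω ≠ 0 ∧ ‖ω‖ ≤ ρ ∧ ∃ κ : ℕ, ‖lam‖ ^ κ * (‖A‖ * ‖ω‖ ^ d) = ‖z₀‖ ∧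
      iter q κ t₀ (ω ^ d * u t₀ ω) = z₀ := by
  have hA0 : 0 < ‖A‖ := norm_pos_iff.2 H.A_ne
  have hd1 : ‖(d : Ω)‖ ≤ 1 := IsUltrametricDist.norm_natCast_le_one Ω d
  have hd0 : 0 < ‖(d : Ω)‖ := norm_pos_iff.2 H.d_ne
  have hd' : d ≠ 0 := by have := H.d_pos; omega
  have hz0 : 0 < ‖z₀‖ := norm_pos_iff.2 H.z₀_ne
  have hl0 : 0 < ‖lam‖ := by linarith [H.one_lt_lam]
  obtain ⟨κ, hκ⟩ := H.exists_le_pow (‖z₀‖ / (‖A‖ * ρ ^ d))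
  obtain ⟨x, hxK, hxn, hxz⟩ := H.exists_iter_eq κ
  -- to first order `ω` is a `d`-th root `w` of `x / A`; Newton's method then corrects `w` to `ω`
  -- within the field generated by `w`
  obtain ⟨w, hw⟩ := IsAlgClosed.exists_pow_nat_eq (x / A) (n := d) (by omega)
  have hwd : w ^ d ∈ K := by rw [hw]; exact K.div_mem hxK H.A_mem
  obtain ⟨k, hkC, hKk, hwk⟩ := H.ext K H.K_mem w d hd' hwd
  have hwn : ‖A‖ * ‖w‖ ^ d = ‖x‖ := by
    rw [← norm_pow, hw, norm_div]
    field_simp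
  have hw1 : ‖lam‖ ^ κ * (‖A‖ * ‖w‖ ^ d) = ‖z₀‖ := by rw [hwn, hxn]
  have hwρ : ‖w‖ ≤ ρ := by
    have h1 : ‖w‖ ^ d ≤ ρ ^ d := by
      rw [div_le_iff₀ (by positivity)] at hκ
      have h2 : (‖lam‖ ^ κ * ‖A‖) * ‖w‖ ^ d ≤ (‖lam‖ ^ κ * ‖A‖) * ρ ^ d := by
        rw [mul_assoc, hw1]
        linarith
      exact le_of_mul_le_mul_left h2 (by positivity)
    exact (pow_le_pow_iff_left₀ (norm_nonneg _) hρ.le hd').1 h1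
  have hw0 : w ≠ 0 := by
    rintro rfl
    rw [norm_zero, zero_pow hd', mul_zero, mul_zero] at hw1
    exact hz0.ne hw1
  have hwp : 0 < ‖w‖ := norm_pos_iff.2 hw0
  have ht0 : ‖t₀ - t₀‖ ≤ δ := by simpa using hδ0.le
  have hself : ‖w - w‖ ≤ ‖(d : Ω)‖ / 2 * ‖w‖ := by
    rw [sub_self, norm_zero]; positivity
  have hpow : ‖w‖ ^ d = ‖w‖ ^ (d - 1) * ‖w‖ := by
    rw [← pow_succ]; congr 1; have := H.d_pos; omega
  have hL0 : (d : Ω) * A * w ^ (d - 1) ≠ 0 :=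
    mul_ne_zero (mul_ne_zero H.d_ne H.A_ne) (pow_ne_zero _ hw0)
  have hLn : ‖(d : Ω) * A * w ^ (d - 1)‖ = ‖(d : Ω)‖ * ‖A‖ * ‖w‖ ^ (d - 1) := by
    rw [norm_mul, norm_mul, norm_pow]
  have hrad : ∀ y : Ω, ‖(d : Ω) * A * w ^ (d - 1)‖ * ‖y - w‖ ≤
      ‖(d : Ω)‖ * ‖A‖ * ‖w‖ ^ d * (‖(d : Ω)‖ / 2) → ‖y - w‖ ≤ ‖(d : Ω)‖ / 2 * ‖w‖ := by
    intro y hy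
    have h1 : ‖(d : Ω) * A * w ^ (d - 1)‖ * ‖y - w‖ ≤
        ‖(d : Ω) * A * w ^ (d - 1)‖ * (‖(d : Ω)‖ / 2 * ‖w‖) := by
      refine hy.trans (le_of_eq ?_)
      rw [hLn, hpow]; ring
    exact le_of_mul_le_mul_left h1 (norm_pos_iff.2 hL0)
  have hθd : θ ≤ ‖(d : Ω)‖ / 2 := by
    have := H.θ_le
    nlinarith
  have hball : ∀ y : Ω, ‖y - w‖ ≤ ‖(d : Ω)‖ / 2 * ‖w‖ → ‖y‖ ≤ δ := fun y hy =>
    norm_le_of_sub_le ((hy.trans (mul_le_of_le_one_left hwp.le (by linarith))).trans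
      (hwρ.trans hρδ)) (hwρ.trans hρδ)
  obtain ⟨ω, hωk, hω, hωx⟩ := exists_eq_of_approxLinear (H.closed k hkC)
    (φ := fun y => y ^ d * u t₀ y) (t₀ := w) (L := d * A * w ^ (d - 1)) (y := x)
    (R := ‖(d : Ω)‖ * ‖A‖ * ‖w‖ ^ d * (‖(d : Ω)‖ / 2)) (θ := 1 / 2) (by norm_num) (by norm_num)
    (by positivity)
    (k.mul_mem (k.mul_mem (natCast_mem k d) (hKk H.A_mem)) (k.pow_mem hwk _)) hL0 hwk
    (fun y hy hyr => k.mul_mem (k.pow_mem hy _) (H.u_mem k hkC t₀ (hKk H.t₀_mem) y hy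
      (ht0.trans hδr) ((hball y (hrad y hyr)).trans hδr)))
    (by
      intro y _ y' _ hyr hyr'
      have := H.g_est (κ := 1 / 2) hδr hδ H.θ_le_half (by positivity) (by linarith)
        (by linarith) ht0 ht0 (hwρ.trans hρδ) (hrad y hyr) (hrad y' hyr')
      rw [sub_self, norm_zero, mul_zero, max_eq_left (by positivity)] at this
      rw [hLn]
      exact this)
    (hKk hxK)
    (by
      have h1 : x - w ^ d * u t₀ w = -(w ^ d * (u t₀ w - A)) := by
        have : x = w ^ d * A := by rw [hw, div_mul_cancel₀ _ H.A_ne]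
        rw [this]; ring
      rw [h1, norm_neg, norm_mul, norm_pow]
      calc _ ≤ ‖w‖ ^ d * (θ * (‖(d : Ω)‖ * ‖A‖)) := by
            gcongr; exact H.u_near hδr hδ ht0 (hwρ.trans hρδ)
        _ ≤ ‖w‖ ^ d * (‖(d : Ω)‖ / 2 * (‖(d : Ω)‖ * ‖A‖)) := by gcongr
        _ = _ := by ring)
  have hωn : ‖ω‖ = ‖w‖ := norm_eq_of_sub_le (by linarith) (hrad ω hω)
  refine ⟨k, hkC, ω, hωk, ?_, hωn.le.trans hwρ, κ, by rw [hωn, hw1], ?_⟩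
  · rw [← norm_pos_iff, hωn]; exact hwp
  · have h1 : ω ^ d * u t₀ ω = x := hωx
    rw [h1, hxz]

/-- The return map near the preimage `ω` of the critical point. -/
theorem exists_returnSystem [CompleteSpace Ω] {δ η ρ : ℝ} (hδr : δ ≤ r)
    (hδ : Λ * δ ≤ θ * (‖(d : Ω)‖ * ‖A‖)) (hδ0 : 0 < δ) (hη : 0 < η) (hη2 : η ≤ 1 / 2)
    (hηθ : η ≤ θ * ‖(d : Ω)‖) (hηr : ‖(d : Ω)‖ * ‖(d : Ω)‖ * η * ‖z₀‖ ≤ r)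
    (hρ : ρ = ‖(d : Ω)‖ * ‖(d : Ω)‖ * ‖M‖ * ‖z₀‖ * η) (hρδ : ρ ≤ δ)
    {k : Subfield Ω} {ω : Ω} (hωk : ω ∈ k) (hω0 : ω ≠ 0) (hωρ : ‖ω‖ ≤ ρ)
    {κ : ℕ} (hωn : ‖lam‖ ^ κ * (‖A‖ * ‖ω‖ ^ d) = ‖z₀‖)
    (hωz : iter q κ t₀ (ω ^ d * u t₀ ω) = z₀) :
    ∃ δ' > 0, δ' ≤ δ ∧ ∃ (f : Ω → Ω → Ω) (σ : Ω) (Λ' : ℝ), Λ ≤ Λ' ∧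
      ∀ k' ∈ C, k ≤ k' →
      ReturnSystem k' {t | ‖t - t₀‖ ≤ δ'} T P (fun t w => Z t ((t - t₀) ^ m * U t + w))
        (fun t y => y ^ d * u t y) f ℓ (N + (κ + ℓ)) d A ω σ θ η (‖(d : Ω)‖ / 2) ρ Λ' := by
  have hA0 : 0 < ‖A‖ := norm_pos_iff.2 H.A_ne
  have hd1 : ‖(d : Ω)‖ ≤ 1 := IsUltrametricDist.norm_natCast_le_one Ω d
  have hd0 : 0 < ‖(d : Ω)‖ := norm_pos_iff.2 H.d_ne
  have hd' : d ≠ 0 := by have := H.d_pos; omega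
  have hz0 : 0 < ‖z₀‖ := norm_pos_iff.2 H.z₀_ne
  have hM0 : 0 < ‖M‖ := norm_pos_iff.2 H.M_ne
  have hl0 : 0 < ‖lam‖ := by linarith [H.one_lt_lam]
  have hlk : 0 < ‖lam‖ ^ κ := pow_pos hl0 κ
  have hωp : 0 < ‖ω‖ := norm_pos_iff.2 hω0
  have hθ := H.θ_pos
  have hθ2 := H.θ_le_half
  have hθ1 : θ ≤ 1 := by linarith
  have hΛ := H.Λ_nonneg
  have hΛq := H.Λq_nonneg
  have hpow : ‖ω‖ ^ d = ‖ω‖ ^ (d - 1) * ‖ω‖ := by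
    rw [← pow_succ]; congr 1; have := H.d_pos; omega
  have hρ0 : 0 < ρ := hωp.trans_le hωρ
  have hm' : m ≠ 0 := by have := H.m_pos; omega
  set γ : Ω := d * A * ω ^ (d - 1) with hγ
  have hγn : ‖γ‖ = ‖(d : Ω)‖ * ‖A‖ * ‖ω‖ ^ (d - 1) := by
    rw [hγ, norm_mul, norm_mul, norm_pow]
  have hγ0 : γ ≠ 0 := mul_ne_zero (mul_ne_zero H.d_ne H.A_ne) (pow_ne_zero _ hω0)
  set σ : Ω := M * (lam ^ κ * γ) with hσ
  have hσω : ‖σ‖ * ‖ω‖ = ‖(d : Ω)‖ * ‖M‖ * ‖z₀‖ := by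
    rw [hσ, norm_mul, norm_mul, norm_pow, hγn, ← hωn, hpow]; ring
  have hγω : ‖lam‖ ^ κ * (‖γ‖ * ‖ω‖) = ‖(d : Ω)‖ * ‖z₀‖ := by rw [hγn, ← hωn, hpow]; ring
  -- Lipschitz constants in the parameter of the three successive maps
  set C₁ : ℝ := max (Λ * ‖ω‖ ^ d) Λ with hC₁
  have hC₁0 : 0 ≤ C₁ := le_max_of_le_right hΛ
  set C₂ : ℝ := max (‖lam ^ κ‖ * C₁) (Λq * ‖z₀‖) with hC₂
  have hC₂0 : 0 ≤ C₂ := le_max_of_le_right (by positivity)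
  set C₃ : ℝ := max (‖M‖ * C₂) Λ with hC₃
  have hC₃0 : 0 ≤ C₃ := le_max_of_le_right hΛ
  -- for parameters within `δ'` of `t₀` the successive images stay in the domains of the next maps
  obtain ⟨δ', hδ'0, hδ'δ, hδ'1, hδ'2, hδ'3⟩ : ∃ δ' > 0, δ' ≤ δ ∧ Λ * δ' ≤ ‖A‖ * ‖ω‖ ^ d ∧
      C₂ * δ' ≤ r ∧ C₃ * δ' ≤ ρ := by
    have key : ∀ a b : ℝ, 0 ≤ a → 0 < b → ∃ e > 0, ∀ x, x ≤ e → a * x ≤ b := by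
      intro a b ha hb
      refine ⟨b / (a + 1), by positivity, fun x hx => ?_⟩
      calc a * x ≤ a * (b / (a + 1)) := by gcongr
        _ = b * (a / (a + 1)) := by ring
        _ ≤ b := mul_le_of_le_one_right hb.le ((div_le_one (by positivity)).2 (by linarith))
    obtain ⟨e₁, h1, h1'⟩ := key Λ (‖A‖ * ‖ω‖ ^ d) hΛ (by positivity)
    obtain ⟨e₂, h2, h2'⟩ := key C₂ r hC₂0 H.r_pos
    obtain ⟨e₃, h3, h3'⟩ := key C₃ ρ hC₃0 hρ0
    refine ⟨min δ (min e₁ (min e₂ e₃)), by positivity, min_le_left _ _, h1' _ ?_, h2' _ ?_,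
      h3' _ ?_⟩
    · exact (min_le_right _ _).trans (min_le_left _ _)
    · exact (min_le_right _ _).trans ((min_le_right _ _).trans (min_le_left _ _))
    · exact (min_le_right _ _).trans ((min_le_right _ _).trans (min_le_right _ _))
  have hdη : ‖(d : Ω)‖ * η ≤ η := mul_le_of_le_one_left hη.le hd1
  have ht0r : ‖t₀ - t₀‖ ≤ r := by simpa using H.r_pos.le
  have ht0δ : ‖t₀ - t₀‖ ≤ δ := by simpa using hδ0.le
  have ht0δ' : ‖t₀ - t₀‖ ≤ δ' := by simpa using hδ'0.le
  have hX0 : (t₀ - t₀) ^ m * U t₀ = 0 := by rw [sub_self, zero_pow hm', zero_mul]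
  have hωη : ‖ω - ω‖ ≤ ‖(d : Ω)‖ * η * ‖ω‖ := by rw [sub_self, norm_zero]; positivity
  -- the coordinate near the fixed point
  set G : Ω → Ω → Ω := fun t y => (t - t₀) ^ m * U t + y ^ d * u t y with hG
  have hyω : ∀ y : Ω, ‖y - ω‖ ≤ ‖(d : Ω)‖ * η * ‖ω‖ → ‖y‖ ≤ ‖ω‖ := fun y hy =>
    norm_le_of_sub_le (hy.trans (mul_le_of_le_one_left hωp.le (by linarith))) le_rfl
  have hGn : ∀ t y, ‖t - t₀‖ ≤ δ' → ‖y - ω‖ ≤ ‖(d : Ω)‖ * η * ‖ω‖ →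
      ‖lam‖ ^ κ * ‖G t y‖ ≤ ‖z₀‖ := by
    intro t y ht hy
    rw [← hωn]
    refine mul_le_mul_of_nonneg_left (norm_add_le_of_le ?_ ?_) hlk.le
    · have h1 := H.X_lip t t₀ (ht.trans (hδ'δ.trans hδr)) ht0r
      rw [hX0, sub_zero] at h1
      exact h1.trans ((mul_le_mul_of_nonneg_left ht hΛ).trans hδ'1)
    · rw [norm_mul, norm_pow, H.norm_u hδr hδ (ht.trans hδ'δ)
        ((hyω y hy).trans (hωρ.trans hρδ)), mul_comm]
      have := hyω y hy
      gcongr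
  have hGest : ∀ t t' y y', ‖t - t₀‖ ≤ δ' → ‖t' - t₀‖ ≤ δ' → ‖y - ω‖ ≤ ‖(d : Ω)‖ * η * ‖ω‖ →
      ‖y' - ω‖ ≤ ‖(d : Ω)‖ * η * ‖ω‖ → ‖G t y - G t' y' - γ * (y - y')‖ ≤
        max (θ * (‖γ‖ * ‖y - y'‖)) (C₁ * ‖t - t'‖) := by
    intro t t' y y' ht ht' hy hy'
    have h1 := H.g_est (κ := θ) (e := ‖(d : Ω)‖ * η) hδr hδ le_rfl (by positivity) (by linarith)
      (by linarith) (ht.trans hδ'δ) (ht'.trans hδ'δ) (hωρ.trans hρδ) hy hy'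
    have h2 := H.X_lip t t' (ht.trans (hδ'δ.trans hδr)) (ht'.trans (hδ'δ.trans hδr))
    have e : G t y - G t' y' - γ * (y - y') =
        (y ^ d * u t y - y' ^ d * u t' y' - d * A * ω ^ (d - 1) * (y - y')) +
        ((t - t₀) ^ m * U t - (t' - t₀) ^ m * U t') := by simp only [hG, hγ]; ring
    rw [e, hγn]
    refine norm_add_le_of_le (h1.trans (max_le_max le_rfl ?_)) (le_max_of_le_right (h2.trans ?_))
    · gcongr; exact le_max_left _ _
    · gcongr; exact le_max_right _ _
  have hIest : ∀ t t' y y', ‖t - t₀‖ ≤ δ' → ‖t' - t₀‖ ≤ δ' → ‖y - ω‖ ≤ ‖(d : Ω)‖ * η * ‖ω‖ →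
      ‖y' - ω‖ ≤ ‖(d : Ω)‖ * η * ‖ω‖ →
      ‖iter q κ t (G t y) - iter q κ t' (G t' y') - lam ^ κ * γ * (y - y')‖ ≤
        max (θ * (‖lam ^ κ * γ‖ * ‖y - y'‖)) (C₂ * ‖t - t'‖) := by
    intro t t' y y' ht ht' hy hy'
    refine approx_comp hθ.le hθ1 (norm_nonneg _) (hGest t t' y y' ht ht' hy hy') ?_
    refine (H.iter_est (ht.trans (hδ'δ.trans hδr)) (ht'.trans (hδ'δ.trans hδr))
      (hGn t y ht hy) (hGn t' y' ht' hy')).trans (max_le_max le_rfl ?_)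
    gcongr
    exact hGn t' y' ht' hy'
  have hG0 : iter q κ t₀ (G t₀ ω) = z₀ := by
    simp only [hG]
    rw [hX0, zero_add, hωz]
  have hIz : ∀ t y, ‖t - t₀‖ ≤ δ' → ‖y - ω‖ ≤ ‖(d : Ω)‖ * η * ‖ω‖ →
      ‖iter q κ t (G t y) - z₀‖ ≤ r := by
    intro t y ht hy
    have h1 := hIest t t₀ y ω ht ht0δ' hy hωη
    rw [hG0] at h1
    have hb : ‖lam ^ κ * γ‖ * ‖y - ω‖ ≤ r := by
      refine le_trans ?_ hηr
      calc _ ≤ ‖lam ^ κ * γ‖ * (‖(d : Ω)‖ * η * ‖ω‖) := by gcongr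
        _ = (‖lam‖ ^ κ * (‖γ‖ * ‖ω‖)) * (‖(d : Ω)‖ * η) := by rw [norm_mul, norm_pow]; ring
        _ = _ := by rw [hγω]; ring
    refine norm_le_of_sub_le (h1.trans (max_le ?_ ?_)) ?_
    · exact (mul_le_of_le_one_left (by positivity) hθ1).trans hb
    · exact (mul_le_mul_of_nonneg_left ht hC₂0).trans hδ'2
    · rw [norm_mul]; exact hb
  have hfest : ∀ t t' y y', ‖t - t₀‖ ≤ δ' → ‖t' - t₀‖ ≤ δ' → ‖y - ω‖ ≤ ‖(d : Ω)‖ * η * ‖ω‖ →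
      ‖y' - ω‖ ≤ ‖(d : Ω)‖ * η * ‖ω‖ →
      ‖s t (iter q κ t (G t y)) - s t' (iter q κ t' (G t' y')) - σ * (y - y')‖ ≤
        max (θ * (‖σ‖ * ‖y - y'‖)) (C₃ * ‖t - t'‖) := by
    intro t t' y y' ht ht' hy hy'
    exact approx_comp hθ.le hθ1 (norm_nonneg _) (hIest t t' y y' ht ht' hy hy')
      (H.s_est t t' _ _ (ht.trans (hδ'δ.trans hδr)) (ht'.trans (hδ'δ.trans hδr))
        (hIz t y ht hy) (hIz t' y' ht' hy'))
  refine ⟨δ', hδ'0, hδ'δ, fun t y => s t (iter q κ t (G t y)), σ, C₃, le_max_right _ _, ?_⟩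
  intro k' hk' hkk'
  have hKk' := H.le k' hk'
  have hρd : ∀ {y : Ω}, ‖y‖ ≤ ρ → ‖y‖ ≤ δ := fun h => h.trans hρδ
  have hG_mem : ∀ t ∈ k', ∀ y ∈ k', ‖t - t₀‖ ≤ δ' → ‖y‖ ≤ δ → G t y ∈ k' := by
    intro t ht y hy htr hyr
    exact k'.add_mem (k'.mul_mem (k'.pow_mem (k'.sub_mem ht (hKk' H.t₀_mem)) _)
      (H.U_mem k' hk' t ht (htr.trans (hδ'δ.trans hδr))))
      (k'.mul_mem (k'.pow_mem hy _) (H.u_mem k' hk' t ht y hy (htr.trans (hδ'δ.trans hδr))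
        (hyr.trans hδr)))
  have hΛ3 : Λ ≤ C₃ := le_max_right _ _
  refine ⟨H.closed k' hk', hKk' H.A_mem, hkk' hωk, ?_, H.A_ne, hω0, ?_, H.d_pos, H.d_ne, hθ, hθ2,
    hη, hη2, by linarith, H.θ_le, hC₃0, ?_, hωρ, ?_, ?_, ?_, ?_, ?_, ?_, ?_, ?_, ?_⟩
  · exact k'.mul_mem (hKk' H.M_mem) (k'.mul_mem (k'.pow_mem (hKk' H.lam_mem) _)
      (k'.mul_mem (k'.mul_mem (natCast_mem k' d) (hKk' H.A_mem)) (k'.pow_mem (hkk' hωk) _)))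
  · exact mul_ne_zero H.M_ne (mul_ne_zero (pow_ne_zero _ (norm_pos_iff.1 hl0)) hγ0)
  · rw [hρ, mul_assoc ‖(d : Ω)‖ ‖σ‖, hσω]; ring
  · intro t ht htD y hy hyρ
    exact k'.mul_mem (k'.pow_mem hy _) (H.u_mem k' hk' t ht y hy (htD.trans (hδ'δ.trans hδr))
      ((hρd hyρ).trans hδr))
  · intro t ht htD t' ht' htD' h hh hhρ y hy y' hy' hyh hyh'
    refine (H.g_est (κ := θ) (e := η) hδr hδ le_rfl hη.le (by linarith) hηθ
      (htD.trans hδ'δ) (htD'.trans hδ'δ) (hρd hhρ) hyh hyh').trans (max_le_max le_rfl ?_)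
    gcongr
  · intro t ht htD h hh hhρ y hy y' hy' hyh hyh'
    have h1 := H.g_est (κ := 1 / 2) (e := ‖(d : Ω)‖ / 2) hδr hδ hθ2 (by positivity)
      (by linarith) (by linarith) (htD.trans hδ'δ) (htD.trans hδ'δ) (hρd hhρ) hyh hyh'
    rwa [sub_self, norm_zero, mul_zero, max_eq_left (by positivity)] at h1
  · intro t ht htD h hh hhρ
    have e : h ^ d * u t h - A * h ^ d = h ^ d * (u t h - A) := by ring
    rw [e, norm_mul, norm_pow]
    have h1 := H.u_near hδr hδ (htD.trans hδ'δ) (hρd hhρ)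
    calc _ ≤ ‖h‖ ^ d * (θ * (‖(d : Ω)‖ * ‖A‖)) := by gcongr
      _ ≤ ‖h‖ ^ d * (θ * (1 * ‖A‖)) := by gcongr
      _ = _ := by ring
  · intro t ht htD x hx hxω
    refine H.s_mem k' hk' t ht _ ?_ (htD.trans (hδ'δ.trans hδr)) (hIz t x htD hxω)
    exact H.iter_mem hk' ht (hG_mem t ht x hx htD ((hyω x hxω).trans (hρd hωρ)))
      (htD.trans (hδ'δ.trans hδr)) (hGn t x htD hxω)
  · intro t ht htD t' ht' htD' x hx x' hx' hxω hxω'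
    exact hfest t t' x x' htD htD' hxω hxω'
  · intro t ht htD x hx hxω
    have h1 := hfest t t₀ x ω htD ht0δ' hxω hωη
    rw [hG0, H.s_val, sub_zero] at h1
    have hb : ‖σ‖ * ‖x - ω‖ ≤ ρ := by
      rw [hρ]
      calc _ ≤ ‖σ‖ * (‖(d : Ω)‖ * η * ‖ω‖) := by gcongr
        _ = (‖σ‖ * ‖ω‖) * (‖(d : Ω)‖ * η) := by ring
        _ = _ := by rw [hσω]; ring
    refine norm_le_of_sub_le (h1.trans (max_le ?_ ?_)) (by rw [norm_mul]; exact hb)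
    · exact (mul_le_of_le_one_left (by positivity) hθ1).trans hb
    · exact (mul_le_mul_of_nonneg_left htD hC₃0).trans hδ'3
  · intro t ht htD y hy hyρ
    exact H.dyn_u t y (htD.trans (hδ'δ.trans hδr)) ((hρd hyρ).trans hδr)
  · intro t ht htD x hx hxω
    have htr : ‖t - t₀‖ ≤ r := htD.trans (hδ'δ.trans hδr)
    rw [Function.iterate_add_apply, Function.iterate_add_apply,
      H.dyn_u t x htr (((hyω x hxω).trans (hρd hωρ)).trans hδr),
      H.dyn_iter htr (hGn t x htD hxω), H.dyn_s t _ htr (hIz t x htD hxω)]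

/-- A stage at parameters `t₀ + s₀ * (1 + v)`, where `s₀` is small and such that the critical value
of the parameter `t₀ + s₀` goes, after many iterates near the fixed point, close to the preimage
`z₀` of the critical point. -/
theorem exists_stage [CompleteSpace Ω] [IsAlgClosed Ω] {δ' η ρ ε B : ℝ} (hδ' : 0 < δ')
    (hδ'r : δ' ≤ r) (hη : 0 < η) (hη1 : η ≤ 1)
    (hm : (m : Ω) ≠ 0) (hηm : ‖(d : Ω)‖ * ‖(d : Ω)‖ * η ≤ θ * ‖(m : Ω)‖ * ‖(m : Ω)‖)
    (hηr : ‖(d : Ω)‖ * ‖(d : Ω)‖ * η * ‖z₀‖ ≤ r)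
    (hρ : ρ = ‖(d : Ω)‖ * ‖(d : Ω)‖ * ‖M‖ * ‖z₀‖ * η)
    {k : Subfield Ω} (hk : k ∈ C) {ω : Ω} (hωk : ω ∈ k) (hε : 0 < ε) :
    ∃ k' ∈ C, k ≤ k' ∧ ∃ (τ L E : Ω) (ψ : Ω → Ω → Ω) (n : ℕ) (h₀ : Ω),
      Stage k' {t | ‖t - t₀‖ ≤ δ'} T P (fun t w => Z t ((t - t₀) ^ m * U t + w)) θ ρ τ L E ψ n ∧
      h₀ ∈ k' ∧ E * (A * h₀ ^ d) = ω ∧ ‖h₀‖ ≤ ε ∧ B ≤ ‖L‖ := by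
  have hA0 : 0 < ‖A‖ := norm_pos_iff.2 H.A_ne
  have hd1 : ‖(d : Ω)‖ ≤ 1 := IsUltrametricDist.norm_natCast_le_one Ω d
  have hm1 : ‖(m : Ω)‖ ≤ 1 := IsUltrametricDist.norm_natCast_le_one Ω m
  have hd0 : 0 < ‖(d : Ω)‖ := norm_pos_iff.2 H.d_ne
  have hm0 : 0 < ‖(m : Ω)‖ := norm_pos_iff.2 hm
  have hd' : d ≠ 0 := by have := H.d_pos; omega
  have hm' : m ≠ 0 := by have := H.m_pos; omega
  have hz0 : 0 < ‖z₀‖ := norm_pos_iff.2 H.z₀_ne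
  have hM0 : 0 < ‖M‖ := norm_pos_iff.2 H.M_ne
  have hU0 : 0 < ‖U₀‖ := norm_pos_iff.2 H.U₀_ne
  have hl0 : 0 < ‖lam‖ := by linarith [H.one_lt_lam]
  have hlam0 : lam ≠ 0 := norm_pos_iff.1 hl0
  have hθ := H.θ_pos
  have hθ2 := H.θ_le_half
  have hθ1 : θ ≤ 1 := by linarith
  have hΛ := H.Λ_nonneg
  have hΛq := H.Λq_nonneg
  have hρ0 : 0 < ρ := by rw [hρ]; positivity
  have ev : ∀ a b : ℝ, 0 < b → ∀ᶠ x : ℝ in 𝓝[>] 0, a * x ≤ b := by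
    intro a b hb
    have : Tendsto (fun x : ℝ => a * x) (𝓝 0) (𝓝 (a * 0)) := (continuous_const_mul a).tendsto 0
    rw [mul_zero] at this
    exact ((this.eventually (gt_mem_nhds hb)).filter_mono nhdsWithin_le_nhds).mono
      fun x hx => hx.le
  -- `e₀` is an upper bound for the distance `‖s₀‖` of the new parameter to `t₀`
  obtain ⟨e₀, he₀, e1, e2, e3, e4, e5, e6, e7, e8⟩ : ∃ e₀ : ℝ, 0 < e₀ ∧ 1 * e₀ ≤ δ' ∧
      Λ * e₀ ≤ θ * (‖(m : Ω)‖ * ‖U₀‖) ∧ Λq * e₀ ≤ θ * ‖(m : Ω)‖ ∧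
      Λ * e₀ ≤ θ * (‖M‖ * ‖(m : Ω)‖ * ‖z₀‖) ∧ (Λ * ‖z₀‖ * ‖M‖) * e₀ ≤ ‖U₀‖ * ρ ∧
      (Λq * ‖z₀‖ * ‖M‖) * e₀ ≤ ρ ∧ Λ * e₀ ≤ ρ ∧ B * e₀ ≤ ‖M‖ * ‖(m : Ω)‖ * ‖z₀‖ := by
    have h0 : ∀ᶠ x : ℝ in 𝓝[>] 0, 0 < x := eventually_mem_nhdsWithin
    exact (h0.and ((ev 1 δ' hδ').and ((ev Λ _ (by positivity)).and ((ev Λq _ (by positivity)).and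
      ((ev Λ _ (by positivity)).and ((ev (Λ * ‖z₀‖ * ‖M‖) _ (by positivity)).and
      ((ev (Λq * ‖z₀‖ * ‖M‖) _ hρ0).and ((ev Λ _ hρ0).and (ev B _ (by positivity)))))))))).exists
  obtain ⟨κ, hκ⟩ := H.exists_le_pow (max (‖z₀‖ / (‖U₀‖ * e₀ ^ m)) (‖ω‖ / (‖M‖ * ‖A‖ * ε ^ d)))
  have hlk : 0 < ‖lam‖ ^ κ := pow_pos hl0 κ
  obtain ⟨x, hxK, hxn, hxz⟩ := H.exists_iter_eq κ
  -- the roots that have to be adjoined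
  obtain ⟨s₀, hs₀⟩ := IsAlgClosed.exists_pow_nat_eq (x / U₀) (n := m) (by omega)
  obtain ⟨k₁, hk₁, hkk₁, hs₀k⟩ := H.ext k hk s₀ m hm'
    (by rw [hs₀]; exact H.le k hk (K.div_mem hxK H.U₀_mem))
  obtain ⟨h₀, hh₀⟩ := IsAlgClosed.exists_pow_nat_eq (ω / (M * lam ^ κ * A)) (n := d) (by omega)
  obtain ⟨k₂, hk₂, hkk₂, hh₀k⟩ := H.ext k₁ hk₁ h₀ d hd'
    (by
      rw [hh₀]
      exact k₁.div_mem (hkk₁ hωk) (k₁.mul_mem (k₁.mul_mem (H.le k₁ hk₁ H.M_mem)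
        (k₁.pow_mem (H.le k₁ hk₁ H.lam_mem) _)) (H.le k₁ hk₁ H.A_mem)))
  have hK₂ := H.le k₂ hk₂
  have hsU : s₀ ^ m * U₀ = x := by rw [hs₀, div_mul_cancel₀ _ H.U₀_ne]
  have hsn : ‖lam‖ ^ κ * (‖s₀‖ ^ m * ‖U₀‖) = ‖z₀‖ := by
    rw [← norm_pow s₀, ← norm_mul, hsU, hxn]
  have hs0 : s₀ ≠ 0 := by
    rintro rfl
    rw [norm_zero, zero_pow hm', zero_mul, mul_zero] at hsn
    exact hz0.ne hsn
  have hsp : 0 < ‖s₀‖ := norm_pos_iff.2 hs0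
  have hse : ‖s₀‖ ≤ e₀ := by
    have h1 := (le_max_left _ _).trans hκ
    rw [div_le_iff₀ (by positivity)] at h1
    have h2 : (‖lam‖ ^ κ * ‖U₀‖) * ‖s₀‖ ^ m ≤ (‖lam‖ ^ κ * ‖U₀‖) * e₀ ^ m := by linarith
    exact (pow_le_pow_iff_left₀ hsp.le he₀.le hm').1 (le_of_mul_le_mul_left h2 (by positivity))
  have hhε : ‖h₀‖ ≤ ε := by
    have h1 := (le_max_right _ _).trans hκ
    rw [div_le_iff₀ (by positivity)] at h1
    have h2 : ‖h₀‖ ^ d ≤ ε ^ d := by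
      rw [← norm_pow, hh₀, norm_div, norm_mul, norm_mul, norm_pow, div_le_iff₀ (by positivity)]
      linarith
    exact (pow_le_pow_iff_left₀ (norm_nonneg _) hε.le hd').1 h2
  have hmon : ∀ {a b : ℝ}, 0 ≤ a → a * e₀ ≤ b → a * ‖s₀‖ ≤ b := fun ha h =>
    (mul_le_mul_of_nonneg_left hse ha).trans h
  replace e1 := hmon zero_le_one e1
  replace e2 := hmon hΛ e2
  replace e3 := hmon hΛq e3
  replace e4 := hmon hΛ e4
  replace e5 := hmon (by positivity) e5
  replace e6 := hmon (by positivity) e6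
  replace e7 := hmon hΛ e7
  rw [one_mul] at e1
  have hpow : ‖s₀‖ ^ m = ‖s₀‖ ^ (m - 1) * ‖s₀‖ := by
    rw [← pow_succ]; congr 1; have := H.m_pos; omega
  set S : Ω := m * U₀ * s₀ ^ (m - 1) with hS
  have hSn : ‖S‖ = ‖(m : Ω)‖ * ‖U₀‖ * ‖s₀‖ ^ (m - 1) := by
    rw [hS, norm_mul, norm_mul, norm_pow]
  have hS0 : S ≠ 0 := mul_ne_zero (mul_ne_zero hm H.U₀_ne) (pow_ne_zero _ hs0)
  set E : Ω := M * lam ^ κ with hE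
  have hE0 : E ≠ 0 := mul_ne_zero H.M_ne (pow_ne_zero _ hlam0)
  have hEn : ‖E‖ = ‖M‖ * ‖lam‖ ^ κ := by rw [hE, norm_mul, norm_pow]
  have hEp : 0 < ‖E‖ := norm_pos_iff.2 hE0
  set L : Ω := E * S with hL
  have hLn : ‖L‖ = ‖E‖ * ‖S‖ := norm_mul _ _
  have hLs : ‖L‖ * ‖s₀‖ = ‖M‖ * ‖(m : Ω)‖ * ‖z₀‖ := by
    rw [hLn, hEn, hSn, ← hsn, hpow]; ring
  have hLp : 0 < ‖L‖ := norm_pos_iff.2 (mul_ne_zero hE0 hS0)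
  -- the radius of the parameter ball of the stage, relative to `‖s₀‖`
  set e : ℝ := ‖(d : Ω)‖ * ‖(d : Ω)‖ * η / ‖(m : Ω)‖ with he
  have hem : e ≤ θ * ‖(m : Ω)‖ := by rw [he, div_le_iff₀ hm0]; exact hηm
  have he0 : 0 ≤ e := by positivity
  have he1 : e ≤ 1 := hem.trans (mul_le_one₀ hθ1 hm0.le hm1)
  have hLe : ‖L‖ * (e * ‖s₀‖) = ρ := by
    have : ‖L‖ * (e * ‖s₀‖) = (‖L‖ * ‖s₀‖) * e := by ring
    rw [this, hLs, he, hρ]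
    field_simp
  set τ : Ω := t₀ + s₀ with hτ
  have hrad : ∀ t : Ω, ‖L‖ * ‖t - τ‖ ≤ ρ → ‖t - t₀ - s₀‖ ≤ e * ‖s₀‖ ∧ ‖t - t₀‖ ≤ ‖s₀‖ := by
    intro t ht
    have h1 : t - τ = t - t₀ - s₀ := by rw [hτ]; ring
    rw [h1, ← hLe] at ht
    have h2 := le_of_mul_le_mul_left ht hLp
    exact ⟨h2, norm_le_of_sub_le (h2.trans (mul_le_of_le_one_left hsp.le he1)) le_rfl⟩
  have hττ : ‖L‖ * ‖τ - τ‖ ≤ ρ := by simpa using hρ0.le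
  have hτt₀ : ‖τ - t₀‖ ≤ ‖s₀‖ := (hrad τ hττ).2
  have hsr : ‖s₀‖ ≤ r := e1.trans hδ'r
  have ht0r : ‖t₀ - t₀‖ ≤ r := by simpa using H.r_pos.le
  -- the critical value as a function of the parameter
  set V : Ω → Ω := fun t => (t - t₀) ^ m * U t with hV
  have hU : ∀ t, ‖t - t₀‖ ≤ ‖s₀‖ → ‖U t - U₀‖ ≤ θ * (‖(m : Ω)‖ * ‖U₀‖) := by
    intro t ht
    have h1 := H.U_lip t t₀ (ht.trans hsr) ht0r
    rw [H.U_val] at h1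
    exact (h1.trans (mul_le_mul_of_nonneg_left ht hΛ)).trans e2
  have hVest : ∀ t t', ‖L‖ * ‖t - τ‖ ≤ ρ → ‖L‖ * ‖t' - τ‖ ≤ ρ →
      ‖V t - V t' - S * (t - t')‖ ≤ θ * (‖S‖ * ‖t - t'‖) := by
    intro t t' ht ht'
    obtain ⟨a1, a2⟩ := hrad t ht
    obtain ⟨b1, b2⟩ := hrad t' ht'
    have h1 := norm_pow_mul_sub_pow_mul_le (d := m) (A := U₀) (B := Λ) (τ := ‖t - t'‖) hm
      he0 he1 hem H.m_pos a1 b1 (hU t a2) (by rw [mul_comm]; exact e2)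
      (v' := U t') (Λ := Λ) ?_ le_rfl (norm_nonneg _)
    · have h2 : t - t₀ - (t' - t₀) = t - t' := by ring
      rw [h2, ← hSn] at h1
      refine h1.trans (max_le (le_of_eq (by ring)) ?_)
      calc Λ * ‖s₀‖ ^ m * ‖t - t'‖ = (Λ * ‖s₀‖) * (‖s₀‖ ^ (m - 1) * ‖t - t'‖) := by
            rw [hpow]; ring
        _ ≤ (θ * (‖(m : Ω)‖ * ‖U₀‖)) * (‖s₀‖ ^ (m - 1) * ‖t - t'‖) := by gcongr
        _ = _ := by rw [hSn]; ring
    · refine (H.U_lip t t' (a2.trans hsr) (b2.trans hsr)).trans ?_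
      gcongr
      exact le_max_left _ _
  have hVn : ∀ t, ‖L‖ * ‖t - τ‖ ≤ ρ → ‖lam‖ ^ κ * ‖V t‖ ≤ ‖z₀‖ := by
    intro t ht
    obtain ⟨-, a2⟩ := hrad t ht
    have h1 : ‖U t‖ = ‖U₀‖ := norm_eq_of_sub_le (θ := θ) (by linarith) ((hU t a2).trans
      (mul_le_mul_of_nonneg_left (mul_le_of_le_one_left hU0.le hm1) hθ.le))
    rw [← hsn]
    simp only [hV]
    rw [norm_mul, norm_pow, h1]
    gcongr
  have hρM : ρ / ‖M‖ = ‖(d : Ω)‖ * ‖(d : Ω)‖ * η * ‖z₀‖ := by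
    rw [hρ]; field_simp
  have hw : ∀ w : Ω, ‖E‖ * ‖w‖ ≤ ρ → ‖lam‖ ^ κ * ‖w‖ ≤ ρ / ‖M‖ := by
    intro w hw
    rw [le_div_iff₀ hM0]
    calc _ = ‖E‖ * ‖w‖ := by rw [hEn]; ring
      _ ≤ ρ := hw
  have hρz : ρ / ‖M‖ ≤ ‖z₀‖ := by
    rw [hρM]
    exact mul_le_of_le_one_left hz0.le (mul_le_one₀ (mul_le_one₀ hd1 hd0.le hd1) hη.le hη1)
  have hVw : ∀ t w, ‖L‖ * ‖t - τ‖ ≤ ρ → ‖E‖ * ‖w‖ ≤ ρ → ‖lam‖ ^ κ * ‖V t + w‖ ≤ ‖z₀‖ := by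
    intro t w ht hwρ
    have h1 := hVn t ht
    have h2 := (hw w hwρ).trans hρz
    rw [← norm_pow, ← norm_mul] at h1 h2 ⊢
    rw [mul_add]
    exact norm_add_le_of_le h1 h2
  have ht0V : V τ - x = s₀ ^ m * (U τ - U₀) := by
    simp only [hV, hτ]
    rw [← hsU]
    ring
  -- after the iterates near the fixed point
  have hI : ∀ t w, ‖L‖ * ‖t - τ‖ ≤ ρ → ‖E‖ * ‖w‖ ≤ ρ →
      ‖iter q κ t (V t + w) - z₀‖ ≤ ρ / ‖M‖ := by
    intro t w ht hwρ
    obtain ⟨a1, a2⟩ := hrad t ht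
    have h1 : ‖lam ^ κ‖ * ‖V t + w - x‖ ≤ ρ / ‖M‖ := by
      have g1 : ‖lam ^ κ * (V t - V τ)‖ ≤ ρ / ‖M‖ := by
        have g2 : ‖V t - V τ‖ ≤ ‖S‖ * ‖t - τ‖ := norm_le_of_sub_le
          ((hVest t τ ht hττ).trans (mul_le_of_le_one_left (by positivity) hθ1)) (norm_mul _ _).le
        rw [norm_mul, norm_pow, le_div_iff₀ hM0]
        calc _ ≤ ‖lam‖ ^ κ * (‖S‖ * ‖t - τ‖) * ‖M‖ := by gcongr
          _ = ‖L‖ * ‖t - τ‖ := by rw [hLn, hEn]; ring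
          _ ≤ ρ := ht
      have g3 : ‖lam ^ κ * (V τ - x)‖ ≤ ρ / ‖M‖ := by
        have g4 := H.U_lip τ t₀ (hτt₀.trans hsr) ht0r
        rw [H.U_val] at g4
        rw [ht0V, norm_mul, norm_mul, norm_pow, norm_pow, le_div_iff₀ hM0]
        have g5 : (‖lam‖ ^ κ * (‖s₀‖ ^ m * ‖U τ - U₀‖) * ‖M‖) * ‖U₀‖ ≤ ρ * ‖U₀‖ := by
          calc _ = (‖lam‖ ^ κ * (‖s₀‖ ^ m * ‖U₀‖)) * ‖M‖ * ‖U τ - U₀‖ := by ring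
            _ = ‖z₀‖ * ‖M‖ * ‖U τ - U₀‖ := by rw [hsn]
            _ ≤ ‖z₀‖ * ‖M‖ * (Λ * ‖s₀‖) := by
                gcongr; exact g4.trans (mul_le_mul_of_nonneg_left hτt₀ hΛ)
            _ = Λ * ‖z₀‖ * ‖M‖ * ‖s₀‖ := by ring
            _ ≤ _ := by rw [mul_comm ρ]; exact e5
        exact le_of_mul_le_mul_right g5 hU0
      have g6 : ‖lam ^ κ * w‖ ≤ ρ / ‖M‖ := by rw [norm_mul, norm_pow]; exact hw w hwρ
      have g7 : lam ^ κ * (V t + w - x) =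
          lam ^ κ * (V t - V τ) + (lam ^ κ * (V τ - x) + lam ^ κ * w) := by ring
      rw [← norm_mul, g7]
      exact norm_add_le_of_le g1 (norm_add_le_of_le g3 g6)
    have h2 := H.iter_est (a2.trans hsr) ht0r (hVw t w ht hwρ) hxn.le
    rw [hxz, hxn] at h2
    refine norm_le_of_sub_le (h2.trans (max_le ?_ ?_)) (by rw [norm_mul]; exact h1)
    · exact (mul_le_of_le_one_left (by positivity) hθ1).trans h1
    · rw [le_div_iff₀ hM0]
      calc _ ≤ Λq * ‖z₀‖ * ‖s₀‖ * ‖M‖ := by gcongr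
        _ = Λq * ‖z₀‖ * ‖M‖ * ‖s₀‖ := by ring
        _ ≤ ρ := e6
  have hIr : ∀ t w, ‖L‖ * ‖t - τ‖ ≤ ρ → ‖E‖ * ‖w‖ ≤ ρ → ‖iter q κ t (V t + w) - z₀‖ ≤ r :=
    fun t w ht hwρ => (hI t w ht hwρ).trans (by rw [hρM]; exact hηr)
  have hk0 : (0 : Ω) ∈ k₂ := k₂.zero_mem
  have hEk : E ∈ k₂ := k₂.mul_mem (hK₂ H.M_mem) (k₂.pow_mem (hK₂ H.lam_mem) _)
  have hVmem : ∀ t ∈ k₂, ‖L‖ * ‖t - τ‖ ≤ ρ → V t ∈ k₂ := by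
    intro t htk ht
    exact k₂.mul_mem (k₂.pow_mem (k₂.sub_mem htk (hK₂ H.t₀_mem)) _)
      (H.U_mem k₂ hk₂ t htk ((hrad t ht).2.trans hsr))
  refine ⟨k₂, hk₂, hkk₁.trans hkk₂, τ, L, E, fun t w => s t (iter q κ t (V t + w)), N + κ, h₀,
    ⟨?_, ?_, hEk, mul_ne_zero hE0 hS0, hE0, ?_, ?_, ?_, ?_, ?_⟩, hh₀k, ?_, hhε, ?_⟩
  · exact k₂.add_mem (hK₂ H.t₀_mem) (hkk₂ hs₀k)
  · exact k₂.mul_mem hEk (k₂.mul_mem (k₂.mul_mem (natCast_mem k₂ m) (hK₂ H.U₀_mem))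
      (k₂.pow_mem (hkk₂ hs₀k) _))
  · intro t _ ht
    exact (hrad t ht).2.trans e1
  · intro t htk ht w hwk hwρ
    have htr := (hrad t ht).2.trans hsr
    exact H.s_mem k₂ hk₂ t htk _ (H.iter_mem hk₂ htk (k₂.add_mem (hVmem t htk ht) hwk) htr
      (hVw t w ht hwρ)) htr (hIr t w ht hwρ)
  · intro t htk ht t' htk' ht' w hwk hwρ w' hwk' hwρ'
    have htr := (hrad t ht).2.trans hsr
    have htr' := (hrad t' ht').2.trans hsr
    set mm := max (‖L‖ * ‖t - t'‖) (‖E‖ * ‖w - w'‖) with hmm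
    have hmm0 : 0 ≤ mm := le_max_of_le_left (by positivity)
    have hLmm : ‖L‖ * ‖t - t'‖ ≤ mm := le_max_left _ _
    have hEmm : ‖E‖ * ‖w - w'‖ ≤ mm := le_max_right _ _
    have hsmall : ∀ {a : ℝ}, a * ‖s₀‖ ≤ θ * (‖M‖ * ‖(m : Ω)‖ * ‖z₀‖) →
        a * ‖t - t'‖ ≤ θ * mm := by
      intro a ha
      have h1 : a ≤ θ * ‖L‖ := by
        rw [← hLs] at ha
        have : a * ‖s₀‖ ≤ θ * ‖L‖ * ‖s₀‖ := by linarith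
        exact le_of_mul_le_mul_right this hsp
      calc a * ‖t - t'‖ ≤ θ * ‖L‖ * ‖t - t'‖ := by gcongr
        _ = θ * (‖L‖ * ‖t - t'‖) := by ring
        _ ≤ _ := by gcongr
    have b1 : ‖E * (V t + w - (V t' + w') - S * (t - t') - (w - w'))‖ ≤ θ * mm := by
      have : V t + w - (V t' + w') - S * (t - t') - (w - w') = V t - V t' - S * (t - t') := by
        ring
      rw [this, norm_mul]
      calc _ ≤ ‖E‖ * (θ * (‖S‖ * ‖t - t'‖)) := by gcongr; exact hVest t t' ht ht'
        _ = θ * (‖L‖ * ‖t - t'‖) := by rw [hLn]; ring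
        _ ≤ _ := by gcongr
    have b2 : ‖E * (V t + w - (V t' + w'))‖ ≤ mm := by
      have : E * (V t + w - (V t' + w')) =
          E * (V t + w - (V t' + w') - S * (t - t') - (w - w')) + (L * (t - t') + E * (w - w')) := by
        rw [hL]; ring
      rw [this]
      exact norm_add_le_of_le (b1.trans (mul_le_of_le_one_left hmm0 hθ1))
        (norm_add_le_of_le (by rw [norm_mul]; exact hLmm) (by rw [norm_mul]; exact hEmm))
    have c0 := H.iter_est htr htr' (hVw t w ht hwρ) (hVw t' w' ht' hwρ')
    have c1 : ‖M * (iter q κ t (V t + w) - iter q κ t' (V t' + w') -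
        lam ^ κ * (V t + w - (V t' + w')))‖ ≤ θ * mm := by
      rw [norm_mul]
      refine (mul_le_mul_of_nonneg_left c0 hM0.le).trans ?_
      rw [mul_max_of_nonneg _ _ hM0.le]
      refine max_le ?_ ?_
      · rw [norm_mul] at b2
        calc _ = θ * (‖E‖ * ‖V t + w - (V t' + w')‖) := by rw [hEn, norm_pow]; ring
          _ ≤ _ := by gcongr
      · have h1 : ‖M‖ * (Λq * (‖lam‖ ^ κ * ‖V t' + w'‖) * ‖t - t'‖) ≤
            (Λq * ‖z₀‖ * ‖M‖) * ‖t - t'‖ := by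
          calc _ ≤ ‖M‖ * (Λq * ‖z₀‖ * ‖t - t'‖) := by gcongr; exact hVw t' w' ht' hwρ'
            _ = _ := by ring
        refine h1.trans (hsmall ?_)
        calc _ = (Λq * ‖s₀‖) * (‖z₀‖ * ‖M‖) := by ring
          _ ≤ (θ * ‖(m : Ω)‖) * (‖z₀‖ * ‖M‖) := by gcongr
          _ = _ := by ring
    have c2 : ‖M * (iter q κ t (V t + w) - iter q κ t' (V t' + w'))‖ ≤ mm := by
      have : M * (iter q κ t (V t + w) - iter q κ t' (V t' + w')) =
          M * (iter q κ t (V t + w) - iter q κ t' (V t' + w') -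
            lam ^ κ * (V t + w - (V t' + w'))) + E * (V t + w - (V t' + w')) := by
        rw [hE]; ring
      rw [this]
      exact norm_add_le_of_le (c1.trans (mul_le_of_le_one_left hmm0 hθ1)) b2
    have d0 := H.s_est t t' _ _ htr htr' (hIr t w ht hwρ) (hIr t' w' ht' hwρ')
    have : s t (iter q κ t (V t + w)) - s t' (iter q κ t' (V t' + w')) - L * (t - t') -
        E * (w - w') =
        (s t (iter q κ t (V t + w)) - s t' (iter q κ t' (V t' + w')) -
          M * (iter q κ t (V t + w) - iter q κ t' (V t' + w'))) +
        (M * (iter q κ t (V t + w) - iter q κ t' (V t' + w') -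
          lam ^ κ * (V t + w - (V t' + w'))) +
        E * (V t + w - (V t' + w') - S * (t - t') - (w - w'))) := by
      rw [hL, hE]; ring
    show ‖s t (iter q κ t (V t + w)) - s t' (iter q κ t' (V t' + w')) - L * (t - t') -
        E * (w - w')‖ ≤ _
    rw [this]
    refine norm_add_le_of_le (d0.trans (max_le ?_ (hsmall e4))) (norm_add_le_of_le c1 b1)
    rw [norm_mul] at c2
    gcongr
  · have hE0ρ : ‖E‖ * ‖(0 : Ω)‖ ≤ ρ := by simpa using hρ0.le
    have h1 := H.s_est τ t₀ (iter q κ τ (V τ + 0)) z₀ (hτt₀.trans hsr) ht0r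
      (hIr τ 0 hττ hE0ρ) (by simpa using H.r_pos.le)
    rw [H.s_val, sub_zero] at h1
    have h2 := hI τ 0 hττ hE0ρ
    have h3 : ‖M‖ * ‖iter q κ τ (V τ + 0) - z₀‖ ≤ ρ := by
      rw [le_div_iff₀ hM0] at h2
      linarith
    refine norm_le_of_sub_le (h1.trans (max_le ?_ ?_)) (by rw [norm_mul]; exact h3)
    · exact (mul_le_of_le_one_left (by positivity) hθ1).trans h3
    · exact (mul_le_mul_of_nonneg_left hτt₀ hΛ).trans e7
  · intro t htk ht w hwk hwρ
    have htr := (hrad t ht).2.trans hsr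
    rw [Function.iterate_add_apply, H.dyn_iter htr (hVw t w ht hwρ),
      H.dyn_s t _ htr (hIr t w ht hwρ)]
  · rw [hh₀, hE]
    have := H.A_ne
    have := H.M_ne
    field_simp
  · by_contra! hc
    have hB0 : 0 ≤ B := hLp.le.trans hc.le
    have h1 := (mul_le_mul_of_nonneg_left hse hB0).trans e8
    rw [← hLs] at h1
    exact absurd (le_of_mul_le_mul_right h1 hsp) (not_le.2 hc)

/-- In the local model of a Misiurewicz bifurcation some field of the collection contains a
parameter at which the critical point returns arbitrarily close to itself. -/
theorem exists_parameter [CompleteSpace Ω] [IsAlgClosed Ω] (hm : (m : Ω) ≠ 0) :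
    ∃ k ∈ C, ∃ t ∈ k, ‖t - t₀‖ ≤ r ∧ ∀ ε > 0, ∃ (n : ℕ) (y : Ω), y ≠ 0 ∧ ‖y‖ < ε ∧
      (T t)^[n] (P t 0) = P t y := by
  have hA0 : 0 < ‖A‖ := norm_pos_iff.2 H.A_ne
  have hd0 : 0 < ‖(d : Ω)‖ := norm_pos_iff.2 H.d_ne
  have hm0 : 0 < ‖(m : Ω)‖ := norm_pos_iff.2 hm
  have hd' : d ≠ 0 := by have := H.d_pos; omega
  have hθ := H.θ_pos
  have hr := H.r_pos
  have ev : ∀ a b : ℝ, 0 < b → ∀ᶠ x : ℝ in 𝓝[>] 0, a * x ≤ b := by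
    intro a b hb
    have : Tendsto (fun x : ℝ => a * x) (𝓝 0) (𝓝 (a * 0)) := (continuous_const_mul a).tendsto 0
    rw [mul_zero] at this
    exact ((this.eventually (gt_mem_nhds hb)).filter_mono nhdsWithin_le_nhds).mono
      fun x hx => hx.le
  have h0 : ∀ᶠ x : ℝ in 𝓝[>] 0, 0 < x := eventually_mem_nhdsWithin
  -- The constants are chosen in the order `δ`, `η`, `ρ`, `ω`, `ε`: `ρ` is determined by `η`, the
  -- preimage `ω` is to be at most of size `ρ`, and the solution `h₀` of the first stage at most of
  -- size `ε`.
  obtain ⟨δ, hδ0, hδr, hδ⟩ :=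
    (h0.and ((ev 1 r hr).and (ev Λ (θ * (‖(d : Ω)‖ * ‖A‖)) (by positivity)))).exists
  rw [one_mul] at hδr
  obtain ⟨η, hη, hη2, hηθ, hηr, hηδ, hηm⟩ := (h0.and ((ev 1 (1 / 2) (by norm_num)).and
    ((ev 1 (θ * ‖(d : Ω)‖) (by positivity)).and
    ((ev (‖(d : Ω)‖ * ‖(d : Ω)‖ * ‖z₀‖) r hr).and
    ((ev (‖(d : Ω)‖ * ‖(d : Ω)‖ * ‖M‖ * ‖z₀‖) δ hδ0).and
    (ev (‖(d : Ω)‖ * ‖(d : Ω)‖) (θ * ‖(m : Ω)‖ * ‖(m : Ω)‖) (by positivity))))))).exists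
  rw [one_mul] at hη2 hηθ
  rw [mul_right_comm] at hηr
  have hz0 : 0 < ‖z₀‖ := norm_pos_iff.2 H.z₀_ne
  have hM0 : 0 < ‖M‖ := norm_pos_iff.2 H.M_ne
  set ρ : ℝ := ‖(d : Ω)‖ * ‖(d : Ω)‖ * ‖M‖ * ‖z₀‖ * η with hρ
  have hρ0 : 0 < ρ := by positivity
  obtain ⟨k, hk, ω, hωk, hω0, hωρ, κ, hωn, hωz⟩ := H.exists_preimage_near hδr hδ hδ0 hρ0 hηδ
  have hωp : 0 < ‖ω‖ := norm_pos_iff.2 hω0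
  obtain ⟨δ', hδ'0, hδ'δ, f, σ, Λ', hΛΛ', hS⟩ := H.exists_returnSystem hδr hδ hδ0 hη hη2 hηθ hηr
    hρ hηδ hωk hω0 hωρ hωn hωz
  have hσ0 : 0 < ‖σ‖ := norm_pos_iff.2 (hS k hk le_rfl).σ_ne
  set ε : ℝ := min (min ρ (θ * (‖(d : Ω)‖ * ‖ω‖)))
    (min (θ * (‖(d : Ω)‖ * ‖σ‖ * ‖ω‖)) (‖(d : Ω)‖ * η * ‖ω‖)) with hε
  obtain ⟨k', hk', hkk', τ, L, E, ψ, n, h₀, hst, hh₀, hE, hhε, hB⟩ := H.exists_stage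
    (B := max Λ' (Λ' * ρ / (θ * (‖(d : Ω)‖ * ‖A‖)))) (ε := ε) hδ'0 (hδ'δ.trans hδr) hη
    (by linarith) hm hηm hηr hρ hk hωk (by positivity)
  obtain ⟨t, htk, htD, ht⟩ := exists_recurrent_parameter (hS k' hk' hkk')
    (by intro t _ _; rw [zero_pow hd', zero_mul]) hst hh₀ hE
    (hhε.trans ((min_le_left _ _).trans (min_le_left _ _)))
    (hhε.trans ((min_le_left _ _).trans (min_le_right _ _)))
    (hhε.trans ((min_le_right _ _).trans (min_le_left _ _)))
    (hhε.trans ((min_le_right _ _).trans (min_le_right _ _)))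
    (by
      have h1 := (le_max_right _ _).trans hB
      rw [div_le_iff₀ (by positivity)] at h1
      linarith)
    ((le_max_left _ _).trans hB)
  exact ⟨k', hk', t, htk, (show ‖t - t₀‖ ≤ δ' from htD).trans (hδ'δ.trans hδr), ht⟩

end LocalModel
end Model

/-! ### Power series with coefficients in a closed subfield -/

section Holomorphic

variable {Ω : Type*} [NontriviallyNormedField Ω] [IsUltrametricDist Ω]

variable (Ω) in
theorem nonarchimedeanRing : NonarchimedeanRing Ω where
  is_nonarchimedean := (inferInstance : NonarchimedeanAddGroup Ω).is_nonarchimedean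

omit [IsUltrametricDist Ω] in
theorem hasSum_of_eq {ι : Type*} {f g : ι → Ω} {x : Ω} (h : ∀ n, f n = g n) (hg : HasSum g x) :
    HasSum f x := by
  rwa [funext h]

theorem hasSum_antidiagonal {α : Type*} [AddCommGroup α] [TopologicalSpace α]
    [IsTopologicalAddGroup α] [T3Space α] {f : ℕ × ℕ → α} {x : α} (h : HasSum f x) :
    HasSum (fun n => ∑ ij ∈ Finset.HasAntidiagonal.antidiagonal n, f ij) x := by
  have h' := (Finset.HasAntidiagonal.sigmaAntidiagonalEquivProd (A := ℕ)).hasSum_iff.2 h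
  refine h'.sigma fun n => ?_
  have := hasSum_fintype (fun y : Finset.HasAntidiagonal.antidiagonal n => f y.1)
  rw [Finset.sum_coe_sort (Finset.HasAntidiagonal.antidiagonal n) f] at this
  exact this

omit [IsUltrametricDist Ω] in
theorem mem_of_hasSum {k : Subfield Ω} (hk : IsClosed (k : Set Ω)) {f : ℕ → Ω} {x : Ω}
    (hf : ∀ n, f n ∈ k) (h : HasSum f x) : x ∈ k :=
  hk.mem_of_tendsto h (Eventually.of_forall fun _ => sum_mem fun i _ => hf i)

/-- The ring of the functions that are given on `B` by a power series around `ζ` with coefficients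
in `K`; the values outside `B` are arbitrary. -/
def holRing (K : Subfield Ω) (ζ : Ω) (B : Set Ω) : Subring (Ω → Ω) where
  carrier := {f | ∃ a : ℕ → Ω, (∀ n, a n ∈ K) ∧ ∀ t ∈ B, HasSum (fun n => a n * (t - ζ) ^ n) (f t)}
  mul_mem' := by
    rintro f g ⟨a, haK, ha⟩ ⟨b, hbK, hb⟩
    have := nonarchimedeanRing Ω
    refine ⟨fun n => ∑ ij ∈ Finset.HasAntidiagonal.antidiagonal n, a ij.1 * b ij.2,
      fun n => sum_mem fun ij _ => K.mul_mem (haK _) (hbK _), fun t ht => ?_⟩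
    have h := hasSum_antidiagonal ((ha t ht).mul_of_nonarchimedean (hb t ht))
    refine hasSum_of_eq (fun n => ?_) h
    rw [Finset.sum_mul]
    refine Finset.sum_congr rfl fun ij hij => ?_
    rw [← Finset.HasAntidiagonal.mem_antidiagonal.1 hij, pow_add]
    ring
  one_mem' := ⟨fun n => if n = 0 then 1 else 0, fun n => by
      dsimp only; split_ifs; exacts [K.one_mem, K.zero_mem], fun t _ => by
      convert hasSum_single (f := fun n => (if n = 0 then (1 : Ω) else 0) * (t - ζ) ^ n) 0
        (fun n hn => by simp [hn]) using 1
      simp⟩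
  add_mem' := by
    rintro f g ⟨a, haK, ha⟩ ⟨b, hbK, hb⟩
    refine ⟨fun n => a n + b n, fun n => K.add_mem (haK _) (hbK _), fun t ht => ?_⟩
    simp only [add_mul]
    exact (ha t ht).add (hb t ht)
  zero_mem' := ⟨fun _ => 0, fun _ => K.zero_mem, fun t _ => by simp⟩
  neg_mem' := by
    rintro f ⟨a, haK, ha⟩
    refine ⟨fun n => -a n, fun n => K.neg_mem (haK _), fun t ht => ?_⟩
    simp only [neg_mul]
    exact (ha t ht).neg

variable {K : Subfield Ω} {ζ : Ω} {B : Set Ω}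

theorem holRing_apply_mem {k : Subfield Ω} (hk : IsClosed (k : Set Ω)) (hKk : K ≤ k) (hζ : ζ ∈ k)
    {f : Ω → Ω} (hf : f ∈ holRing K ζ B) {t : Ω} (ht : t ∈ k) (htB : t ∈ B) : f t ∈ k := by
  obtain ⟨a, haK, ha⟩ := hf
  exact mem_of_hasSum hk (fun n => k.mul_mem (hKk (haK n)) (k.pow_mem (k.sub_mem ht hζ) n))
    (ha t htB)

theorem holRing_analyticAt (hB : B ∈ 𝓝 ζ) {f : Ω → Ω} (hf : f ∈ holRing K ζ B) :
    AnalyticAt Ω f ζ := by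
  obtain ⟨a, -, ha⟩ := hf
  refine ⟨FormalMultilinearSeries.ofScalars Ω a, hasFPowerSeriesAt_iff.2 ?_⟩
  have h0 : Tendsto (fun z => ζ + z) (𝓝 0) (𝓝 ζ) := by
    have h : Continuous fun z : Ω => ζ + z := by fun_prop
    simpa using h.tendsto 0
  filter_upwards [h0 hB] with z hz
  have := ha _ hz
  simp only [add_sub_cancel_left] at this
  simpa only [FormalMultilinearSeries.coeff_ofScalars, smul_eq_mul, mul_comm] using this

/-- A function with a power series expansion vanishes to finite order at the center, unless it
vanishes identically. -/
theorem holRing_exists_order {f : Ω → Ω} (hf : f ∈ holRing K ζ B) (hne : ∃ t ∈ B, f t ≠ 0) :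
    ∃ m : ℕ, ∃ g ∈ holRing K ζ B, (ζ ∈ B → g ζ ≠ 0) ∧ ∀ t ∈ B, f t = (t - ζ) ^ m * g t := by
  classical
  obtain ⟨a, haK, ha⟩ := hf
  have hex : ∃ n, a n ≠ 0 := by
    by_contra! h
    obtain ⟨t, ht, htne⟩ := hne
    refine htne ((ha t ht).unique ?_)
    simp [h]
  set m := Nat.find hex with hm
  have hlow : ∀ n < m, a n = 0 := fun n hn => by simpa using Nat.find_min hex hn
  have hshift : ∀ t ∈ B, HasSum (fun n => a (n + m) * (t - ζ) ^ (n + m)) (f t) := by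
    intro t ht
    have := (hasSum_nat_add_iff' m).2 (ha t ht)
    rwa [Finset.sum_eq_zero (fun i hi => by rw [hlow i (Finset.mem_range.1 hi), zero_mul]),
      sub_zero] at this
  set g : Ω → Ω := fun t => ∑' n, a (n + m) * (t - ζ) ^ n with hg
  have hgs : ∀ t ∈ B, HasSum (fun n => a (n + m) * (t - ζ) ^ n) (g t) := by
    intro t ht
    refine Summable.hasSum ?_
    rcases eq_or_ne t ζ with rfl | hne
    · exact (hasSum_single 0 (fun n hn => by simp [hn])).summable
    · refine ((hshift t ht).summable.mul_right (((t - ζ) ^ m)⁻¹)).congr fun n => ?_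
      rw [pow_add]
      field_simp [sub_ne_zero.2 hne]
  refine ⟨m, g, ⟨fun n => a (n + m), fun n => haK _, hgs⟩, fun hζ => ?_, fun t ht => ?_⟩
  · have h1 : g ζ = a m := (hgs ζ hζ).unique (by
      simpa using hasSum_single (f := fun n => a (n + m) * (ζ - ζ) ^ n) 0
        (fun n hn => by simp [hn]))
    rw [h1]
    exact Nat.find_spec hex
  · refine (hshift t ht).unique ?_
    refine hasSum_of_eq (fun n => ?_) ((hgs t ht).mul_left ((t - ζ) ^ m))
    rw [pow_add]
    ring

end Holomorphic

section Recenter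

variable {Ω : Type*} [NontriviallyNormedField Ω] [IsUltrametricDist Ω] [CompleteSpace Ω]
variable {K : Subfield Ω} {ζ : Ω} {B : Set Ω}

/-- On a set over which a power series converges, the power series can be recentered at any
point of the set, without loss of the domain of convergence. -/
theorem holRing_recenter (hK : IsClosed (K : Set Ω)) (hζ : ζ ∈ K) {ζ' : Ω} (hζ' : ζ' ∈ K)
    (hζB : ζ' ∈ B) : holRing K ζ B ≤ holRing K ζ' B := by
  rintro f ⟨a, haK, ha⟩
  set w := ζ' - ζ with hw
  have hlim : ∀ t ∈ B, Tendsto (fun n => ‖a n‖ * ‖t - ζ‖ ^ n) atTop (𝓝 0) := by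
    intro t ht
    have h := (ha t ht).summable.tendsto_atTop_zero.norm
    simpa only [norm_mul, norm_pow, norm_zero] using h
  -- the terms of the double series
  set G : Ω → ℕ × ℕ → Ω := fun t ij =>
    a (ij.1 + ij.2) * ((ij.1 + ij.2).choose ij.1 : Ω) * (t - ζ') ^ ij.1 * w ^ ij.2 with hG
  have hmax : ∀ t ∈ B, ∃ s ∈ B, ‖t - ζ'‖ ≤ ‖s - ζ‖ ∧ ‖w‖ ≤ ‖s - ζ‖ := by
    intro t ht
    have hle : ‖t - ζ'‖ ≤ max ‖t - ζ‖ ‖w‖ := by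
      have : t - ζ' = (t - ζ) - w := by rw [hw]; ring
      rw [this]
      exact norm_sub_le_of_le (le_max_left _ _) (le_max_right _ _)
    rcases le_total ‖t - ζ‖ ‖w‖ with h | h
    · rw [max_eq_right h] at hle
      exact ⟨ζ', hζB, hle, le_rfl⟩
    · rw [max_eq_left h] at hle
      exact ⟨t, ht, hle, h⟩
  have hGs : ∀ t ∈ B, Summable (G t) := by
    intro t ht
    refine NonarchimedeanAddGroup.summable_of_tendsto_cofinite_zero ?_
    obtain ⟨s, hs, h1, h2⟩ := hmax t ht
    rw [Metric.tendsto_nhds]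
    intro ε hε
    obtain ⟨N, hN⟩ := eventually_atTop.1 ((hlim s hs).eventually (gt_mem_nhds hε))
    refine (((Finset.range N) ×ˢ (Finset.range N)).finite_toSet).subset fun ij hij => ?_
    by_contra hnot
    refine hij ?_
    have hge : N ≤ ij.1 + ij.2 := by
      by_contra hlt
      simp only [Finset.coe_product, Finset.coe_range, Set.mem_prod, Set.mem_Iio, not_and_or,
        not_lt] at hnot
      omega
    change dist (G t ij) 0 < ε
    rw [dist_zero_right]
    refine lt_of_le_of_lt ?_ (hN _ hge)
    simp only [hG, norm_mul, norm_pow]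
    calc _ ≤ ‖a (ij.1 + ij.2)‖ * 1 * ‖s - ζ‖ ^ ij.1 * ‖s - ζ‖ ^ ij.2 := by
          gcongr
          exact IsUltrametricDist.norm_natCast_le_one Ω _
      _ = _ := by rw [pow_add]; ring
  have hGsum : ∀ t ∈ B, HasSum (G t) (f t) := by
    intro t ht
    have h1 := hasSum_antidiagonal (hGs t ht).hasSum
    have h2 : HasSum (fun n => ∑ ij ∈ Finset.HasAntidiagonal.antidiagonal n, G t ij) (f t) := by
      refine hasSum_of_eq (fun n => ?_) (ha t ht)
      have : t - ζ = (t - ζ') + w := by rw [hw]; ring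
      rw [this, (Commute.all (t - ζ') w).add_pow', Finset.mul_sum]
      refine Finset.sum_congr rfl fun ij hij => ?_
      rw [← Finset.HasAntidiagonal.mem_antidiagonal.1 hij]
      simp only [hG, nsmul_eq_mul]
      ring
    rw [← h1.unique h2]
    exact (hGs t ht).hasSum
  have hin : ∀ i, Summable fun j => a (i + j) * ((i + j).choose i : Ω) * w ^ j := by
    intro i
    rcases eq_or_ne w 0 with h0 | h0
    · exact (hasSum_single 0 (fun n hn => by simp [h0, hn])).summable
    · refine NonarchimedeanAddGroup.summable_of_tendsto_cofinite_zero ?_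
      rw [Nat.cofinite_eq_atTop]
      have h1 : Tendsto (fun j => (‖w‖ ^ i)⁻¹ * (‖a (j + i)‖ * ‖w‖ ^ (j + i))) atTop (𝓝 0) := by
        simpa using (((tendsto_add_atTop_iff_nat i).2 (hlim ζ' hζB)).const_mul ((‖w‖ ^ i)⁻¹))
      refine squeeze_zero_norm (fun j => ?_) h1
      have hw0 : ‖w‖ ^ i ≠ 0 := pow_ne_zero _ (norm_ne_zero_iff.2 h0)
      have : (‖w‖ ^ i)⁻¹ * (‖a (j + i)‖ * ‖w‖ ^ (j + i)) = ‖a (i + j)‖ * 1 * ‖w‖ ^ j := by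
        rw [pow_add, add_comm j i]
        field_simp
      rw [this, norm_mul, norm_mul, norm_pow]
      gcongr
      exact IsUltrametricDist.norm_natCast_le_one Ω _
  refine ⟨fun i => ∑' j, a (i + j) * ((i + j).choose i : Ω) * w ^ j, fun i => ?_, fun t ht => ?_⟩
  · exact mem_of_hasSum hK (fun j => K.mul_mem (K.mul_mem (haK _) (natCast_mem K _))
      (K.pow_mem (K.sub_mem hζ' hζ) j)) (hin i).hasSum
  · refine (hGsum t ht).prod_fiberwise fun i => ?_
    refine hasSum_of_eq (fun j => ?_) ((hin i).hasSum.mul_right ((t - ζ') ^ i))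
    simp only [hG]
    ring

end Recenter

section AlgebraicZero

theorem exists_forall_le_of_tendsto_zero {c : ℕ → ℝ} (h0 : ∀ n, 0 ≤ c n)
    (h : Tendsto c atTop (𝓝 0)) : ∃ n, ∀ i, c i ≤ c n := by
  by_cases hz : ∀ i, c i = 0
  · exact ⟨0, fun i => by rw [hz, hz]⟩
  · push Not at hz
    obtain ⟨i₀, hi₀⟩ := hz
    have hpos : 0 < c i₀ := lt_of_le_of_ne (h0 _) (Ne.symm hi₀)
    obtain ⟨N, hN⟩ := eventually_atTop.1 (h.eventually (gt_mem_nhds hpos))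
    have hi₀N : i₀ < N := by
      by_contra hge
      exact lt_irrefl _ (hN i₀ (not_lt.1 hge))
    obtain ⟨n, -, hn⟩ := Finset.exists_max_image (Finset.range N) c ⟨i₀, Finset.mem_range.2 hi₀N⟩
    refine ⟨n, fun i => ?_⟩
    rcases lt_or_ge i N with hi | hi
    · exact hn i (Finset.mem_range.2 hi)
    · exact (hN i hi).le.trans (hn i₀ (Finset.mem_range.2 hi₀N))

variable {F Ω : Type*} [NontriviallyNormedField F] [CompleteSpace F] [NontriviallyNormedField Ω]
  [IsUltrametricDist Ω] [NormedAlgebra F Ω]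

/-- A zero of a nonzero power series with coefficients in a finite extension `K` of the complete
field `F` is algebraic over `F`. If `a n * w ^ n` is the last term of maximal size then every power
of `w` can be approximated arbitrarily well by the span of `1, ..., w ^ (n - 1)` over `K`, which is
closed. -/
theorem isAlgebraic_of_hasSum_zero (K : IntermediateField F Ω) [FiniteDimensional F K]
    {a : ℕ → Ω} (haK : ∀ n, a n ∈ K) {w : Ω} (hw : HasSum (fun n => a n * w ^ n) 0)
    (hne : ∃ n, a n ≠ 0) : IsAlgebraic F w := by
  rcases eq_or_ne w 0 with rfl | hw0
  · exact isAlgebraic_zero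
  have hwp : 0 < ‖w‖ := norm_pos_iff.2 hw0
  set c : ℕ → ℝ := fun i => ‖a i * w ^ i‖ with hc
  have hcnn : ∀ i, 0 ≤ c i := fun i => norm_nonneg _
  have hlim : Tendsto c atTop (𝓝 0) := by
    have h := hw.summable.tendsto_atTop_zero.norm
    rwa [norm_zero] at h
  obtain ⟨n₀, hn₀⟩ := exists_forall_le_of_tendsto_zero hcnn hlim
  have hμ : 0 < c n₀ := by
    obtain ⟨i, hi⟩ := hne
    exact (norm_pos_iff.2 (mul_ne_zero hi (pow_ne_zero _ hw0))).trans_le (hn₀ i)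
  -- the last index where the maximum is attained
  obtain ⟨n, hn, hnlast⟩ : ∃ n, c n = c n₀ ∧ ∀ i, n < i → c i < c n := by
    obtain ⟨N, hN⟩ := eventually_atTop.1 (hlim.eventually (gt_mem_nhds hμ))
    have hlt : ∀ i, c i = c n₀ → i ≤ N := by
      intro i hi
      by_contra hgt
      exact absurd (hN i (by omega)) (by rw [hi]; exact lt_irrefl _)
    refine ⟨Nat.findGreatest (fun i => c i = c n₀) N, ?_, fun i hi => ?_⟩
    · exact Nat.findGreatest_spec (P := fun i => c i = c n₀) (hlt n₀ rfl) rfl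
    · rw [Nat.findGreatest_spec (P := fun i => c i = c n₀) (hlt n₀ rfl) rfl]
      refine lt_of_le_of_ne (hn₀ i) fun h => ?_
      exact absurd (Nat.le_findGreatest (hlt i h) h) (not_le.2 hi)
  have hmax : ∀ i, c i ≤ c n := fun i => by rw [hn]; exact hn₀ i
  have hcn : 0 < c n := by rw [hn]; exact hμ
  obtain ⟨θ, hθ0, hθ1, hθ⟩ : ∃ θ : ℝ, 0 < θ ∧ θ < 1 ∧ ∀ i, n < i → c i ≤ θ * c n := by
    obtain ⟨j, hj⟩ := exists_forall_le_of_tendsto_zero (c := fun i => c (i + (n + 1)))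
      (fun i => hcnn _) ((tendsto_add_atTop_iff_nat (n + 1)).2 hlim)
    refine ⟨max (1 / 2) (c (j + (n + 1)) / c n), by positivity, max_lt (by norm_num) ?_,
      fun i hi => ?_⟩
    · rw [div_lt_one hcn]
      exact hnlast _ (by omega)
    · have h1 := hj (i - (n + 1))
      rw [show i - (n + 1) + (n + 1) = i by omega] at h1
      calc c i ≤ c (j + (n + 1)) / c n * c n := by rw [div_mul_cancel₀ _ hcn.ne']; exact h1
        _ ≤ _ := by gcongr; exact le_max_right _ _
  have han : a n ≠ 0 := by
    intro h
    simp [hc, h] at hcn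
  set V : Submodule K Ω := Submodule.span K (Set.range fun i : Fin n => w ^ (i : ℕ)) with hV
  have hstep : ∀ C : ℝ, 0 < C → (∀ m, ∃ v ∈ V, ‖w ^ m - v‖ ≤ C * ‖w‖ ^ m) →
      ∀ m, ∃ v ∈ V, ‖w ^ m - v‖ ≤ θ * C * ‖w‖ ^ m := by
    intro C hC hCV m
    induction m using Nat.strong_induction_on with
    | _ m ih =>
    rcases lt_or_ge m n with hmn | hmn
    · refine ⟨w ^ m, Submodule.subset_span ⟨⟨m, hmn⟩, rfl⟩, ?_⟩
      rw [sub_self, norm_zero]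
      positivity
    have happ : ∀ i, ∃ v ∈ V, i ≠ n → ‖a i / a n * (w ^ (i + m - n) - v)‖ ≤ θ * C * ‖w‖ ^ m := by
      intro i
      have hpow : ‖w‖ ^ (i + m - n) * ‖w‖ ^ n = ‖w‖ ^ i * ‖w‖ ^ m := by
        rw [← pow_add, ← pow_add]; congr 1; omega
      have hci : ‖a i‖ * ‖w‖ ^ i = c i := by rw [hc]; simp
      have hcn' : ‖a n‖ * ‖w‖ ^ n = c n := by rw [hc]; simp
      have han' : 0 < ‖a n‖ := norm_pos_iff.2 han
      have hconv : ∀ s C' : ℝ, 0 ≤ C' → c i ≤ s * c n →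
          ‖a i / a n‖ * (C' * ‖w‖ ^ (i + m - n)) ≤ s * C' * ‖w‖ ^ m := by
        intro s C' hC' hs
        have hwn : 0 < ‖w‖ ^ n := pow_pos hwp n
        rw [norm_div, div_mul_eq_mul_div, div_le_iff₀ han', ← mul_le_mul_iff_left₀ hwn]
        calc ‖a i‖ * (C' * ‖w‖ ^ (i + m - n)) * ‖w‖ ^ n
            = C' * (‖a i‖ * ‖w‖ ^ i) * ‖w‖ ^ m := by linear_combination ‖a i‖ * C' * hpow
          _ ≤ C' * (s * c n) * ‖w‖ ^ m := by rw [hci]; gcongr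
          _ = _ := by rw [← hcn']; ring
      rcases lt_trichotomy i n with hi | hi | hi
      · obtain ⟨v, hv, hvn⟩ := ih (i + m - n) (by omega)
        refine ⟨v, hv, fun _ => ?_⟩
        rw [norm_mul]
        refine (mul_le_mul_of_nonneg_left hvn (norm_nonneg _)).trans ?_
        simpa using hconv 1 (θ * C) (by positivity) (by rw [one_mul]; exact hmax i)
      · exact ⟨0, V.zero_mem, fun h => absurd hi h⟩
      · obtain ⟨v, hv, hvn⟩ := hCV (i + m - n)
        refine ⟨v, hv, fun _ => ?_⟩
        rw [norm_mul]
        exact (mul_le_mul_of_nonneg_left hvn (norm_nonneg _)).trans (hconv θ C hC.le (hθ i hi))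
    choose v hvV hv using happ
    obtain ⟨N, hNn, hN⟩ : ∃ N, n < N ∧
        ‖∑ i ∈ Finset.range N, a i * w ^ i‖ ≤ θ * C * c n := by
      have h1 := hw.tendsto_sum_nat.norm
      rw [norm_zero] at h1
      have h2 := h1.eventually (gt_mem_nhds (show 0 < θ * C * c n by positivity))
      obtain ⟨N, hN1, hN2⟩ := (h2.and (eventually_gt_atTop n)).exists
      exact ⟨N, hN2, hN1.le⟩
    refine ⟨-∑ i ∈ (Finset.range N).erase n, a i / a n * v i, V.neg_mem (V.sum_mem fun i _ => ?_),
      ?_⟩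
    · exact V.smul_mem (⟨a i / a n, K.div_mem (haK i) (haK n)⟩ : K) (hvV i)
    · have hw1 : ∀ i, a i / a n * w ^ (i + m - n) = w ^ (m - n) / a n * (a i * w ^ i) := by
        intro i
        have : w ^ (i + m - n) = w ^ (m - n) * w ^ i := by rw [← pow_add]; congr 1; omega
        rw [this]
        ring
      have hS := Finset.add_sum_erase (Finset.range N) (fun i => a i * w ^ i)
        (Finset.mem_range.2 hNn)
      have heq : w ^ m - -∑ i ∈ (Finset.range N).erase n, a i / a n * v i =
          w ^ (m - n) / a n * ∑ i ∈ Finset.range N, a i * w ^ i -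
          ∑ i ∈ (Finset.range N).erase n, a i / a n * (w ^ (i + m - n) - v i) := by
        simp only [mul_sub, Finset.sum_sub_distrib, hw1]
        rw [← Finset.mul_sum, ← hS, mul_add]
        have : w ^ (m - n) / a n * (a n * w ^ n) = w ^ m := by
          rw [← hw1, div_self han, one_mul]; congr 1; omega
        rw [this]
        ring
      rw [heq]
      refine norm_sub_le_of_le ?_ ?_
      · rw [norm_mul, norm_div, norm_pow]
        have han' : 0 < ‖a n‖ := norm_pos_iff.2 han
        have hcn' : ‖a n‖ * ‖w‖ ^ n = c n := by rw [hc]; simp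
        calc _ ≤ ‖w‖ ^ (m - n) / ‖a n‖ * (θ * C * c n) := by gcongr
          _ = θ * C * (‖w‖ ^ (m - n) * ‖w‖ ^ n) := by rw [← hcn']; field_simp
          _ = _ := by rw [← pow_add]; congr 2; omega
      · refine IsUltrametricDist.norm_sum_le_of_forall_le_of_nonneg (by positivity) fun i hi => ?_
        exact hv i (Finset.ne_of_mem_erase hi)
  have hall : ∀ j : ℕ, ∀ m, ∃ v ∈ V, ‖w ^ m - v‖ ≤ θ ^ j * ‖w‖ ^ m := by
    intro j
    induction j with
    | zero => exact fun m => ⟨0, V.zero_mem, by simp⟩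
    | succ j ih =>
      rw [pow_succ']
      exact hstep _ (pow_pos hθ0 j) ih
  have hVfin : Module.Finite K V := Module.Finite.span_of_finite K (Set.finite_range _)
  have : FiniteDimensional F (V.restrictScalars F) := by
    change Module.Finite F V
    exact Module.Finite.trans K V
  have hcl : IsClosed ((V.restrictScalars F : Submodule F Ω) : Set Ω) :=
    Submodule.closed_of_finiteDimensional _
  have hmem : w ^ n ∈ V := by
    change w ^ n ∈ ((V.restrictScalars F : Submodule F Ω) : Set Ω)
    rw [← hcl.closure_eq, Metric.mem_closure_iff]
    intro ε hε
    have hlim2 : Tendsto (fun j => θ ^ j * ‖w‖ ^ n) atTop (𝓝 0) := by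
      simpa using (tendsto_pow_atTop_nhds_zero_of_lt_one hθ0.le hθ1).mul_const (‖w‖ ^ n)
    obtain ⟨j, hj⟩ := (hlim2.eventually (gt_mem_nhds hε)).exists
    obtain ⟨v, hv, hvn⟩ := hall j n
    exact ⟨v, hv, by rw [dist_eq_norm]; exact hvn.trans_lt hj⟩
  obtain ⟨b, hb⟩ := (Submodule.mem_span_range_iff_exists_fun K).1 hmem
  have hint : IsIntegral K w := by
    refine ⟨X ^ n - ∑ i : Fin n, C (b i) * X ^ (i : ℕ), ?_, ?_⟩
    · refine monic_X_pow_sub ?_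
      refine (degree_sum_le _ _).trans_lt ?_
      refine (Finset.sup_lt_iff (WithBot.bot_lt_coe n)).2 fun i _ => ?_
      exact (degree_C_mul_X_pow_le _ _).trans_lt (WithBot.coe_lt_coe.2 i.2)
    · rw [eval₂_sub, eval₂_X_pow, eval₂_finsetSum, ← hb, sub_eq_zero]
      refine Finset.sum_congr rfl fun i _ => ?_
      rw [eval₂_mul, eval₂_C, eval₂_X_pow, Algebra.smul_def]
  exact hint.isAlgebraic.restrictScalars F

end AlgebraicZero

/-! ### Homogeneous lifts -/

section Lift

/-- A pair of forms of degree `deg` in two variables; `num i` and `den i` are the coefficients of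
`x ^ i * y ^ (deg - i)` for `i ≤ deg`, and the later values of these sequences are irrelevant. -/
structure FormPair (A : Type*) where
  deg : ℕ
  num : ℕ → A
  den : ℕ → A

variable {A A' : Type*} [CommRing A] [CommRing A']

/-- The form `∑ i ≤ D, a i * x ^ i * y ^ (D - i)`. -/
def homEval (D : ℕ) (a : ℕ → A) (x y : A) : A :=
  ∑ i ∈ Finset.range (D + 1), a i * x ^ i * y ^ (D - i)

/-- The determinant of two vectors in the plane. -/
def wedge (v w : A × A) : A := v.1 * w.2 - v.2 * w.1

/-- The map on vectors induced by a ring homomorphism. -/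
def mapV (φ : A →+* A') (v : A × A) : A' × A' := (φ v.1, φ v.2)

/-- The map on vectors given by a pair of forms. -/
def FormPair.app (F : FormPair A) (v : A × A) : A × A :=
  (homEval F.deg F.num v.1 v.2, homEval F.deg F.den v.1 v.2)

/-- The change of the ring of coefficients. -/
def FormPair.map (φ : A →+* A') (F : FormPair A) : FormPair A' where
  deg := F.deg
  num i := φ (F.num i)
  den i := φ (F.den i)

theorem map_homEval (φ : A →+* A') (D : ℕ) (a : ℕ → A) (x y : A) :
    φ (homEval D a x y) = homEval D (fun i => φ (a i)) (φ x) (φ y) := by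
  simp [homEval, map_sum]

theorem homEval_smul (D : ℕ) (a : ℕ → A) (c x y : A) :
    homEval D a (c * x) (c * y) = c ^ D * homEval D a x y := by
  rw [homEval, homEval, Finset.mul_sum]
  refine Finset.sum_congr rfl fun i hi => ?_
  have : c ^ D = c ^ i * c ^ (D - i) := by
    rw [← pow_add]; congr 1; have := Finset.mem_range.1 hi; omega
  rw [this]
  ring

theorem homEval_one_right (D : ℕ) (a : ℕ → A) (x : A) :
    homEval D a x 1 = ∑ i ∈ Finset.range (D + 1), a i * x ^ i := by
  simp [homEval]

theorem homEval_zero_right (D : ℕ) (a : ℕ → A) (x : A) : homEval D a x 0 = a D * x ^ D := by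
  rw [homEval, Finset.sum_eq_single D]
  · simp
  · intro i hi hne
    have := Finset.mem_range.1 hi
    rw [zero_pow (by omega), mul_zero]
  · intro h
    exact absurd (Finset.mem_range.2 (Nat.lt_succ_self D)) h

theorem mapV_smul (φ : A →+* A') (c : A) (v : A × A) : mapV φ (c • v) = φ c • mapV φ v := by
  simp [mapV, Prod.smul_def]

theorem mapV_add (φ : A →+* A') (v w : A × A) : mapV φ (v + w) = mapV φ v + mapV φ w := by
  simp [mapV]

theorem mapV_mapV {A'' : Type*} [CommRing A''] (φ : A →+* A') (ψ : A' →+* A'') (v : A × A) :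
    mapV ψ (mapV φ v) = mapV (ψ.comp φ) v := rfl

theorem map_wedge (φ : A →+* A') (v w : A × A) :
    φ (wedge v w) = wedge (mapV φ v) (mapV φ w) := by
  simp [wedge, mapV]

theorem wedge_smul_left (c : A) (v w : A × A) : wedge (c • v) w = c * wedge v w := by
  simp [wedge]; ring

theorem wedge_smul_right (c : A) (v w : A × A) : wedge v (c • w) = c * wedge v w := by
  simp [wedge]; ring

theorem wedge_add_right (u v w : A × A) : wedge u (v + w) = wedge u v + wedge u w := by
  simp [wedge]; ring

theorem wedge_add_left (u v w : A × A) : wedge (u + v) w = wedge u w + wedge v w := by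
  simp [wedge]; ring

theorem wedge_self (v : A × A) : wedge v v = 0 := by simp [wedge]; ring

theorem wedge_swap (v w : A × A) : wedge w v = -wedge v w := by simp [wedge]; ring

/-- The curve `v + X * w`. -/
def line (v w : A × A) : A[X] × A[X] := mapV C v + (X : A[X]) • mapV C w

namespace FormPair

theorem map_app (φ : A →+* A') (F : FormPair A) (v : A × A) :
    (F.map φ).app (mapV φ v) = mapV φ (F.app v) := by
  simp [app, map, mapV, map_homEval]

theorem map_iterate (φ : A →+* A') (F : FormPair A) (n : ℕ) (v : A × A) :
    (F.map φ).app^[n] (mapV φ v) = mapV φ (F.app^[n] v) := by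
  induction n with
  | zero => rfl
  | succ n ih => rw [Function.iterate_succ_apply', Function.iterate_succ_apply', ih, map_app]

theorem map_map {A'' : Type*} [CommRing A''] (φ : A →+* A') (ψ : A' →+* A'') (F : FormPair A) :
    (F.map φ).map ψ = F.map (ψ.comp φ) := rfl

theorem app_smul (F : FormPair A) (c : A) (v : A × A) :
    F.app (c • v) = c ^ F.deg • F.app v := by
  simp [app, homEval_smul, Prod.smul_def]

theorem iterate_smul (F : FormPair A) (n : ℕ) (c : A) (v : A × A) :
    F.app^[n] (c • v) = c ^ F.deg ^ n • F.app^[n] v := by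
  induction n with
  | zero => simp
  | succ n ih =>
    rw [Function.iterate_succ_apply', Function.iterate_succ_apply', ih, app_smul, ← pow_mul,
      pow_succ]

end FormPair

end Lift

section Fields

variable {F : Type*} [Field F]

/-- The point of the projective line represented by a vector. -/
def pt (v : F × F) : OnePoint F := projPoint v.1 v.2

theorem pt_smul {c : F} (hc : c ≠ 0) (v : F × F) : pt (c • v) = pt v := by
  by_cases h : v.2 = 0
  · simp [pt, projPoint, h]
  · simp [pt, projPoint, h, hc, mul_div_mul_left]

theorem exists_smul_of_wedge_eq_zero {v w : F × F} (hv : v ≠ 0) (hw : w ≠ 0)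
    (h : wedge v w = 0) : ∃ c : F, c ≠ 0 ∧ w = c • v := by
  rw [wedge, sub_eq_zero] at h
  rcases eq_or_ne v.1 0 with h1 | h1
  · have h2 : v.2 ≠ 0 := fun h2 => hv (Prod.ext h1 h2)
    have hw1 : w.1 = 0 := by
      rw [h1, zero_mul] at h
      exact (mul_eq_zero.1 h.symm).resolve_left h2
    have hw2 : w.2 ≠ 0 := fun h2 => hw (Prod.ext hw1 h2)
    refine ⟨w.2 / v.2, div_ne_zero hw2 h2, Prod.ext ?_ ?_⟩
    · simp [h1, hw1]
    · simp [h2]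
  · have hc : w.1 ≠ 0 := by
      intro hw1
      rw [hw1, mul_zero] at h
      exact hw (Prod.ext hw1 ((mul_eq_zero.1 h).resolve_left h1))
    refine ⟨w.1 / v.1, div_ne_zero hc h1, Prod.ext ?_ ?_⟩
    · simp [h1]
    · simp only [Prod.smul_snd, smul_eq_mul]
      field_simp
      linear_combination h

theorem pt_eq_iff {v w : F × F} (hv : v ≠ 0) (hw : w ≠ 0) : pt v = pt w ↔ wedge v w = 0 := by
  constructor
  · intro h
    simp only [pt, projPoint] at h
    rw [wedge]
    split_ifs at h with h1 h2 h2
    · rw [h1, h2]; ring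
    · exact absurd h (OnePoint.infty_ne_coe _)
    · exact absurd h (OnePoint.coe_ne_infty _)
    · have := OnePoint.coe_injective h
      rw [div_eq_div_iff h1 h2] at this
      linear_combination this
  · intro h
    obtain ⟨c, hc, rfl⟩ := exists_smul_of_wedge_eq_zero hv hw h
    rw [pt_smul hc]

theorem exists_pt_eq (z : OnePoint F) : (∃ x : F, z = pt (x, 1)) ∨ z = pt ((1 : F), 0) := by
  induction z using OnePoint.rec with
  | infty => right; simp [pt, projPoint]
  | coe x => left; exact ⟨x, by simp [pt, projPoint]⟩

theorem pt_infty : pt ((1 : F), (0 : F)) = ∞ := by simp [pt, projPoint]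

theorem pt_coe (x : F) : pt (x, (1 : F)) = (x : OnePoint F) := by simp [pt, projPoint]

namespace FormPair

/-- The numerator and the denominator of the rational function given by a pair of forms. -/
def polys (G : FormPair F) : F[X] × F[X] := (G.map C).app (X, 1)

theorem polys_fst (G : FormPair F) :
    G.polys.1 = ∑ i ∈ Finset.range (G.deg + 1), C (G.num i) * X ^ i := by
  simp [polys, app, map, homEval_one_right]

theorem polys_snd (G : FormPair F) :
    G.polys.2 = ∑ i ∈ Finset.range (G.deg + 1), C (G.den i) * X ^ i := by
  simp [polys, app, map, homEval_one_right]

theorem coeff_polys_fst (G : FormPair F) {i : ℕ} (hi : i ≤ G.deg) :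
    G.polys.1.coeff i = G.num i := by
  rw [polys_fst]
  simp [Polynomial.coeff_X_pow, Nat.lt_succ_of_le hi]

theorem coeff_polys_snd (G : FormPair F) {i : ℕ} (hi : i ≤ G.deg) :
    G.polys.2.coeff i = G.den i := by
  rw [polys_snd]
  simp [Polynomial.coeff_X_pow, Nat.lt_succ_of_le hi]

theorem natDegree_polys_fst (G : FormPair F) : G.polys.1.natDegree ≤ G.deg := by
  rw [polys_fst]
  refine natDegree_sum_le_of_forall_le _ _ fun i hi => ?_
  exact (natDegree_C_mul_X_pow_le _ _).trans (Nat.lt_succ_iff.1 (Finset.mem_range.1 hi))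

theorem natDegree_polys_snd (G : FormPair F) : G.polys.2.natDegree ≤ G.deg := by
  rw [polys_snd]
  refine natDegree_sum_le_of_forall_le _ _ fun i hi => ?_
  exact (natDegree_C_mul_X_pow_le _ _).trans (Nat.lt_succ_iff.1 (Finset.mem_range.1 hi))

theorem app_eval (G : FormPair F) (x : F) :
    G.app (x, 1) = (G.polys.1.eval x, G.polys.2.eval x) := by
  rw [polys_fst, polys_snd]
  simp [app, homEval_one_right, eval_finsetSum]

theorem app_one_zero (G : FormPair F) : G.app (1, 0) = (G.num G.deg, G.den G.deg) := by
  simp [app, homEval_zero_right]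

theorem app_inf (G : FormPair F) :
    G.app (1, 0) = (G.polys.1.coeff G.deg, G.polys.2.coeff G.deg) := by
  rw [app_one_zero, coeff_polys_fst _ le_rfl, coeff_polys_snd _ le_rfl]

end FormPair

theorem num_denom_of_isCoprime {P Q : F[X]} (h : IsCoprime P Q) (hQ : Q ≠ 0) :
    (algebraMap F[X] (RatFunc F) P / algebraMap F[X] (RatFunc F) Q).num =
        C Q.leadingCoeff⁻¹ * P ∧
      (algebraMap F[X] (RatFunc F) P / algebraMap F[X] (RatFunc F) Q).denom =
        C Q.leadingCoeff⁻¹ * Q := by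
  classical
  have hg1 : gcd P Q = 1 := by
    rw [← normalize_gcd]
    exact normalize_eq_one.2 ((gcd_isUnit_iff _ _).2 h)
  constructor
  · rw [RatFunc.num_div, hg1]
    simp
  · rw [RatFunc.denom_div _ hQ, hg1]
    simp

/-- `G` is a pair of forms without common zeros that represents the rational map `R`. -/
structure IsLift (G : FormPair F) (R : RatFunc F) : Prop where
  app_ne : ∀ v, v ≠ 0 → G.app v ≠ 0
  snd_ne : G.polys.2 ≠ 0
  eq_div : R = algebraMap F[X] (RatFunc F) G.polys.1 / algebraMap F[X] (RatFunc F) G.polys.2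

namespace IsLift

variable {G : FormPair F} {R : RatFunc F}

theorem max_natDegree (h : IsLift G R) :
    max G.polys.1.natDegree G.polys.2.natDegree = G.deg := by
  refine le_antisymm (max_le G.natDegree_polys_fst G.natDegree_polys_snd) ?_
  have h1 := h.app_ne (1, 0) (by simp)
  rw [G.app_inf] at h1
  by_contra hlt
  rw [not_le, max_lt_iff] at hlt
  exact h1 (Prod.ext (coeff_eq_zero_of_natDegree_lt hlt.1) (coeff_eq_zero_of_natDegree_lt hlt.2))

theorem isCoprime [IsAlgClosed F] (h : IsLift G R) : IsCoprime G.polys.1 G.polys.2 := by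
  rw [Polynomial.isCoprime_iff_aeval_ne_zero_of_isAlgClosed F F]
  intro x
  have h1 := h.app_ne (x, 1) (by simp)
  rw [G.app_eval] at h1
  by_contra! hcon
  exact h1 (Prod.ext (by simpa using hcon.1) (by simpa using hcon.2))

theorem num_denom [IsAlgClosed F] (h : IsLift G R) :
    ∃ c : F, c ≠ 0 ∧ R.num = C c * G.polys.1 ∧ R.denom = C c * G.polys.2 := by
  obtain ⟨h1, h2⟩ := num_denom_of_isCoprime h.isCoprime h.snd_ne
  rw [← h.eq_div] at h1 h2
  exact ⟨_, inv_ne_zero (leadingCoeff_ne_zero.2 h.snd_ne), h1, h2⟩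

theorem ratDegree_eq [IsAlgClosed F] (h : IsLift G R) : ratDegree R = G.deg := by
  obtain ⟨c, hc, h1, h2⟩ := h.num_denom
  rw [ratDegree, h1, h2, natDegree_C_mul hc, natDegree_C_mul hc, h.max_natDegree]

theorem toMap_pt [IsAlgClosed F] (h : IsLift G R) {v : F × F} (hv : v ≠ 0) :
    toMap R (pt v) = pt (G.app v) := by
  obtain ⟨c, hc, h1, h2⟩ := h.num_denom
  have hinf : toMap R ∞ = pt (G.app (1, 0)) := by
    change projPoint (R.num.coeff (ratDegree R)) (R.denom.coeff (ratDegree R)) = _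
    rw [h.ratDegree_eq, h1, h2, coeff_C_mul, coeff_C_mul, G.app_inf]
    exact pt_smul hc (G.polys.1.coeff G.deg, G.polys.2.coeff G.deg)
  have hfin : ∀ x : F, toMap R (x : OnePoint F) = pt (G.app (x, 1)) := by
    intro x
    change projPoint (R.num.eval x) (R.denom.eval x) = _
    rw [h1, h2, eval_C_mul, eval_C_mul, G.app_eval]
    exact pt_smul hc (G.polys.1.eval x, G.polys.2.eval x)
  rcases exists_pt_eq (pt v) with ⟨x, hx⟩ | hx
  · obtain ⟨c, hc, rfl⟩ := exists_smul_of_wedge_eq_zero (by simp) hv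
      ((pt_eq_iff (by simp) hv).1 hx.symm)
    rw [G.app_smul, pt_smul hc, pt_smul (pow_ne_zero _ hc), pt_coe, hfin]
  · obtain ⟨c, hc, rfl⟩ := exists_smul_of_wedge_eq_zero (by simp) hv
      ((pt_eq_iff (by simp) hv).1 hx.symm)
    rw [G.app_smul, pt_smul hc, pt_smul (pow_ne_zero _ hc), pt_infty, hinf]

theorem iterate_ne (h : IsLift G R) (n : ℕ) {v : F × F} (hv : v ≠ 0) : G.app^[n] v ≠ 0 := by
  induction n with
  | zero => exact hv
  | succ n ih => rw [Function.iterate_succ_apply']; exact h.app_ne _ ih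

theorem iterate_pt [IsAlgClosed F] (h : IsLift G R) (n : ℕ) {v : F × F} (hv : v ≠ 0) :
    (toMap R)^[n] (pt v) = pt (G.app^[n] v) := by
  induction n with
  | zero => rfl
  | succ n ih =>
    rw [Function.iterate_succ_apply', Function.iterate_succ_apply', ih,
      h.toMap_pt (h.iterate_ne n hv)]

end IsLift

end Fields

/-! ### Local degrees in terms of homogeneous lifts -/

section LocalDegree

theorem natDegree_homEval_le {A : Type*} [CommRing A] {D m : ℕ} {c : ℕ → A} {x y : A[X]}
    (hx : x.natDegree ≤ m) (hy : y.natDegree ≤ m) :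
    (homEval D (fun i => C (c i)) x y).natDegree ≤ D * m := by
  refine natDegree_sum_le_of_forall_le _ _ fun i hi => ?_
  have hiD := Nat.lt_succ_iff.1 (Finset.mem_range.1 hi)
  rw [mul_assoc]
  refine (natDegree_C_mul_le _ _).trans ((natDegree_mul_le_of_le (natDegree_pow_le_of_le i hx)
    (natDegree_pow_le_of_le (D - i) hy)).trans ?_)
  rw [← add_mul, Nat.add_sub_cancel' hiD]

theorem coeff_homEval {A : Type*} [CommRing A] {D m : ℕ} {c : ℕ → A} {x y : A[X]}
    (hx : x.natDegree ≤ m) (hy : y.natDegree ≤ m) :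
    (homEval D (fun i => C (c i)) x y).coeff (D * m) = homEval D c (x.coeff m) (y.coeff m) := by
  rw [homEval, homEval, finsetSum_coeff]
  refine Finset.sum_congr rfl fun i hi => ?_
  have hiD := Nat.lt_succ_iff.1 (Finset.mem_range.1 hi)
  have : D * m = i * m + (D - i) * m := by rw [← add_mul, Nat.add_sub_cancel' hiD]
  rw [mul_assoc, coeff_C_mul, this, coeff_mul_add_eq_of_natDegree_le
    (natDegree_pow_le_of_le i hx) (natDegree_pow_le_of_le _ hy), coeff_pow_of_natDegree_le hx,
    coeff_pow_of_natDegree_le hy, mul_assoc]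

variable {F : Type*} [Field F]

theorem homEval_coeff {L : Type*} [Field L] (φ : F →+* L) {D : ℕ} {f : F[X]}
    (hf : f.natDegree ≤ D) {x y : L} (hy : y ≠ 0) :
    homEval D (fun i => φ (f.coeff i)) x y = y ^ D * f.eval₂ φ (x / y) := by
  have hx : x = y * (x / y) := by field_simp
  have h1 : homEval D (fun i => φ (f.coeff i)) x y =
      homEval D (fun i => φ (f.coeff i)) (y * (x / y)) (y * 1) := by rw [← hx, mul_one]
  rw [h1, homEval_smul, homEval_one_right, eval₂_eq_sum_range' φ (Nat.lt_succ_of_le hf)]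

/-- The polynomial in `X` that measures the distance of the images of `v` and `v + X * w`. -/
def contactPoly (G : FormPair F) (v w : F × F) : F[X] :=
  wedge (mapV C (G.app v)) ((G.map C).app (line v w))

theorem line_natDegree (v w : F × F) :
    (line v w).1.natDegree ≤ 1 ∧ (line v w).2.natDegree ≤ 1 := by
  constructor
  all_goals
    simp only [line, mapV, Prod.fst_add, Prod.snd_add, Prod.smul_fst, Prod.smul_snd, smul_eq_mul]
    refine natDegree_add_le_of_degree_le (by simp) ?_
    rw [X_mul_C]
    exact (natDegree_C_mul_le _ _).trans natDegree_X_le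

theorem contactPoly_natDegree (G : FormPair F) (v w : F × F) :
    (contactPoly G v w).natDegree ≤ G.deg := by
  obtain ⟨h1, h2⟩ := line_natDegree v w
  refine (natDegree_sub_le _ _).trans (max_le ?_ ?_)
  · refine (natDegree_C_mul_le _ _).trans ?_
    exact (natDegree_homEval_le (D := G.deg) (c := G.den) h1 h2).trans (mul_one _).le
  · refine (natDegree_C_mul_le _ _).trans ?_
    exact (natDegree_homEval_le (D := G.deg) (c := G.num) h1 h2).trans (mul_one _).le

/-- The distance of the images of two points of a line through `v`, in homogeneous coordinates
along the line. -/
theorem wedge_app_eq_homEval (G : FormPair F) (v w : F × F) {α τ : F[X]} (hα : α ≠ 0) :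
    wedge (mapV C (G.app v)) ((G.map C).app (α • mapV C v + τ • mapV C w)) =
      homEval G.deg (fun i => C ((contactPoly G v w).coeff i)) τ α := by
  set φ := algebraMap F[X] (FractionRing F[X]) with hφ
  have hinj : Function.Injective φ := IsFractionRing.injective F[X] (FractionRing F[X])
  have hα' : φ α ≠ 0 := by
    rw [Ne, map_eq_zero_iff _ hinj]
    exact hα
  apply hinj
  have hr : φ (homEval G.deg (fun i => C ((contactPoly G v w).coeff i)) τ α) =
      φ α ^ G.deg * (contactPoly G v w).eval₂ (φ.comp C) (φ τ / φ α) := by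
    rw [map_homEval]
    exact homEval_coeff (φ.comp C) (contactPoly_natDegree G v w) hα'
  have hA : ∀ (ψ : F[X] →+* FractionRing F[X]) (γ : F[X] × F[X]),
      ψ (wedge (mapV C (G.app v)) ((G.map C).app γ)) =
        wedge (mapV (ψ.comp C) (G.app v)) ((G.map (ψ.comp C)).app (mapV ψ γ)) := by
    intro ψ γ
    rw [map_wedge, mapV_mapV, ← FormPair.map_app ψ (G.map C) γ, FormPair.map_map]
  set ψ : F[X] →+* FractionRing F[X] := eval₂RingHom (φ.comp C) (φ τ / φ α) with hψ
  have hψC : ψ.comp C = φ.comp C := by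
    ext x
    simp [hψ]
  have he : (contactPoly G v w).eval₂ (φ.comp C) (φ τ / φ α) = ψ (contactPoly G v w) := rfl
  have hX : ψ X = φ τ / φ α := by simp [hψ]
  rw [hr, he, contactPoly, hA, hA, hψC, line, mapV_add, mapV_add, mapV_smul, mapV_smul, mapV_smul,
    mapV_mapV, mapV_mapV, mapV_mapV, mapV_mapV, hψC, hX]
  have hs : φ α • mapV (φ.comp C) v + φ τ • mapV (φ.comp C) w =
      φ α • (mapV (φ.comp C) v + (φ τ / φ α) • mapV (φ.comp C) w) := by
    rw [smul_add, smul_smul, mul_div_cancel₀ _ hα']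
  rw [hs, FormPair.app_smul, wedge_smul_right]
  rfl

/-- The order of contact of a curve with a point is multiplied by the order of the contact
polynomial at this point. -/
theorem natTrailingDegree_wedge_app (G : FormPair F) {v w : F × F} {α τ : F[X]}
    (hα : α.coeff 0 ≠ 0) (hτ : τ.coeff 0 = 0) (hτ0 : τ ≠ 0) (hδ : contactPoly G v w ≠ 0) :
    wedge (mapV C (G.app v)) ((G.map C).app (α • mapV C v + τ • mapV C w)) ≠ 0 ∧
    (wedge (mapV C (G.app v)) ((G.map C).app (α • mapV C v + τ • mapV C w))).natTrailingDegree =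
      (contactPoly G v w).natTrailingDegree * τ.natTrailingDegree := by
  have hα0 : α ≠ 0 := by rintro rfl; simp at hα
  rw [wedge_app_eq_homEval G v w hα0]
  set δ := contactPoly G v w with hδd
  set m := δ.natTrailingDegree with hm
  have hmD : m ≤ G.deg := (natTrailingDegree_le_natDegree δ).trans (contactPoly_natDegree G v w)
  set W : F[X] := ∑ i ∈ Finset.range (G.deg + 1),
    C (δ.coeff i) * τ ^ (i - m) * α ^ (G.deg - i) with hW
  have hfac : homEval G.deg (fun i => C (δ.coeff i)) τ α = τ ^ m * W := by
    rw [homEval, hW, Finset.mul_sum]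
    refine Finset.sum_congr rfl fun i _ => ?_
    rcases lt_or_ge i m with h | h
    · rw [coeff_eq_zero_of_lt_natTrailingDegree h]; simp
    · have : τ ^ i = τ ^ m * τ ^ (i - m) := by rw [← pow_add]; congr 1; omega
      rw [this]; ring
  have hW0 : W.coeff 0 ≠ 0 := by
    rw [coeff_zero_eq_eval_zero, hW, eval_finsetSum, Finset.sum_eq_single m]
    · rw [Nat.sub_self, pow_zero, mul_one, eval_mul, eval_C, eval_pow, ← coeff_zero_eq_eval_zero]
      refine mul_ne_zero ?_ (pow_ne_zero _ hα)
      exact (mem_support_iff.1 (natTrailingDegree_mem_support_of_nonzero hδ))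
    · intro i _ hi
      rcases lt_or_ge i m with h | h
      · rw [coeff_eq_zero_of_lt_natTrailingDegree h]; simp
      · rw [eval_mul, eval_mul, eval_pow, ← coeff_zero_eq_eval_zero τ, hτ, zero_pow (by omega)]
        simp
    · intro h
      exact absurd (Finset.mem_range.2 (by omega)) h
  have hWne : W ≠ 0 := by intro h; rw [h] at hW0; simp at hW0
  rw [hfac]
  refine ⟨mul_ne_zero (pow_ne_zero _ hτ0) hWne, ?_⟩
  rw [natTrailingDegree_mul (pow_ne_zero _ hτ0) hWne, natTrailingDegree_eq_zero.2 (Or.inr hW0),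
    add_zero]
  have hpow : ∀ n : ℕ, (τ ^ n).natTrailingDegree = n * τ.natTrailingDegree := by
    intro n
    induction n with
    | zero => simp
    | succ n ih => rw [pow_succ, natTrailingDegree_mul (pow_ne_zero _ hτ0) hτ0, ih]; ring
  exact hpow m

theorem exists_line_decomposition {v w : F × F} (h : wedge v w ≠ 0) (γ : F[X] × F[X]) :
    γ = (C (wedge v w)⁻¹ * wedge γ (mapV C w)) • mapV C v +
      (C (wedge v w)⁻¹ * wedge (mapV C v) γ) • mapV C w := by
  have hc : C (wedge v w)⁻¹ * wedge (mapV C v) (mapV C w) = 1 := by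
    rw [← map_wedge, ← C_mul, inv_mul_cancel₀ h, C_1]
  simp only [wedge, mapV] at hc ⊢
  refine Prod.ext ?_ ?_
  · simp only [Prod.fst_add, Prod.smul_fst, smul_eq_mul]
    linear_combination (-γ.1) * hc
  · simp only [Prod.snd_add, Prod.smul_snd, smul_eq_mul]
    linear_combination (-γ.2) * hc

theorem natTrailingDegree_C_mul' {a : F} (ha : a ≠ 0) (f : F[X]) :
    (C a * f).natTrailingDegree = f.natTrailingDegree := by
  rcases eq_or_ne f 0 with rfl | hf
  · simp
  · rw [natTrailingDegree_mul (C_ne_zero.2 ha) hf, natTrailingDegree_C, zero_add]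

/-- A version of `natTrailingDegree_wedge_app` for an arbitrary curve. -/
theorem natTrailingDegree_wedge_curve (G : FormPair F) {v w : F × F} (hvw : wedge v w ≠ 0)
    (hδ : contactPoly G v w ≠ 0) {γ : F[X] × F[X]} {c : F} (hc : c ≠ 0)
    (hγ : mapV (evalRingHom 0) γ = c • v) (hne : wedge (mapV C v) γ ≠ 0) :
    wedge (mapV C (G.app v)) ((G.map C).app γ) ≠ 0 ∧
    (wedge (mapV C (G.app v)) ((G.map C).app γ)).natTrailingDegree =
      (contactPoly G v w).natTrailingDegree * (wedge (mapV C v) γ).natTrailingDegree := by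
  have hCC : (evalRingHom (0 : F)).comp C = RingHom.id F := by ext; simp
  have hmm : ∀ u : F × F, mapV (evalRingHom 0) (mapV C u) = u := fun u => by
    rw [mapV_mapV, hCC]; rfl
  have h1 := natTrailingDegree_wedge_app G (v := v) (w := w)
    (α := C (wedge v w)⁻¹ * wedge γ (mapV C w)) (τ := C (wedge v w)⁻¹ * wedge (mapV C v) γ)
    (by
      rw [coeff_C_mul, coeff_zero_eq_eval_zero, ← coe_evalRingHom, map_wedge, hγ, hmm,
        wedge_smul_left]
      exact mul_ne_zero (inv_ne_zero hvw) (mul_ne_zero hc hvw))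
    (by
      rw [coeff_C_mul, coeff_zero_eq_eval_zero, ← coe_evalRingHom, map_wedge, hγ, hmm,
        wedge_smul_right, wedge_self, mul_zero, mul_zero])
    (mul_ne_zero (C_ne_zero.2 (inv_ne_zero hvw)) hne) hδ
  rw [← exists_line_decomposition hvw γ, natTrailingDegree_C_mul' (inv_ne_zero hvw)] at h1
  exact h1

theorem mapV_eval_line (v w : F × F) : mapV (evalRingHom 0) (line v w) = v := by
  simp [mapV, line]

theorem wedge_line (v w : F × F) : wedge (mapV C v) (line v w) = C (wedge v w) * X := by
  rw [line, wedge_add_right, wedge_self, zero_add, wedge_smul_right, ← map_wedge, mul_comm]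

theorem wedge_C_line (u v w : F × F) :
    wedge (mapV C u) (line v w) = C (wedge u v) + C (wedge u w) * X := by
  rw [line, wedge_add_right, wedge_smul_right, ← map_wedge, ← map_wedge, mul_comm X]

/-- The order of the contact polynomial depends neither on the representative nor on the
direction. -/
theorem contactPoly_natTrailingDegree_congr (G : FormPair F) {v w w' : F × F} {c : F}
    (hvw : wedge v w ≠ 0) (hvw' : wedge v w' ≠ 0) (hc : c ≠ 0) (hδ : contactPoly G v w ≠ 0) :
    contactPoly G (c • v) w' ≠ 0 ∧
    (contactPoly G (c • v) w').natTrailingDegree = (contactPoly G v w).natTrailingDegree := by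
  have hwl : wedge (mapV C v) (line (c • v) w') = C (wedge v w') * X := by
    rw [wedge_C_line, wedge_smul_right, wedge_self, mul_zero, C_0, zero_add]
  obtain ⟨h1, h2⟩ := natTrailingDegree_wedge_curve G hvw hδ (γ := line (c • v) w') hc
    (mapV_eval_line _ _) (by rw [hwl]; exact mul_ne_zero (C_ne_zero.2 hvw') X_ne_zero)
  have hcp : contactPoly G (c • v) w' =
      C (c ^ G.deg) * wedge (mapV C (G.app v)) ((G.map C).app (line (c • v) w')) := by
    rw [contactPoly, FormPair.app_smul, mapV_smul, wedge_smul_left]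
  rw [hcp]
  refine ⟨mul_ne_zero (C_ne_zero.2 (pow_ne_zero _ hc)) h1, ?_⟩
  rw [natTrailingDegree_C_mul' (pow_ne_zero _ hc), h2, hwl, natTrailingDegree_C_mul' hvw',
    natTrailingDegree_X, mul_one]

theorem IsCoprime.natDegree_eq_zero_of_proportional {p q : F[X]} (h : IsCoprime p q) {a b : F}
    (hab : a ≠ 0 ∨ b ≠ 0) (he : C a * q = C b * p) : p.natDegree = 0 ∧ q.natDegree = 0 := by
  rcases hab with ha | hb
  · have hd : p ∣ C a * q := ⟨C b, by rw [he, mul_comm]⟩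
    have hdq : p ∣ q := (isUnit_C.2 ha.isUnit).dvd_mul_left.1 hd
    have hu : IsUnit p := h.isUnit_of_dvd' dvd_rfl hdq
    have hp := natDegree_eq_zero_of_isUnit hu
    refine ⟨hp, ?_⟩
    rw [← natDegree_C_mul ha, he]
    have := natDegree_C_mul_le b p
    omega
  · have hd : q ∣ C b * p := ⟨C a, by rw [← he, mul_comm]⟩
    have hdq : q ∣ p := (isUnit_C.2 hb.isUnit).dvd_mul_left.1 hd
    have hu : IsUnit q := h.isUnit_of_dvd' hdq dvd_rfl
    have hq := natDegree_eq_zero_of_isUnit hu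
    refine ⟨?_, hq⟩
    rw [← natDegree_C_mul hb, ← he]
    have := natDegree_C_mul_le a q
    omega

theorem rootMultiplicity_C_mul' {a : F} (ha : a ≠ 0) (f : F[X]) (x : F) :
    (C a * f).rootMultiplicity x = f.rootMultiplicity x := by
  rcases eq_or_ne f 0 with rfl | hf
  · simp
  · rw [rootMultiplicity_mul (mul_ne_zero (C_ne_zero.2 ha) hf), rootMultiplicity_C, zero_add]

variable [IsAlgClosed F] {G : FormPair F} {R : RatFunc F}

/-- The equation `R x = [a : b]`. -/
theorem IsLift.fiberPoly_eq (h : IsLift G R) {v : F × F} (hv : v ≠ 0) :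
    ∃ c : F, c ≠ 0 ∧ fiberPoly R (pt v) = C c * (C v.1 * G.polys.2 - C v.2 * G.polys.1) := by
  obtain ⟨c, hc, h1, h2⟩ := h.num_denom
  by_cases h0 : v.2 = 0
  · have hv1 : v.1 ≠ 0 := fun h1 => hv (Prod.ext h1 h0)
    refine ⟨c * v.1⁻¹, mul_ne_zero hc (inv_ne_zero hv1), ?_⟩
    have : pt v = ∞ := by simp [pt, projPoint, h0]
    rw [this]
    change R.denom = _
    rw [h2, h0, C_0, zero_mul, sub_zero, C_mul]
    have : C v.1⁻¹ * C v.1 = 1 := by rw [← C_mul, inv_mul_cancel₀ hv1, C_1]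
    linear_combination (-(C c * G.polys.2)) * this
  · refine ⟨-(c * v.2⁻¹), neg_ne_zero.2 (mul_ne_zero hc (inv_ne_zero h0)), ?_⟩
    have : pt v = ((v.1 / v.2 : F) : OnePoint F) := by simp [pt, projPoint, h0]
    rw [this]
    change R.num - C (v.1 / v.2) * R.denom = _
    have e1 : C v.2⁻¹ * C v.2 = 1 := by rw [← C_mul, inv_mul_cancel₀ h0, C_1]
    rw [h1, h2, div_eq_mul_inv, C_mul, C_neg, C_mul]
    linear_combination (-(C c * G.polys.1)) * e1

theorem IsLift.fiberPoly_ne (h : IsLift G R) (hD : 0 < G.deg) {v : F × F} (hv : v ≠ 0) :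
    C v.1 * G.polys.2 - C v.2 * G.polys.1 ≠ 0 := by
  intro h0
  have := IsCoprime.natDegree_eq_zero_of_proportional h.isCoprime (a := v.1) (b := v.2)
    (by by_contra! hc; exact hv (Prod.ext hc.1 hc.2)) (sub_eq_zero.1 h0)
  have hm := h.max_natDegree
  rw [this.1, this.2] at hm
  simp at hm
  omega

omit [IsAlgClosed F] in
theorem contactPoly_finite (G : FormPair F) (x : F) :
    contactPoly G (x, 1) (1, 0) =
      (C (G.app (x, 1)).1 * G.polys.2 - C (G.app (x, 1)).2 * G.polys.1).comp (X + C x) := by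
  have hl : line (x, 1) ((1 : F), 0) = mapV (compRingHom (X + C x)) ((X : F[X]), 1) := by
    simp [line, mapV, add_comm]
  have hC : (compRingHom (X + C x)).comp C = (C : F →+* F[X]) := by ext; simp
  have hm : (G.map C).app (line (x, 1) ((1 : F), 0)) = mapV (compRingHom (X + C x)) G.polys := by
    rw [hl, FormPair.polys, ← FormPair.map_app, FormPair.map_map, hC]
  rw [contactPoly, hm]
  simp [wedge, mapV]

omit [IsAlgClosed F] in
theorem contactPoly_infinite (G : FormPair F) :
    contactPoly G (1, 0) (0, 1) = reflect G.deg
      (C (G.app (1, 0)).1 * G.polys.2 - C (G.app (1, 0)).2 * G.polys.1) := by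
  have hl : line (1, 0) ((0 : F), 1) = ((1 : F[X]), X) := by simp [line, mapV]
  have hr : ∀ a : ℕ → F, homEval G.deg (fun i => C (a i)) (1 : F[X]) X =
      reflect G.deg (∑ i ∈ Finset.range (G.deg + 1), C (a i) * X ^ i) := by
    intro a
    have hs : ∀ s : Finset ℕ, reflect G.deg (∑ i ∈ s, C (a i) * X ^ i) =
        ∑ i ∈ s, C (a i) * X ^ revAt G.deg i := by
      intro s
      induction s using Finset.cons_induction with
      | empty => simp
      | cons i s hi ih => rw [Finset.sum_cons, Finset.sum_cons, reflect_add, ih,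
          reflect_C_mul_X_pow]
    rw [hs, homEval]
    refine Finset.sum_congr rfl fun i hi => ?_
    rw [one_pow, mul_one, revAt_le (Nat.lt_succ_iff.1 (Finset.mem_range.1 hi))]
  rw [contactPoly, hl, reflect_sub, reflect_C_mul, reflect_C_mul, FormPair.polys_fst,
    FormPair.polys_snd, ← hr, ← hr]
  simp [wedge, mapV, FormPair.app, FormPair.map]

omit [IsAlgClosed F] in
theorem natTrailingDegree_reflect {D : ℕ} {f : F[X]} (hf : f ≠ 0) (hD : f.natDegree ≤ D) :
    reflect D f ≠ 0 ∧ (reflect D f).natTrailingDegree = D - f.natDegree := by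
  have hc : (reflect D f).coeff (D - f.natDegree) ≠ 0 := by
    rw [coeff_reflect, revAt_le (Nat.sub_le _ _), Nat.sub_sub_self hD]
    exact leadingCoeff_ne_zero.2 hf
  have hne : reflect D f ≠ 0 := by intro h; rw [h] at hc; simp at hc
  refine ⟨hne, le_antisymm (natTrailingDegree_le_of_ne_zero hc) ?_⟩
  refine le_natTrailingDegree hne fun i hi => ?_
  rw [coeff_reflect, revAt_le (by omega)]
  exact coeff_eq_zero_of_natDegree_lt (by omega)

/-- The local degree is the order of the contact polynomial. -/
theorem IsLift.localDegree_eq (h : IsLift G R) (hD : 0 < G.deg) {v w : F × F}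
    (hvw : wedge v w ≠ 0) :
    contactPoly G v w ≠ 0 ∧ localDegree R (pt v) = (contactPoly G v w).natTrailingDegree := by
  have hv : v ≠ 0 := by rintro rfl; simp [wedge] at hvw
  have key : ∀ v₀ w₀ : F × F, wedge v₀ w₀ ≠ 0 → pt v = pt v₀ → contactPoly G v₀ w₀ ≠ 0 →
      localDegree R (pt v₀) = (contactPoly G v₀ w₀).natTrailingDegree →
      contactPoly G v w ≠ 0 ∧ localDegree R (pt v) = (contactPoly G v w).natTrailingDegree := by
    intro v₀ w₀ h0 hp hne hl
    have hv₀ : v₀ ≠ 0 := by rintro rfl; simp [wedge] at h0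
    obtain ⟨c, hc, rfl⟩ := exists_smul_of_wedge_eq_zero hv₀ hv ((pt_eq_iff hv₀ hv).1 hp.symm)
    have h0' : wedge v₀ w ≠ 0 := by
      rw [wedge_smul_left] at hvw
      exact right_ne_zero_of_mul hvw
    obtain ⟨h1, h2⟩ := contactPoly_natTrailingDegree_congr G h0 h0' hc hne
    exact ⟨h1, by rw [pt_smul hc, hl, h2]⟩
  rcases exists_pt_eq (pt v) with ⟨x, hx⟩ | hx
  · have hGne := h.app_ne (x, 1) (by simp)
    refine key (x, 1) (1, 0) (by simp [wedge]) hx ?_ ?_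
    · rw [contactPoly_finite]
      intro h0
      refine h.fiberPoly_ne hD hGne ?_
      have h1 := congrArg (fun f => f.comp (X - C x)) h0
      simpa [comp_assoc] using h1
    · rw [contactPoly_finite, ← rootMultiplicity_eq_natTrailingDegree]
      obtain ⟨c, hc, hfib⟩ := h.fiberPoly_eq hGne
      rw [pt_coe]
      change (fiberPoly R (toMap R (x : OnePoint F))).rootMultiplicity x = _
      rw [← pt_coe, h.toMap_pt (by simp), hfib, rootMultiplicity_C_mul' hc]
  · have hGne := h.app_ne (1, 0) (by simp)
    have hdeg : (C (G.app (1, 0)).1 * G.polys.2 - C (G.app (1, 0)).2 * G.polys.1).natDegree ≤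
        G.deg :=
      (natDegree_sub_le _ _).trans (max_le
        ((natDegree_C_mul_le _ _).trans G.natDegree_polys_snd)
        ((natDegree_C_mul_le _ _).trans G.natDegree_polys_fst))
    obtain ⟨h1, h2⟩ := natTrailingDegree_reflect (h.fiberPoly_ne hD hGne) hdeg
    refine key (1, 0) (0, 1) (by simp [wedge]) hx ?_ ?_
    · rwa [contactPoly_infinite]
    · rw [contactPoly_infinite, h2]
      obtain ⟨c, hc, hfib⟩ := h.fiberPoly_eq hGne
      rw [pt_infty]
      change ratDegree R - (fiberPoly R (toMap R ∞)).natDegree = _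
      rw [← pt_infty, h.toMap_pt (by simp), hfib, natDegree_C_mul hc, h.ratDegree_eq]

end LocalDegree

/-! ### Iterates -/

section Iterates

variable {F : Type*} [Field F]

namespace FormPair

/-- The pair of forms of degree `G.deg ^ n` that induces the `n`-th iterate of `G`. -/
def iter (G : FormPair F) (n : ℕ) : FormPair F where
  deg := G.deg ^ n
  num i := ((G.map C).app^[n] (X, 1)).1.coeff i
  den i := ((G.map C).app^[n] (X, 1)).2.coeff i

theorem iterate_polys_natDegree (G : FormPair F) (n : ℕ) :
    ((G.map C).app^[n] (X, 1)).1.natDegree ≤ G.deg ^ n ∧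
    ((G.map C).app^[n] (X, 1)).2.natDegree ≤ G.deg ^ n ∧
    (((G.map C).app^[n] (X, 1)).1.coeff (G.deg ^ n),
      ((G.map C).app^[n] (X, 1)).2.coeff (G.deg ^ n)) = G.app^[n] (1, 0) := by
  induction n with
  | zero => simp [coeff_one]
  | succ n ih =>
    obtain ⟨h1, h2, h3⟩ := ih
    rw [Function.iterate_succ_apply', Function.iterate_succ_apply', ← h3, pow_succ']
    refine ⟨natDegree_homEval_le h1 h2, natDegree_homEval_le h1 h2, Prod.ext ?_ ?_⟩
    · exact coeff_homEval (c := G.num) h1 h2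
    · exact coeff_homEval (c := G.den) h1 h2

theorem iter_polys (G : FormPair F) (n : ℕ) :
    (G.iter n).polys = (G.map C).app^[n] (X, 1) := by
  obtain ⟨h1, h2, -⟩ := G.iterate_polys_natDegree n
  refine Prod.ext ?_ ?_
  · rw [polys_fst]
    exact (as_sum_range_C_mul_X_pow' _ (Nat.lt_succ_of_le h1)).symm
  · rw [polys_snd]
    exact (as_sum_range_C_mul_X_pow' _ (Nat.lt_succ_of_le h2)).symm

theorem iter_app_one_zero (G : FormPair F) (n : ℕ) :
    (G.iter n).app (1, 0) = G.app^[n] (1, 0) := by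
  rw [app_one_zero, ← (G.iterate_polys_natDegree n).2.2]
  rfl

theorem iter_map_app_field {L : Type*} [Field L] (φ : F →+* L) (G : FormPair F) (n : ℕ)
    (v : L × L) : ((G.iter n).map φ).app v = (G.map φ).app^[n] v := by
  obtain ⟨x, y⟩ := v
  by_cases hy : y = 0
  · have hv : (x, y) = x • mapV φ ((1 : F), 0) := by simp [mapV, hy]
    rw [hv, app_smul, iterate_smul, map_app, map_iterate, iter_app_one_zero]
    rfl
  · have hv : (x, y) = y • mapV (eval₂RingHom φ (x / y)) ((X : F[X]), 1) := by
      simp [mapV, mul_div_cancel₀ _ hy]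
    have hC : (eval₂RingHom φ (x / y)).comp C = φ := by ext; simp
    have hGC : ∀ G : FormPair F, G.map φ = (G.map C).map (eval₂RingHom φ (x / y)) := by
      intro G
      rw [map_map, hC]
    rw [hv, app_smul, iterate_smul, hGC, hGC, map_app, map_iterate, ← polys, iter_polys]
    rfl

theorem iter_map_app {A : Type*} [CommRing A] [IsDomain A] (φ : F →+* A) (G : FormPair F) (n : ℕ)
    (v : A × A) : ((G.iter n).map φ).app v = (G.map φ).app^[n] v := by
  set ι := algebraMap A (FractionRing A) with hι
  have hinj : Function.Injective ι := IsFractionRing.injective A (FractionRing A)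
  have hV : Function.Injective (mapV ι) := by
    intro a b h
    exact Prod.ext (hinj (congrArg Prod.fst h)) (hinj (congrArg Prod.snd h))
  apply hV
  rw [← map_app, map_map, iter_map_app_field, ← map_iterate, map_map]

theorem map_id (G : FormPair F) : G.map (RingHom.id F) = G := rfl

theorem iter_app (G : FormPair F) (n : ℕ) (v : F × F) : (G.iter n).app v = G.app^[n] v := by
  simpa only [map_id] using iter_map_app (RingHom.id F) G n v

/-- The polynomial that measures the distance of the images of `v` and `v + X * w` under the
`n`-th iterate. -/
theorem contactPoly_iter (G : FormPair F) (n : ℕ) (v w : F × F) :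
    contactPoly (G.iter n) v w =
      wedge (mapV C (G.app^[n] v)) ((G.map C).app^[n] (line v w)) := by
  rw [contactPoly, iter_app, iter_map_app]

end FormPair

variable [IsAlgClosed F] {G : FormPair F} {R : RatFunc F}

omit [IsAlgClosed F] in
theorem eval₂_mul_pow {L : Type*} [Field L] (φ : F →+* L) {D : ℕ} {f : F[X]}
    (hf : f.natDegree ≤ D) {x y : L} (hy : y ≠ 0) :
    f.eval₂ φ (x / y) * y ^ D = homEval D (fun i => φ (f.coeff i)) x y := by
  rw [homEval_coeff φ hf hy, mul_comm]

theorem homEval_congr {A : Type*} [CommRing A] {D : ℕ} {a b : ℕ → A} (h : ∀ i ≤ D, a i = b i)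
    (x y : A) : homEval D a x y = homEval D b x y :=
  Finset.sum_congr rfl fun i hi => by
    rw [h i (Nat.lt_succ_iff.1 (Finset.mem_range.1 hi))]

theorem IsLift.iter (h : IsLift G R) (hD : 0 < G.deg) (n : ℕ) :
    IsLift (G.iter n) (ratIterate R n) := by
  have hne : ∀ n v, v ≠ 0 → (G.iter n).app v ≠ 0 := fun n v hv => by
    rw [FormPair.iter_app]
    exact h.iterate_ne n hv
  induction n with
  | zero =>
    refine ⟨hne 0, ?_, ?_⟩ <;> rw [FormPair.iter_polys]
    · exact one_ne_zero
    · simp [ratIterate]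
  | succ n ih =>
    have hsnd : (G.iter (n + 1)).polys.2 ≠ 0 := by
      intro h0
      have hcop : IsCoprime (G.iter (n + 1)).polys.1 (G.iter (n + 1)).polys.2 := by
        rw [Polynomial.isCoprime_iff_aeval_ne_zero_of_isAlgClosed F F]
        intro x
        have h1 := hne (n + 1) (x, 1) (by simp)
        rw [FormPair.app_eval] at h1
        by_contra! hcon
        exact h1 (Prod.ext (by simpa using hcon.1) (by simpa using hcon.2))
      rw [h0, isCoprime_zero_right] at hcop
      have h1 := natDegree_eq_zero_of_isUnit hcop
      have h2 := hne (n + 1) (1, 0) (by simp)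
      rw [FormPair.app_inf] at h2
      have hpos : 0 < (G.iter (n + 1)).deg := pow_pos hD _
      exact h2 (Prod.ext (coeff_eq_zero_of_natDegree_lt (by rwa [h1])) (by rw [h0]; simp))
    refine ⟨hne (n + 1), hsnd, ?_⟩
    obtain ⟨c, hc, h1, h2⟩ := h.num_denom
    set a := algebraMap F[X] (RatFunc F) with ha
    have hinj : Function.Injective a := IsFractionRing.injective F[X] (RatFunc F)
    have hq : a (G.iter n).polys.2 ≠ 0 := by
      rw [Ne, map_eq_zero_iff _ hinj]; exact ih.snd_ne
    have hstep : (G.iter (n + 1)).polys = (G.map C).app (G.iter n).polys := by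
      rw [FormPair.iter_polys, FormPair.iter_polys, Function.iterate_succ_apply']
    have hCa : ∀ x, (RatFunc.C : F →+* RatFunc F) x = a (C x) := fun x => by simp [ha]
    have hE1 : R.num.eval₂ RatFunc.C (ratIterate R n) * a (G.iter n).polys.2 ^ G.deg =
        a (C c) * a (G.iter (n + 1)).polys.1 := by
      have : (G.iter (n + 1)).polys.1 =
          homEval G.deg (fun i => C (G.num i)) (G.iter n).polys.1 (G.iter n).polys.2 := by
        rw [hstep]; rfl
      rw [h1, ih.eq_div, eval₂_mul, eval₂_C, mul_assoc, eval₂_mul_pow _ G.natDegree_polys_fst hq,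
        this, map_homEval, hCa]
      congr 1
      exact homEval_congr (fun i hi => by rw [G.coeff_polys_fst hi, hCa]) _ _
    have hE2 : R.denom.eval₂ RatFunc.C (ratIterate R n) * a (G.iter n).polys.2 ^ G.deg =
        a (C c) * a (G.iter (n + 1)).polys.2 := by
      have : (G.iter (n + 1)).polys.2 =
          homEval G.deg (fun i => C (G.den i)) (G.iter n).polys.1 (G.iter n).polys.2 := by
        rw [hstep]; rfl
      rw [h2, ih.eq_div, eval₂_mul, eval₂_C, mul_assoc, eval₂_mul_pow _ G.natDegree_polys_snd hq,
        this, map_homEval, hCa]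
      congr 1
      exact homEval_congr (fun i hi => by rw [G.coeff_polys_snd hi, hCa]) _ _
    have hcne : a (C c) ≠ 0 := by
      rw [Ne, map_eq_zero_iff _ hinj]; exact C_ne_zero.2 hc
    change R.num.eval₂ RatFunc.C (ratIterate R n) / R.denom.eval₂ RatFunc.C (ratIterate R n) = _
    rw [← mul_div_mul_right _ _ (pow_ne_zero G.deg hq), hE1, hE2, mul_div_mul_left _ _ hcne]

/-- The local degree of an iterate is the order of contact of the images of a point and of a line
through it. -/
theorem IsLift.localDegree_iterate (h : IsLift G R) (hD : 0 < G.deg) (n : ℕ) {v w : F × F}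
    (hvw : wedge v w ≠ 0) :
    wedge (mapV C (G.app^[n] v)) ((G.map C).app^[n] (line v w)) ≠ 0 ∧
    localDegree (ratIterate R n) (pt v) =
      (wedge (mapV C (G.app^[n] v)) ((G.map C).app^[n] (line v w))).natTrailingDegree := by
  rw [← FormPair.contactPoly_iter]
  exact (h.iter hD n).localDegree_eq (pow_pos hD n) hvw

omit [IsAlgClosed F] in
theorem exists_wedge_ne {v : F × F} (hv : v ≠ 0) : ∃ w : F × F, wedge v w ≠ 0 := by
  by_contra! h
  have h1 := h (1, 0)
  have h2 := h (0, 1)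
  simp only [wedge, mul_zero, mul_one, zero_sub, sub_zero, neg_eq_zero] at h1 h2
  exact hv (Prod.ext h2 h1)

omit [IsAlgClosed F] in
theorem mapV_eval_iterate_line (G : FormPair F) (n : ℕ) (v w : F × F) :
    mapV (evalRingHom 0) ((G.map C).app^[n] (line v w)) = G.app^[n] v := by
  have hCC : (evalRingHom (0 : F)).comp C = RingHom.id F := by ext; simp
  rw [← FormPair.map_iterate, FormPair.map_map, hCC, mapV_eval_line]
  rfl

theorem IsLift.localDegree_succ (h : IsLift G R) (hD : 0 < G.deg) (n : ℕ) {v : F × F}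
    (hv : v ≠ 0) :
    localDegree (ratIterate R (n + 1)) (pt v) =
      localDegree R (pt (G.app^[n] v)) * localDegree (ratIterate R n) (pt v) := by
  obtain ⟨w, hvw⟩ := exists_wedge_ne hv
  obtain ⟨u, hu⟩ := exists_wedge_ne (h.iterate_ne n hv)
  obtain ⟨h1, h2⟩ := h.localDegree_iterate hD n hvw
  obtain ⟨-, h3⟩ := h.localDegree_iterate hD (n + 1) hvw
  obtain ⟨h4, h5⟩ := h.localDegree_eq hD hu
  have := natTrailingDegree_wedge_curve G hu h4 (γ := (G.map C).app^[n] (line v w)) one_ne_zero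
    (by rw [one_smul]; exact mapV_eval_iterate_line G n v w) h1
  rw [h3, h5, h2, Function.iterate_succ_apply', Function.iterate_succ_apply', this.2]

/-- The local degree of an iterate is the product of the local degrees along the orbit. -/
theorem IsLift.localDegree_iterate_eq_prod (h : IsLift G R) (hD : 0 < G.deg) (n : ℕ) {v : F × F}
    (hv : v ≠ 0) :
    localDegree (ratIterate R n) (pt v) =
      ∏ i ∈ Finset.range n, localDegree R ((toMap R)^[i] (pt v)) := by
  induction n with
  | zero =>
    obtain ⟨w, hvw⟩ := exists_wedge_ne hv
    rw [(h.localDegree_iterate hD 0 hvw).2, Function.iterate_zero, Function.iterate_zero, id, id,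
      wedge_line, natTrailingDegree_C_mul' hvw, natTrailingDegree_X, Finset.prod_range_zero]
  | succ n ih =>
    rw [h.localDegree_succ hD n hv, ih, Finset.prod_range_succ, h.iterate_pt n hv, mul_comm]

theorem IsLift.localDegree_pos (h : IsLift G R) (hD : 0 < G.deg) {v : F × F} (hv : v ≠ 0) :
    0 < localDegree R (pt v) := by
  obtain ⟨w, hvw⟩ := exists_wedge_ne hv
  obtain ⟨h1, h2⟩ := h.localDegree_eq hD hvw
  rw [h2, Nat.pos_iff_ne_zero, natTrailingDegree_ne_zero]
  refine ⟨h1, ?_⟩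
  rw [coeff_zero_eq_eval_zero, ← coe_evalRingHom, contactPoly, map_wedge]
  have := mapV_eval_iterate_line G 1 v w
  rw [Function.iterate_one, Function.iterate_one] at this
  rw [this, ← mapV_eval_line (G.app v) 0]
  simp [mapV, line, wedge, mul_comm]

theorem IsLift.finite_critical [CharZero F] (h : IsLift G R) (hD : 0 < G.deg) :
    {z : OnePoint F | IsCriticalPt R z}.Finite := by
  classical
  have hW : wronskian G.polys.1 G.polys.2 ≠ 0 := by
    intro h0
    obtain ⟨h1, h2⟩ := h.isCoprime.wronskian_eq_zero_iff.1 h0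
    have hm := h.max_natDegree
    rw [derivative_eq_zero.1 h1, derivative_eq_zero.1 h2,
      max_self] at hm
    omega
  refine ((((wronskian G.polys.1 G.polys.2).roots.toFinset.finite_toSet).image
    (fun x : F => (x : OnePoint F))).insert ∞).subset fun z hz => ?_
  induction z using OnePoint.rec with
  | infty => exact Set.mem_insert _ _
  | coe x =>
    refine Set.mem_insert_of_mem _ ⟨x, ?_, rfl⟩
    rw [Finset.mem_coe, Multiset.mem_toFinset, mem_roots hW]
    obtain ⟨c, hc, hfib⟩ := h.fiberPoly_eq (h.app_ne (x, 1) (by simp))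
    have hz' : 1 < (fiberPoly R (toMap R (x : OnePoint F))).rootMultiplicity x := hz
    rw [← pt_coe, h.toMap_pt (by simp), hfib, rootMultiplicity_C_mul' hc, FormPair.app_eval] at hz'
    have hne := h.fiberPoly_ne hD (h.app_ne (x, 1) (by simp))
    rw [FormPair.app_eval] at hne
    have hd := (one_lt_rootMultiplicity_iff_isRoot hne).1 hz'
    have hd2 := hd.2
    simp only [IsRoot.def, derivative_sub, derivative_mul, derivative_C, zero_mul, zero_add,
      eval_sub, eval_mul, eval_C] at hd2
    simp only [IsRoot.def, wronskian, eval_sub, eval_mul]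
    linear_combination hd2

end Iterates

/-! ### The multiplier of a fixed point -/

section Multiplier

variable {F : Type*} [Field F]

theorem contactPoly_coeff_zero (G : FormPair F) (v w : F × F) : (contactPoly G v w).coeff 0 = 0 := by
  have h := mapV_eval_iterate_line G 1 v w
  rw [Function.iterate_one, Function.iterate_one] at h
  have hv : mapV (evalRingHom 0) (mapV C (G.app v)) = G.app v := by simp [mapV]
  rw [coeff_zero_eq_eval_zero, ← coe_evalRingHom, contactPoly, map_wedge, h, hv, wedge_self]

/-- The infinitesimal version of `natTrailingDegree_wedge_curve`. -/
theorem coeff_one_wedge_curve (G : FormPair F) {v w : F × F} (hvw : wedge v w ≠ 0)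
    (hD : 0 < G.deg) {γ : F[X] × F[X]} {c : F} (hc : c ≠ 0)
    (hγ : mapV (evalRingHom 0) γ = c • v) :
    (wedge (mapV C (G.app v)) ((G.map C).app γ)).coeff 1 =
      (contactPoly G v w).coeff 1 * c ^ (G.deg - 1) *
        ((wedge v w)⁻¹ * (wedge (mapV C v) γ).coeff 1) := by
  have hmm : ∀ u : F × F, mapV (evalRingHom 0) (mapV C u) = u := fun u => by simp [mapV]
  set α := C (wedge v w)⁻¹ * wedge γ (mapV C w) with hα
  set τ := C (wedge v w)⁻¹ * wedge (mapV C v) γ with hτ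
  have hα0 : α.coeff 0 = c := by
    rw [hα, coeff_C_mul, coeff_zero_eq_eval_zero, ← coe_evalRingHom, map_wedge, hγ, hmm,
      wedge_smul_left, mul_comm c, ← mul_assoc, inv_mul_cancel₀ hvw, one_mul]
  have hτ0 : τ.coeff 0 = 0 := by
    rw [hτ, coeff_C_mul, coeff_zero_eq_eval_zero, ← coe_evalRingHom, map_wedge, hγ, hmm,
      wedge_smul_right, wedge_self, mul_zero, mul_zero]
  have hαne : α ≠ 0 := by
    intro h
    rw [h, coeff_zero] at hα0
    exact hc hα0.symm
  have hdec := exists_line_decomposition hvw γ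
  rw [← hα, ← hτ] at hdec
  obtain ⟨τ', hτ'⟩ := X_dvd_iff.2 hτ0
  have h1 : (wedge v w)⁻¹ * (wedge (mapV C v) γ).coeff 1 = τ'.coeff 0 := by
    rw [← coeff_C_mul, ← hτ, hτ', coeff_X_mul]
  rw [h1]
  conv_lhs => rw [hdec]
  rw [wedge_app_eq_homEval G v w hαne, homEval, finsetSum_coeff, Finset.sum_eq_single 1]
  · rw [pow_one, hτ', mul_assoc, mul_assoc, coeff_C_mul, coeff_X_mul, mul_coeff_zero,
      coeff_zero_eq_eval_zero (α ^ _), eval_pow, ← coeff_zero_eq_eval_zero, hα0]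
    ring
  · intro i _ hi
    rcases Nat.eq_zero_or_pos i with rfl | hpos
    · rw [contactPoly_coeff_zero]; simp
    · rw [hτ', mul_pow, mul_assoc, mul_assoc, coeff_C_mul, coeff_X_pow_mul', if_neg (by omega),
        mul_zero]
  · intro h
    exact absurd (Finset.mem_range.2 (by omega)) h

theorem contactPoly_coeff_one_congr (G : FormPair F) {v w w' : F × F} {c : F}
    (hvw : wedge v w ≠ 0) (hD : 0 < G.deg) (hc : c ≠ 0) :
    (contactPoly G (c • v) w').coeff 1 * wedge v w =
      (contactPoly G v w).coeff 1 * c ^ (G.deg - 1 + G.deg) * wedge v w' := by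
  have hwl : (wedge (mapV C v) (line (c • v) w')).coeff 1 = wedge v w' := by
    rw [wedge_C_line, wedge_smul_right, wedge_self, mul_zero, C_0, zero_add, coeff_C_mul,
      coeff_X_one, mul_one]
  have h := coeff_one_wedge_curve G hvw hD (γ := line (c • v) w') hc (mapV_eval_line _ _)
  have hcp : contactPoly G (c • v) w' =
      C (c ^ G.deg) * wedge (mapV C (G.app v)) ((G.map C).app (line (c • v) w')) := by
    rw [contactPoly, FormPair.app_smul, mapV_smul, wedge_smul_left]
  rw [hcp, coeff_C_mul, h, hwl, pow_add]
  field_simp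

theorem derivAt_eq_of_div {r s : F[X]} {a : F} (hs : s.eval a ≠ 0) {R : RatFunc F}
    (hR : R = algebraMap F[X] (RatFunc F) r / algebraMap F[X] (RatFunc F) s) :
    derivAt R a = (r.derivative.eval a * s.eval a - r.eval a * s.derivative.eval a) /
      (s.eval a) ^ 2 := by
  have hs0 : s ≠ 0 := by rintro rfl; simp at hs
  have hid : R.num * s = r * R.denom := by
    have hinj : Function.Injective (algebraMap F[X] (RatFunc F)) :=
      IsFractionRing.injective F[X] (RatFunc F)
    apply hinj
    have h1 := RatFunc.num_div_denom R
    rw [hR, div_eq_div_iff ((map_ne_zero_iff _ hinj).2 (RatFunc.denom_ne_zero _))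
      ((map_ne_zero_iff _ hinj).2 hs0), ← hR] at h1
    rw [map_mul, map_mul, h1]
  have hd : R.denom.eval a ≠ 0 := by
    intro hd
    have h1 := congrArg (eval a) hid
    rw [eval_mul, eval_mul, hd, mul_zero] at h1
    have h2 := (mul_eq_zero.1 h1).resolve_right hs
    obtain ⟨u, v, huv⟩ := RatFunc.isCoprime_num_denom R
    have h3 := congrArg (eval a) huv
    rw [eval_add, eval_mul, eval_mul, h2, hd] at h3
    simp at h3
  have h1 := congrArg (eval a) hid
  have h2 := congrArg (fun f => eval a (derivative f)) hid
  simp only [derivative_mul, eval_add, eval_mul] at h1 h2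
  rw [derivAt, div_eq_div_iff (pow_ne_zero _ hd) (pow_ne_zero _ hs)]
  linear_combination (R.denom.eval a * s.eval a) * h2 -
    (R.denom.eval a * s.derivative.eval a + s.eval a * R.denom.derivative.eval a) * h1

variable [IsAlgClosed F] {G : FormPair F} {R : RatFunc F}

/-- The multiplier of a fixed point, in homogeneous coordinates. -/
theorem IsLift.contactPoly_coeff_one (h : IsLift G R) (hD : 0 < G.deg) {b w : F × F} {κ : F}
    (hbw : wedge b w ≠ 0) (hκ : G.app b = κ • b) :
    (contactPoly G b w).coeff 1 = κ ^ 2 * multiplier R (pt b) * wedge b w := by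
  have hb : b ≠ 0 := by rintro rfl; simp [wedge] at hbw
  have key : ∀ b₀ w₀ : F × F, wedge b₀ w₀ ≠ 0 → pt b = pt b₀ →
      (∀ κ₀ : F, G.app b₀ = κ₀ • b₀ →
        (contactPoly G b₀ w₀).coeff 1 = κ₀ ^ 2 * multiplier R (pt b₀) * wedge b₀ w₀) →
      (contactPoly G b w).coeff 1 = κ ^ 2 * multiplier R (pt b) * wedge b w := by
    intro b₀ w₀ h0 hp hl
    have hb₀ : b₀ ≠ 0 := by rintro rfl; simp [wedge] at h0
    obtain ⟨c, hc, rfl⟩ := exists_smul_of_wedge_eq_zero hb₀ hb ((pt_eq_iff hb₀ hb).1 hp.symm)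
    have hκ₀ : G.app b₀ = (κ * c / c ^ G.deg) • b₀ := by
      rw [G.app_smul, smul_smul] at hκ
      have := congrArg (fun u => (c ^ G.deg)⁻¹ • u) hκ
      simp only [smul_smul, inv_mul_cancel₀ (pow_ne_zero G.deg hc), one_smul] at this
      rw [this, div_eq_inv_mul]
    have h2 := contactPoly_coeff_one_congr G (w' := w) h0 hD hc
    rw [hl _ hκ₀] at h2
    rw [pt_smul hc, wedge_smul_left]
    have hcD : c ^ G.deg = c ^ (G.deg - 1) * c := by
      rw [← pow_succ]; congr 1; omega
    have hc1 : c ^ (G.deg - 1) ≠ 0 := pow_ne_zero _ hc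
    apply mul_right_cancel₀ h0
    rw [h2, pow_add, hcD]
    field_simp
  rcases exists_pt_eq (pt b) with ⟨x, hx⟩ | hx
  · refine key (x, 1) (1, 0) (by simp [wedge]) hx fun κ₀ hκ₀ => ?_
    have hG := hκ₀
    rw [FormPair.app_eval] at hG
    have hq : G.polys.2.eval x = κ₀ := by simpa using congrArg Prod.snd hG
    have hp : G.polys.1.eval x = κ₀ * x := by simpa using congrArg Prod.fst hG
    have hκ0 : κ₀ ≠ 0 := by
      rintro rfl
      exact h.app_ne (x, 1) (by simp) (by rw [hκ₀, zero_smul])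
    have hm : multiplier R (pt (x, 1)) = derivAt R x := by rw [pt_coe]; rfl
    have h1 : ∀ f : F[X], (f.comp (X + C x)).coeff 1 = f.derivative.eval x := by
      intro f
      have h2 : (derivative (f.comp (X + C x))).coeff 0 = (f.comp (X + C x)).coeff 1 := by
        rw [coeff_derivative]; simp
      rw [← h2, derivative_comp, coeff_zero_eq_eval_zero]
      simp [eval_comp]
    rw [hm, derivAt_eq_of_div (by rw [hq]; exact hκ0) h.eq_div, contactPoly_finite, h1,
      FormPair.app_eval, hp, hq]
    simp only [wedge, derivative_sub, derivative_mul, derivative_C, eval_sub, eval_mul,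
      eval_C, zero_mul, zero_add]
    field_simp
    ring
  · refine key (1, 0) (0, 1) (by simp [wedge]) hx fun κ₀ hκ₀ => ?_
    have hκ0 : κ₀ ≠ 0 := by
      rintro rfl
      exact h.app_ne (1, 0) (by simp) (by rw [hκ₀, zero_smul])
    have hl : line (1, 0) ((0 : F), 1) = ((1 : F[X]), X) := by simp [line, mapV]
    set V := (G.map C).app ((1 : F[X]), X) with hV
    have hev := mapV_eval_iterate_line G 1 ((1 : F), 0) (0, 1)
    rw [Function.iterate_one, Function.iterate_one, hκ₀, hl, ← hV] at hev
    have hs0 : V.1.eval 0 = κ₀ := by simpa [mapV] using congrArg Prod.fst hev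
    have hr0 : V.2.eval 0 = 0 := by simpa [mapV] using congrArg Prod.snd hev
    have hm : multiplier R (pt (1, 0)) =
        derivAt (RatFunc.eval RatFunc.C (RatFunc.X)⁻¹ R)⁻¹ 0 := by rw [pt_infty]; rfl
    have hdiv : (RatFunc.eval RatFunc.C (RatFunc.X)⁻¹ R)⁻¹ =
        algebraMap F[X] (RatFunc F) V.2 / algebraMap F[X] (RatFunc F) V.1 := by
      obtain ⟨c, hc, h1, h2⟩ := h.num_denom
      have hX : (RatFunc.X : RatFunc F) ≠ 0 := RatFunc.X_ne_zero
      have hCa : ∀ x, (RatFunc.C : F →+* RatFunc F) x = algebraMap F[X] (RatFunc F) (C x) :=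
        fun x => by simp
      have hE1 : R.num.eval₂ RatFunc.C (RatFunc.X)⁻¹ * RatFunc.X ^ G.deg =
          RatFunc.C c * algebraMap F[X] (RatFunc F) V.1 := by
        have : V.1 = homEval G.deg (fun i => C (G.num i)) 1 X := rfl
        rw [h1, eval₂_mul, eval₂_C, mul_assoc, ← one_div,
          eval₂_mul_pow _ G.natDegree_polys_fst hX, this, map_homEval, map_one, RatFunc.algebraMap_X]
        congr 1
        exact homEval_congr (fun i hi => by rw [G.coeff_polys_fst hi, hCa]) _ _
      have hE2 : R.denom.eval₂ RatFunc.C (RatFunc.X)⁻¹ * RatFunc.X ^ G.deg =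
          RatFunc.C c * algebraMap F[X] (RatFunc F) V.2 := by
        have : V.2 = homEval G.deg (fun i => C (G.den i)) 1 X := rfl
        rw [h2, eval₂_mul, eval₂_C, mul_assoc, ← one_div,
          eval₂_mul_pow _ G.natDegree_polys_snd hX, this, map_homEval, map_one, RatFunc.algebraMap_X]
        congr 1
        exact homEval_congr (fun i hi => by rw [G.coeff_polys_snd hi, hCa]) _ _
      change (R.num.eval₂ RatFunc.C (RatFunc.X)⁻¹ / R.denom.eval₂ RatFunc.C (RatFunc.X)⁻¹)⁻¹ = _
      rw [← mul_div_mul_right _ _ (pow_ne_zero G.deg hX), hE1, hE2,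
        mul_div_mul_left _ _ ((_root_.map_ne_zero _).2 hc), inv_div]
    have hVc : V.2.coeff 1 = V.2.derivative.eval 0 := by
      rw [← coeff_zero_eq_eval_zero, coeff_derivative]; simp
    rw [hm, derivAt_eq_of_div (by rw [hs0]; exact hκ0) hdiv, contactPoly, hl, ← hV, hκ₀, hs0, hr0]
    simp only [wedge, mapV, Prod.smul_fst, Prod.smul_snd, smul_eq_mul, mul_one, mul_zero, map_zero,
      zero_mul, sub_zero, coeff_C_mul, hVc]
    field_simp

/-- The iterates near a fixed point. -/
theorem IsLift.iterate_coeff_one (h : IsLift G R) (hD : 0 < G.deg) {b w : F × F} {κ : F}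
    (hbw : wedge b w ≠ 0) (hκ : G.app b = κ • b) (n : ℕ) :
    ∃ c : F, c ≠ 0 ∧ G.app^[n] b = c • b ∧
      (wedge (mapV C b) ((G.map C).app^[n] (line b w))).coeff 1 =
        c * multiplier R (pt b) ^ n * wedge b w := by
  have hb : b ≠ 0 := by rintro rfl; simp [wedge] at hbw
  have hκ0 : κ ≠ 0 := by
    rintro rfl
    exact h.app_ne b hb (by rw [hκ, zero_smul])
  induction n with
  | zero => exact ⟨1, one_ne_zero, by simp, by simp [wedge_line]⟩
  | succ n ih =>
    obtain ⟨c, hc, h1, h2⟩ := ih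
    refine ⟨c ^ G.deg * κ, mul_ne_zero (pow_ne_zero _ hc) hκ0, ?_, ?_⟩
    · rw [Function.iterate_succ_apply', h1, G.app_smul, hκ, smul_smul]
    · have h3 := coeff_one_wedge_curve G hbw hD (γ := (G.map C).app^[n] (line b w)) hc
        (by rw [mapV_eval_iterate_line, h1])
      rw [h2, h.contactPoly_coeff_one hD hbw hκ, hκ, mapV_smul, wedge_smul_left, coeff_C_mul] at h3
      rw [Function.iterate_succ_apply']
      apply mul_left_cancel₀ hκ0
      have hcD : c ^ G.deg = c ^ (G.deg - 1) * c := by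
        rw [← pow_succ]; congr 1; omega
      rw [h3, hcD, pow_succ (multiplier R (pt b))]
      field_simp

end Multiplier

/-! ### Unramified preimages near a repelling fixed point -/

section Preimages

variable {F : Type*} [NormedField F] [IsUltrametricDist F] [IsAlgClosed F]

/-- A polynomial without zeros of absolute value less than `r` has a small logarithmic
derivative at `0`. -/
theorem norm_coeff_one_le_of_no_root {f : F[X]} {r : ℝ} (hr : 0 < r) (h0 : f.coeff 0 ≠ 0)
    (hroot : ∀ x, ‖x‖ < r → f.eval x ≠ 0) : ‖f.coeff 1 / f.coeff 0‖ ≤ 1 / r := by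
  have h1 : f.coeff 1 = f.derivative.eval 0 := by
    rw [← coeff_zero_eq_eval_zero, coeff_derivative]; simp
  have hf : f ≠ 0 := by rintro rfl; simp at h0
  rw [coeff_zero_eq_eval_zero] at h0
  rw [h1, coeff_zero_eq_eval_zero, (IsAlgClosed.splits f).eval_derivative_div_eval_of_ne_zero h0]
  have hb : ∀ y ∈ f.roots.map (fun z => 1 / (0 - z)), ‖y‖ ≤ 1 / r := by
    intro y hy
    obtain ⟨z, hz, rfl⟩ := Multiset.mem_map.1 hy
    have hz' : r ≤ ‖z‖ := by
      by_contra! hlt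
      exact hroot z hlt ((mem_roots hf).1 hz)
    rw [norm_div, norm_one, zero_sub, norm_neg]
    exact one_div_le_one_div_of_le hr hz'
  have hsum : ∀ s : Multiset F, (∀ y ∈ s, ‖y‖ ≤ 1 / r) → ‖s.sum‖ ≤ 1 / r := by
    intro s
    induction s using Multiset.induction_on with
    | empty => intro _; simp [hr.le]
    | cons y s ih =>
      intro hs
      rw [Multiset.sum_cons]
      exact norm_add_le_of_le (hs y (Multiset.mem_cons_self y s))
        (ih fun z hz => hs z (Multiset.mem_cons_of_mem hz))
  exact hsum _ hb

variable {G : FormPair F} {R : RatFunc F}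

/-- Of any two points, at least one has preimages arbitrarily close to a repelling fixed point. -/
theorem IsLift.exists_preimage_near (h : IsLift G R) (hD : 0 < G.deg) {b w : F × F} {κ : F}
    (hbw : wedge b w ≠ 0) (hκ : G.app b = κ • b) (hrep : 1 < ‖multiplier R (pt b)‖) {r : ℝ}
    (hr : 0 < r) {u v : F × F} (huv : wedge u v ≠ 0) (hu : wedge u b ≠ 0) (hv : wedge v b ≠ 0) :
    ∃ (n : ℕ) (x : F), x ≠ 0 ∧ ‖x‖ < r ∧
      (wedge u (G.app^[n] (b + x • w)) = 0 ∨ wedge v (G.app^[n] (b + x • w)) = 0) := by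
  set lam := multiplier R (pt b) with hlam
  -- The polynomials in `x` that vanish when the `n`-th iterate of `b + x • w` is `u`, or `v`, have
  -- logarithmic derivatives at `0` that differ by `lam ^ n * δ`. This is unbounded in `n`, while
  -- both logarithmic derivatives are at most `1 / r` if neither polynomial vanishes near `0`.
  set δ := wedge u w / wedge u b - wedge v w / wedge v b with hδ
  have hδ0 : δ ≠ 0 := by
    rw [hδ, div_sub_div _ _ hu hv]
    refine div_ne_zero ?_ (mul_ne_zero hu hv)
    have : wedge u w * wedge v b - wedge u b * wedge v w = wedge u v * wedge w b := by
      simp only [wedge]; ring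
    rw [this]
    exact mul_ne_zero huv (by rw [wedge_swap]; exact neg_ne_zero.2 hbw)
  obtain ⟨n, hn⟩ := pow_unbounded_of_one_lt (1 / r / ‖δ‖) hrep
  have hδp : 0 < ‖δ‖ := norm_pos_iff.2 hδ0
  rw [div_lt_iff₀ hδp, ← norm_pow, ← norm_mul] at hn
  obtain ⟨c, hc, h1, h2⟩ := h.iterate_coeff_one hD hbw hκ n
  set V := (G.map C).app^[n] (line b w) with hV
  have hev : ∀ x : F, mapV (evalRingHom x) V = G.app^[n] (b + x • w) := by
    intro x
    have hCC : (evalRingHom x).comp C = RingHom.id F := by ext; simp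
    rw [hV, ← FormPair.map_iterate, FormPair.map_map, hCC, line, mapV_add, mapV_smul, mapV_mapV,
      mapV_mapV, hCC]
    simp [mapV, FormPair.map_id]
  have hpoly : ∀ (s : F × F) (x : F), (wedge (mapV C s) V).eval x = wedge s (G.app^[n] (b + x • w)) := by
    intro s x
    rw [← hev x, ← coe_evalRingHom, map_wedge]
    congr 1
    simp [mapV]
  have hcoeff0 : ∀ s, (wedge (mapV C s) V).coeff 0 = c * wedge s b := by
    intro s
    rw [coeff_zero_eq_eval_zero, hpoly, zero_smul, add_zero, h1, wedge_smul_right]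
  have hratio : ∀ s, wedge s b ≠ 0 → (wedge (mapV C s) V).coeff 1 / (wedge (mapV C s) V).coeff 0 =
      wedge (V.1.coeff 1, V.2.coeff 1) w / (c * wedge b w) + lam ^ n * (wedge s w / wedge s b) := by
    intro s hs
    have hlin : ∀ s, (wedge (mapV C s) V).coeff 1 = wedge s (V.1.coeff 1, V.2.coeff 1) := by
      intro s
      simp [wedge, mapV]
    have h3 := h2
    rw [hlin] at h3
    rw [hcoeff0, hlin]
    have h4 : wedge s (V.1.coeff 1, V.2.coeff 1) * wedge b w =
        wedge (V.1.coeff 1, V.2.coeff 1) w * wedge s b +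
          wedge b (V.1.coeff 1, V.2.coeff 1) * wedge s w := by
      simp only [wedge]; ring
    rw [h3] at h4
    field_simp
    linear_combination h4
  by_contra! hcon
  have hsmall : ∀ s, wedge s b ≠ 0 →
      (∀ x : F, x ≠ 0 → ‖x‖ < r → wedge s (G.app^[n] (b + x • w)) ≠ 0) →
      ‖(wedge (mapV C s) V).coeff 1 / (wedge (mapV C s) V).coeff 0‖ ≤ 1 / r := by
    intro s hs hx
    refine norm_coeff_one_le_of_no_root hr (by rw [hcoeff0]; exact mul_ne_zero hc hs) ?_
    intro x hxr
    rcases eq_or_ne x 0 with rfl | hx0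
    · rw [← coeff_zero_eq_eval_zero, hcoeff0]; exact mul_ne_zero hc hs
    · rw [hpoly]; exact hx x hx0 hxr
  have hsu := hsmall u hu fun x hx0 hxr => (hcon n x hx0 hxr).1
  have hsv := hsmall v hv fun x hx0 hxr => (hcon n x hx0 hxr).2
  have hdiff := norm_sub_le_of_le hsu hsv
  rw [hratio u hu, hratio v hv] at hdiff
  have : wedge (V.1.coeff 1, V.2.coeff 1) w / (c * wedge b w) + lam ^ n * (wedge u w / wedge u b) -
      (wedge (V.1.coeff 1, V.2.coeff 1) w / (c * wedge b w) + lam ^ n * (wedge v w / wedge v b)) =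
      lam ^ n * δ := by rw [hδ]; ring
  rw [this] at hdiff
  exact absurd hdiff (not_le.2 hn)

omit [IsUltrametricDist F] [IsAlgClosed F] in
theorem exists_pt (z : OnePoint F) : ∃ v : F × F, v ≠ 0 ∧ z = pt v := by
  rcases exists_pt_eq z with ⟨x, hx⟩ | hx
  · exact ⟨(x, 1), by simp, hx⟩
  · exact ⟨(1, 0), by simp, hx⟩

omit [IsUltrametricDist F] in
/-- A repelling fixed point is not critical. -/
theorem IsLift.localDegree_repelling (h : IsLift G R) (hD : 0 < G.deg) {b : F × F} (hb : b ≠ 0)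
    (hfix : toMap R (pt b) = pt b) (hrep : 1 < ‖multiplier R (pt b)‖) :
    ¬ IsCriticalPt R (pt b) := by
  obtain ⟨w, hbw⟩ := exists_wedge_ne hb
  rw [h.toMap_pt hb] at hfix
  obtain ⟨κ, hκ0, hκ⟩ := exists_smul_of_wedge_eq_zero hb (h.app_ne b hb)
    ((pt_eq_iff hb (h.app_ne b hb)).1 hfix.symm)
  have h1 := h.contactPoly_coeff_one hD hbw hκ
  have hlam : multiplier R (pt b) ≠ 0 := by
    intro h0
    rw [h0, norm_zero] at hrep
    linarith
  rw [IsCriticalPt, (h.localDegree_eq hD hbw).2, not_lt]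
  refine natTrailingDegree_le_of_ne_zero ?_
  rw [h1]
  exact mul_ne_zero (mul_ne_zero (pow_ne_zero _ hκ0) hlam) hbw

/-- If an unramified critical point is sent to a repelling fixed point, then the fixed point
is accumulated by unramified preimages of the critical point. -/
theorem IsLift.exists_unramified_preimage_near [CharZero F] (h : IsLift G R) (hD : 0 < G.deg)
    {b w e : F × F} (hbw : wedge b w ≠ 0) (he : e ≠ 0) {ℓ : ℕ}
    (hℓ : (toMap R)^[ℓ] (pt e) = pt b) (hfix : toMap R (pt b) = pt b)
    (hrep : 1 < ‖multiplier R (pt b)‖) (hcrit : IsCriticalPt R (pt e))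
    (hunr : IsUnramified R (pt e)) {r : ℝ} (hr : 0 < r) :
    ∃ (N : ℕ) (z : F), z ≠ 0 ∧ ‖z‖ < r ∧ wedge e (G.app^[N] (b + z • w)) = 0 ∧
      (wedge (mapV C e) ((G.map C).app^[N] (line b w))).derivative.eval z ≠ 0 := by
  have hb : b ≠ 0 := by rintro rfl; simp [wedge] at hbw
  set T := toMap R with hT
  have hfixn : ∀ n, T^[n] (pt b) = pt b := fun n => Function.iterate_fixed hfix n
  have hcb : pt e ≠ pt b := by
    intro heq
    rw [heq] at hcrit
    exact h.localDegree_repelling hD hb hfix hrep hcrit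
  have hnonper : ∀ n, 1 ≤ n → T^[n] (pt e) ≠ pt e := by
    intro n hn hper
    have h1 : T^[n * ℓ] (pt e) = pt e := by
      rw [Function.iterate_mul]
      exact Function.iterate_fixed hper ℓ
    have h2 : n * ℓ = (n * ℓ - ℓ) + ℓ := by
      have := Nat.le_mul_of_pos_left ℓ hn
      omega
    rw [h2, Function.iterate_add_apply, hℓ, hfixn] at h1
    exact hcb h1.symm
  -- the points of the critical orbits that are sent to the critical point
  have hbad : {z : OnePoint F | ∃ c', IsCriticalPt R c' ∧ ∃ j, z = T^[j] c' ∧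
      ∃ n, T^[n] z = pt e}.Finite := by
    have hsub : {z : OnePoint F | ∃ c', IsCriticalPt R c' ∧ ∃ j, z = T^[j] c' ∧
        ∃ n, T^[n] z = pt e} ⊆ ⋃ c' ∈ {z : OnePoint F | IsCriticalPt R z},
          {z | ∃ j, z = T^[j] c' ∧ ∃ n, T^[n] z = pt e} := by
      rintro z ⟨c', hc', hz⟩
      exact Set.mem_biUnion hc' hz
    refine ((h.finite_critical hD).biUnion fun c' _ => ?_).subset hsub
    by_cases hex : ∃ s, T^[s] c' = pt e
    · obtain ⟨s, hs⟩ := hex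
      refine ((Finset.range (s + 1)).finite_toSet.image fun j => T^[j] c').subset ?_
      rintro z ⟨j, rfl, n, hn⟩
      refine ⟨j, ?_, rfl⟩
      rw [Finset.mem_coe, Finset.mem_range]
      rw [← Function.iterate_add_apply] at hn
      by_contra hlt
      have h3 : n + j = (n + j - s) + s := by omega
      rw [h3, Function.iterate_add_apply, hs] at hn
      exact hnonper _ (by omega) hn
    · convert Set.finite_empty
      rw [Set.eq_empty_iff_forall_notMem]
      rintro z ⟨j, rfl, n, hn⟩
      exact hex ⟨n + j, by rw [Function.iterate_add_apply]; exact hn⟩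
  -- of two unramified preimages off these orbits, one has preimages near the fixed point; along the
  -- way to the critical point no critical point is met
  have hinf := hunr.sdiff hbad
  obtain ⟨w₁, hw₁⟩ := hinf.nonempty
  obtain ⟨w₂, hw₂, hne⟩ := (hinf.sdiff (Set.finite_singleton w₁)).nonempty
  have hnb : ∀ z, IsUnramifiedPreimage R z (pt e) → z ≠ pt b := by
    rintro _ ⟨n, -, hn, -⟩ rfl
    rw [← hT, hfixn] at hn
    exact hcb hn.symm
  obtain ⟨u, hu, rfl⟩ := exists_pt w₁
  obtain ⟨v, hv, rfl⟩ := exists_pt w₂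
  obtain ⟨κ, hκ0, hκ⟩ := exists_smul_of_wedge_eq_zero hb (h.app_ne b hb)
    ((pt_eq_iff hb (h.app_ne b hb)).1 (by rw [← h.toMap_pt hb]; exact hfix.symm))
  obtain ⟨k, z, hz0, hzr, hz⟩ := h.exists_preimage_near hD hbw hκ hrep hr (u := u) (v := v)
    (fun h0 => hne (((pt_eq_iff hu hv).2 h0).symm))
    (fun h0 => hnb _ hw₁.1 ((pt_eq_iff hu hb).2 h0))
    (fun h0 => hnb _ hw₂.1 ((pt_eq_iff hv hb).2 h0))
  have hwz : wedge (b + z • w) w ≠ 0 := by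
    rw [wedge_add_left, wedge_smul_left, wedge_self, mul_zero, add_zero]
    exact hbw
  have hbz : b + z • w ≠ 0 := by
    intro h0
    rw [h0] at hwz
    simp [wedge] at hwz
  have key : ∀ y, y ≠ 0 → IsUnramifiedPreimage R (pt y) (pt e) →
      (¬ ∃ c', IsCriticalPt R c' ∧ ∃ j, pt y = T^[j] c' ∧ ∃ n, T^[n] (pt y) = pt e) →
      wedge y (G.app^[k] (b + z • w)) = 0 →
      ∃ N, T^[N] (pt (b + z • w)) = pt e ∧ localDegree (ratIterate R N) (pt (b + z • w)) = 1 := by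
    rintro y hy ⟨n, hn1, hn, hloc⟩ hybad hyz
    have hTk : T^[k] (pt (b + z • w)) = pt y := by
      rw [hT, h.iterate_pt k hbz]
      exact ((pt_eq_iff hy (h.iterate_ne k hbz)).2 hyz).symm
    refine ⟨k + n, ?_, ?_⟩
    · rw [add_comm, Function.iterate_add_apply, hTk, hn]
    · rw [h.localDegree_iterate_eq_prod hD _ hbz, Finset.prod_range_add]
      have h2 : ∏ i ∈ Finset.range n, localDegree R ((toMap R)^[k + i] (pt (b + z • w))) = 1 := by
        rw [← hloc, h.localDegree_iterate_eq_prod hD _ hy, ← hTk]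
        refine Finset.prod_congr rfl fun i _ => ?_
        rw [add_comm, Function.iterate_add_apply]
      rw [h2, mul_one]
      refine Finset.prod_eq_one fun i hi => ?_
      have hik := Finset.mem_range.1 hi
      have hpos : 0 < localDegree R ((toMap R)^[i] (pt (b + z • w))) := by
        rw [h.iterate_pt i hbz]
        exact h.localDegree_pos hD (h.iterate_ne i hbz)
      by_contra hne1
      refine hybad ⟨T^[i] (pt (b + z • w)), ?_, k - i, ?_, n, hn⟩
      · change 1 < _
        rw [hT]
        omega
      · rw [← Function.iterate_add_apply, Nat.sub_add_cancel hik.le, hTk]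
  obtain ⟨N, hN, hloc⟩ : ∃ N, T^[N] (pt (b + z • w)) = pt e ∧
      localDegree (ratIterate R N) (pt (b + z • w)) = 1 := by
    rcases hz with hz | hz
    · exact key u hu hw₁.1 hw₁.2 hz
    · exact key v hv hw₂.1 hw₂.2 hz
  refine ⟨N, z, hz0, hzr, ?_, ?_⟩
  · rw [hT, h.iterate_pt N hbz] at hN
    exact (pt_eq_iff he (h.iterate_ne N hbz)).1 hN.symm
  · rw [hT, h.iterate_pt N hbz] at hN
    obtain ⟨μ, hμ0, hμ⟩ := exists_smul_of_wedge_eq_zero he (h.iterate_ne N hbz)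
      ((pt_eq_iff he (h.iterate_ne N hbz)).1 hN.symm)
    obtain ⟨h1, h2⟩ := h.localDegree_iterate hD N hwz
    rw [hloc] at h2
    have h3 : (wedge (mapV C (G.app^[N] (b + z • w)))
        ((G.map C).app^[N] (line (b + z • w) w))).coeff 1 ≠ 0 := by
      have := mem_support_iff.1 (natTrailingDegree_mem_support_of_nonzero h1)
      rwa [← h2] at this
    have hcomp : (G.map C).app^[N] (line (b + z • w) w) =
        mapV (compRingHom (X + C z)) ((G.map C).app^[N] (line b w)) := by
      have hC : (compRingHom (X + C z)).comp C = (C : F →+* F[X]) := by ext; simp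
      rw [← FormPair.map_iterate, FormPair.map_map, hC]
      congr 1
      simp only [line, mapV_add, mapV_smul, mapV_mapV, hC]
      simp only [mapV, coe_compRingHom, X_comp]
      refine Prod.ext ?_ ?_
      · simp; ring
      · simp; ring
    have hfin : wedge (mapV C (G.app^[N] (b + z • w)))
        ((G.map C).app^[N] (line (b + z • w) w)) =
        C μ * (wedge (mapV C e) ((G.map C).app^[N] (line b w))).comp (X + C z) := by
      have hCe : mapV C e = mapV (compRingHom (X + C z)) (mapV C e) := by simp [mapV]
      rw [hμ, mapV_smul, wedge_smul_left, hcomp, ← coe_compRingHom_apply, map_wedge, ← hCe]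
    rw [hfin, coeff_C_mul] at h3
    have h4 := right_ne_zero_of_mul h3
    intro h0
    refine h4 ?_
    have h5 : ∀ f : F[X], (f.comp (X + C z)).coeff 1 = f.derivative.eval z := by
      intro f
      have h2 : (derivative (f.comp (X + C z))).coeff 0 = (f.comp (X + C z)).coeff 1 := by
        rw [coeff_derivative]; simp
      rw [← h2, derivative_comp, coeff_zero_eq_eval_zero]
      simp [eval_comp]
    rw [h5, h0]

end Preimages

/-! ### Analytic functions of the parameter and the coordinate -/

section LipschitzNear

variable {Ω E E' : Type*} [NontriviallyNormedField Ω] [NormedAddCommGroup E] [NormedSpace Ω E]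
  [NormedAddCommGroup E'] [NormedSpace Ω E']

/-- `g` is Lipschitz on some ball around `p₀`. -/
def LipNear (g : E → E') (p₀ : E) : Prop :=
  ∃ Λ : ℝ, 0 ≤ Λ ∧ ∃ r : ℝ, 0 < r ∧ ∀ p p', ‖p - p₀‖ ≤ r → ‖p' - p₀‖ ≤ r →
    ‖g p - g p'‖ ≤ Λ * ‖p - p'‖

omit [NormedSpace Ω E] in
theorem exists_radius {p₀ : E} {Q : E → Prop} (h : ∀ᶠ p in 𝓝 p₀, Q p) :
    ∃ r : ℝ, 0 < r ∧ ∀ p, ‖p - p₀‖ ≤ r → Q p := by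
  obtain ⟨r, hr, hQ⟩ := Metric.eventually_nhds_iff_ball.1 h
  refine ⟨r / 2, by positivity, fun p hp => hQ p ?_⟩
  rw [Metric.mem_ball, dist_eq_norm]
  linarith

omit [NormedSpace Ω E] in
theorem eventually_norm_le (p₀ : E) {r : ℝ} (hr : 0 < r) : ∀ᶠ p in 𝓝 p₀, ‖p - p₀‖ ≤ r := by
  filter_upwards [Metric.ball_mem_nhds p₀ hr] with p hp
  rw [Metric.mem_ball, dist_eq_norm] at hp
  exact hp.le

theorem lipNear_of_analyticAt {g : E → E'} {p₀ : E} (h : AnalyticAt Ω g p₀) : LipNear g p₀ := by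
  obtain ⟨Λ, s, hs, hL⟩ := h.hasStrictFDerivAt.exists_lipschitzOnWith
  obtain ⟨r, hr, hrs⟩ := exists_radius (Q := fun p => p ∈ s) hs
  refine ⟨Λ, Λ.2, r, hr, fun p p' hp hp' => ?_⟩
  have := hL.dist_le_mul p (hrs p hp) p' (hrs p' hp')
  rwa [dist_eq_norm, dist_eq_norm] at this

omit [NormedSpace Ω E] [NormedSpace Ω E'] in
theorem LipNear.continuousAt {g : E → E'} {p₀ : E} (h : LipNear g p₀) : ContinuousAt g p₀ := by
  obtain ⟨Λ, hΛ, r, hr, hL⟩ := h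
  rw [ContinuousAt, tendsto_iff_norm_sub_tendsto_zero]
  have h1 : Tendsto (fun p => Λ * ‖p - p₀‖) (𝓝 p₀) (𝓝 0) := by
    have : Continuous fun p : E => Λ * ‖p - p₀‖ := by fun_prop
    simpa using this.tendsto p₀
  refine squeeze_zero' (Eventually.of_forall fun _ => norm_nonneg _) ?_ h1
  filter_upwards [eventually_norm_le p₀ hr] with p hp
  exact hL p p₀ hp (by simpa using hr.le)

omit [NormedSpace Ω E] [NormedSpace Ω E'] in
theorem LipNear.comp {E'' : Type*} [NormedAddCommGroup E''] {g : E' → E''} {φ : E → E'} {p₀ : E}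
    {q₀ : E'} (hg : LipNear g q₀) (hφ : LipNear φ p₀) (h0 : φ p₀ = q₀) :
    LipNear (fun p => g (φ p)) p₀ := by
  have hc := hφ.continuousAt
  obtain ⟨Λ, hΛ, r, hr, hL⟩ := hg
  obtain ⟨Λ', hΛ', r', hr', hL'⟩ := hφ
  rw [ContinuousAt, h0] at hc
  obtain ⟨r₂, hr₂, hr₂'⟩ := exists_radius (hc.eventually (eventually_norm_le q₀ hr))
  refine ⟨Λ * Λ', mul_nonneg hΛ hΛ', min r' r₂, lt_min hr' hr₂, fun p p' hp hp' => ?_⟩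
  refine (hL _ _ (hr₂' p (hp.trans (min_le_right _ _)))
    (hr₂' p' (hp'.trans (min_le_right _ _)))).trans ?_
  rw [mul_assoc]
  gcongr
  exact hL' p p' (hp.trans (min_le_left _ _)) (hp'.trans (min_le_left _ _))

omit [NormedSpace Ω E] [NormedSpace Ω E'] in
theorem LipNear.prodMk {E'' : Type*} [NormedAddCommGroup E''] {g : E → E'} {f : E → E''} {p₀ : E}
    (hg : LipNear g p₀) (hf : LipNear f p₀) : LipNear (fun p => (g p, f p)) p₀ := by
  obtain ⟨Λ, hΛ, r, hr, hL⟩ := hg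
  obtain ⟨Λ', hΛ', r', hr', hL'⟩ := hf
  refine ⟨max Λ Λ', le_max_of_le_left hΛ, min r r', lt_min hr hr', fun p p' hp hp' => ?_⟩
  rw [Prod.mk_sub_mk, Prod.norm_mk]
  refine max_le ?_ ?_
  · refine (hL p p' (hp.trans (min_le_left _ _)) (hp'.trans (min_le_left _ _))).trans ?_
    gcongr
    exact le_max_left _ _
  · refine (hL' p p' (hp.trans (min_le_right _ _)) (hp'.trans (min_le_right _ _))).trans ?_
    gcongr
    exact le_max_right _ _

omit [NormedSpace Ω E] [NormedSpace Ω E'] in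
theorem LipNear.add {g f : E → E'} {p₀ : E}
    (hg : LipNear g p₀) (hf : LipNear f p₀) : LipNear (fun p => g p + f p) p₀ := by
  obtain ⟨Λ, hΛ, r, hr, hL⟩ := hg
  obtain ⟨Λ', hΛ', r', hr', hL'⟩ := hf
  refine ⟨Λ + Λ', by positivity, min r r', lt_min hr hr', fun p p' hp hp' => ?_⟩
  rw [add_sub_add_comm, add_mul]
  exact (norm_add_le _ _).trans (add_le_add
    (hL p p' (hp.trans (min_le_left _ _)) (hp'.trans (min_le_left _ _)))
    (hL' p p' (hp.trans (min_le_right _ _)) (hp'.trans (min_le_right _ _))))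

omit [NormedSpace Ω E] in
theorem lipNear_id (p₀ : E) : LipNear (fun p : E => p) p₀ :=
  ⟨1, zero_le_one, 1, one_pos, fun p p' _ _ => by rw [one_mul]⟩

theorem lipNear_fst (p₀ : E × E') : LipNear (fun p : E × E' => p.1) p₀ :=
  ⟨1, zero_le_one, 1, one_pos, fun p p' _ _ => by
    rw [one_mul]; exact norm_fst_le (p - p')⟩

theorem lipNear_snd (p₀ : E × E') : LipNear (fun p : E × E' => p.2) p₀ :=
  ⟨1, zero_le_one, 1, one_pos, fun p p' _ _ => by
    rw [one_mul]; exact norm_snd_le (p - p')⟩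

end LipschitzNear

section Implicit

variable {Ω : Type*} [NontriviallyNormedField Ω] [IsUltrametricDist Ω]

/-- An analytic function of two variables is approximately linear in the second one. -/
theorem exists_approxLinear {g : Ω × Ω → Ω} {p₀ : Ω × Ω} (h : AnalyticAt Ω g p₀) {L : Ω}
    (hL : HasDerivAt (fun x => g (p₀.1, x)) L p₀.2) (hL0 : L ≠ 0) {θ : ℝ} (hθ : 0 < θ) :
    ∃ Λ : ℝ, 0 ≤ Λ ∧ ∃ r : ℝ, 0 < r ∧ ∀ p p', ‖p - p₀‖ ≤ r → ‖p' - p₀‖ ≤ r →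
      ‖g p - g p' - L * (p.2 - p'.2)‖ ≤ max (θ * (‖L‖ * ‖p.2 - p'.2‖)) (Λ * ‖p.1 - p'.1‖) := by
  have hs := h.hasStrictFDerivAt
  set f' := fderiv Ω g p₀ with hf'
  have hLf : f' (0, 1) = L := by
    have h1 : HasFDerivAt g f' (p₀.1, p₀.2) := hs.hasFDerivAt
    have h2 : HasDerivAt (fun x : Ω => (p₀.1, x)) ((0 : Ω), (1 : Ω)) p₀.2 :=
      (hasDerivAt_const _ _).prodMk (hasDerivAt_id _)
    exact (h1.comp_hasDerivAt p₀.2 h2).unique hL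
  have hLp : 0 < ‖L‖ := norm_pos_iff.2 hL0
  have hc : 0 < θ * ‖L‖ := by positivity
  have ho := hs.isLittleO.bound hc
  obtain ⟨r, hr, hb⟩ := exists_radius ho
  refine ⟨max (θ * ‖L‖) ‖f' (1, 0)‖, le_max_of_le_left hc.le, r, hr, fun p p' hp hp' => ?_⟩
  have hpp := hb (p, p') (by
    have : (p, p') - (p₀, p₀) = (p - p₀, p' - p₀) := rfl
    rw [this, Prod.norm_mk]
    exact max_le hp hp')
  have hlin : f' (p - p') = (p.1 - p'.1) * f' (1, 0) + (p.2 - p'.2) * L := by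
    have : p - p' = (p.1 - p'.1) • ((1 : Ω), (0 : Ω)) + (p.2 - p'.2) • ((0 : Ω), (1 : Ω)) := by
      ext <;> simp
    rw [this, map_add, _root_.map_smul, _root_.map_smul, hLf, smul_eq_mul, smul_eq_mul]
  have hnorm : ‖p - p'‖ = max ‖p.1 - p'.1‖ ‖p.2 - p'.2‖ := Prod.norm_def (p - p')
  dsimp only at hpp
  rw [hlin, hnorm] at hpp
  have e1 : g p - g p' - L * (p.2 - p'.2) =
      (g p - g p' - ((p.1 - p'.1) * f' (1, 0) + (p.2 - p'.2) * L)) + (p.1 - p'.1) * f' (1, 0) := by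
    ring
  rw [e1]
  refine norm_add_le_of_le (hpp.trans ?_) ?_
  · rw [mul_max_of_nonneg _ _ hc.le, max_comm]
    refine max_le_max (by rw [mul_assoc]) ?_
    gcongr
    exact le_max_left _ _
  · refine le_max_of_le_right ?_
    rw [norm_mul, mul_comm]
    gcongr
    exact le_max_right _ _

/-- The implicit function theorem, over every closed subfield from a collection `𝒞` that contains
the parameter at once. -/
theorem exists_implicit [CompleteSpace Ω] {𝒞 : Set (Subfield Ω)}
    (hcl : ∀ k ∈ 𝒞, IsClosed (k : Set Ω)) {g : Ω × Ω → Ω} {t₀ : Ω}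
    (h : AnalyticAt Ω g (t₀, 0)) {L : Ω} (hL : HasDerivAt (fun x => g (t₀, x)) L 0) (hL0 : L ≠ 0)
    (hLk : ∀ k ∈ 𝒞, L ∈ k) (h0 : g (t₀, 0) = 0)
    (hmem : ∀ᶠ p in 𝓝 (t₀, (0 : Ω)), ∀ k ∈ 𝒞, p.1 ∈ k → p.2 ∈ k → g p ∈ k) :
    ∃ α : Ω → Ω, α t₀ = 0 ∧ LipNear α t₀ ∧ (∀ᶠ t in 𝓝 t₀, g (t, α t) = 0) ∧
      ∀ᶠ t in 𝓝 t₀, ∀ k ∈ 𝒞, t ∈ k → α t ∈ k := by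
  obtain ⟨Λ, hΛ, r₁, hr₁, hest⟩ := exists_approxLinear h hL hL0 (θ := 1 / 2) (by norm_num)
  obtain ⟨r₂, hr₂, hmem⟩ := exists_radius hmem
  set r := min r₁ r₂ with hr
  have hr0 : 0 < r := lt_min hr₁ hr₂
  have hLp : 0 < ‖L‖ := norm_pos_iff.2 hL0
  set δ := min r (r * ‖L‖ / (Λ + 1)) with hδ
  have hδ0 : 0 < δ := lt_min hr0 (by positivity)
  have hball : ∀ t x : Ω, ‖t - t₀‖ ≤ δ → ‖x‖ ≤ r → ‖(t, x) - (t₀, 0)‖ ≤ r := by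
    intro t x ht hx
    rw [Prod.mk_sub_mk, Prod.norm_mk, sub_zero]
    exact max_le (ht.trans (min_le_left _ _)) hx
  have hex : ∀ (k : Subfield Ω), IsClosed (k : Set Ω) → L ∈ k →
      (∀ p : Ω × Ω, ‖p - (t₀, 0)‖ ≤ r → p.1 ∈ k → p.2 ∈ k → g p ∈ k) →
      ∀ t ∈ k, ‖t - t₀‖ ≤ δ → ∃ x ∈ k, ‖x‖ ≤ r ∧ g (t, x) = 0 := by
    intro k hk hLk hkm t ht htδ
    obtain ⟨x, hx, hxr, hgx⟩ := exists_eq_of_approxLinear (k := k) hk (φ := fun x => g (t, x))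
      (L := L) (t₀ := 0) (y := 0) (R := ‖L‖ * r) (θ := 1 / 2) (by norm_num) (by norm_num)
      (by positivity) hLk hL0 k.zero_mem
      (fun x hx hxr => hkm _ (hball t x htδ (by
        rw [sub_zero] at hxr; exact le_of_mul_le_mul_left hxr hLp)) ht hx)
      (fun x _ x' _ hxr hxr' => by
        rw [sub_zero] at hxr hxr'
        have := hest (t, x) (t, x')
          ((hball t x htδ (le_of_mul_le_mul_left hxr hLp)).trans (min_le_left _ _))
          ((hball t x' htδ (le_of_mul_le_mul_left hxr' hLp)).trans (min_le_left _ _))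
        simp only [sub_self, norm_zero, mul_zero] at this
        refine this.trans (max_le le_rfl (by positivity)))
      k.zero_mem
      (by
        have := hest (t, 0) (t₀, 0) ((hball t 0 htδ (by simpa using hr0.le)).trans (min_le_left _ _))
          (by simpa using hr₁.le)
        simp only [sub_self, norm_zero, mul_zero, h0, sub_zero] at this
        rw [zero_sub, norm_neg]
        refine this.trans (max_le (by positivity) ?_)
        calc Λ * ‖t - t₀‖ ≤ (Λ + 1) * (r * ‖L‖ / (Λ + 1)) := by
              gcongr
              · linarith
              · exact htδ.trans (min_le_right _ _)
          _ = ‖L‖ * r := by field_simp)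
    exact ⟨x, hx, by rw [sub_zero] at hxr; exact le_of_mul_le_mul_left hxr hLp, hgx⟩
  have hdiff : ∀ t t' x x' : Ω, ‖t - t₀‖ ≤ δ → ‖t' - t₀‖ ≤ δ → ‖x‖ ≤ r → ‖x'‖ ≤ r →
      g (t, x) = 0 → g (t', x') = 0 → ‖x - x'‖ ≤ Λ / ‖L‖ * ‖t - t'‖ := by
    intro t t' x x' ht ht' hx hx' hg hg'
    have := hest (t, x) (t', x') ((hball t x ht hx).trans (min_le_left _ _))
      ((hball t' x' ht' hx').trans (min_le_left _ _))
    rw [hg, hg', sub_zero, zero_sub, norm_neg, norm_mul] at this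
    dsimp only at this
    have h2 : ‖L‖ * ‖x - x'‖ ≤ Λ * ‖t - t'‖ := by
      rcases le_max_iff.1 this with h | h
      · have : ‖L‖ * ‖x - x'‖ = 0 := le_antisymm (by linarith) (by positivity)
        rw [this]; positivity
      · exact h
    rw [div_mul_eq_mul_div, le_div_iff₀ hLp]
    linarith
  have htop := hex ⊤ isClosed_univ (Subfield.mem_top _) (fun _ _ _ _ => Subfield.mem_top _)
  choose! α hα using fun t (ht : ‖t - t₀‖ ≤ δ) => htop t (Subfield.mem_top _) ht
  have ht₀δ : ‖t₀ - t₀‖ ≤ δ := by simpa using hδ0.le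
  have huniq : ∀ t x : Ω, ‖t - t₀‖ ≤ δ → ‖x‖ ≤ r → g (t, x) = 0 → x = α t := by
    intro t x ht hx hg
    have := hdiff t t x (α t) ht ht hx (hα t ht).2.1 hg (hα t ht).2.2
    rw [sub_self, norm_zero, mul_zero] at this
    exact sub_eq_zero.1 (norm_le_zero_iff.1 this)
  refine ⟨α, (huniq t₀ 0 ht₀δ (by simpa using hr0.le) h0).symm,
    ⟨Λ / ‖L‖, by positivity, δ, hδ0, fun t t' ht ht' => hdiff t t' _ _ ht ht' (hα t ht).2.1
      (hα t' ht').2.1 (hα t ht).2.2 (hα t' ht').2.2⟩, ?_, ?_⟩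
  · filter_upwards [eventually_norm_le t₀ hδ0] with t ht
    exact (hα t ht).2.2
  · filter_upwards [eventually_norm_le t₀ hδ0] with t ht k hk htk
    obtain ⟨x, hxk, hxr, hx⟩ := hex k (hcl k hk) (hLk k hk)
      (fun p hp => hmem p (hp.trans (min_le_right _ _)) k hk) t htk ht
    rw [← huniq t x ht hxr hx]
    exact hxk

end Implicit

section Families

variable {Ω : Type*} [NontriviallyNormedField Ω] [IsUltrametricDist Ω]
variable {K : Subfield Ω} {ζ : Ω} {B : Set Ω}

/-- The evaluation of a function at a parameter. -/
def evalAt (t : Ω) : holRing K ζ B →+* Ω :=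
  (Pi.evalRingHom (fun _ : Ω => Ω) t).comp (holRing K ζ B).subtype

/-- The evaluation of a polynomial whose coefficients depend on the parameter. -/
def evalAt₂ (p : Ω × Ω) : (holRing K ζ B)[X] →+* Ω := eval₂RingHom (evalAt p.1) p.2

theorem evalAt₂_eq_sum (f : (holRing K ζ B)[X]) (p : Ω × Ω) :
    evalAt₂ p f = ∑ i ∈ Finset.range (f.natDegree + 1), (f.coeff i : Ω → Ω) p.1 * p.2 ^ i := by
  change f.eval₂ _ _ = _
  rw [eval₂_eq_sum_range]
  rfl

theorem evalAt₂_eq_eval (f : (holRing K ζ B)[X]) (t x : Ω) :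
    evalAt₂ (t, x) f = (f.map (evalAt t)).eval x := by
  rw [eval_map]; rfl

theorem evalAt_analyticAt (hB : B ∈ 𝓝 ζ) (f : holRing K ζ B) :
    AnalyticAt Ω (fun t => evalAt t f) ζ := holRing_analyticAt hB f.2

theorem evalAt₂_analyticAt (hB : B ∈ 𝓝 ζ) (f : (holRing K ζ B)[X]) (x : Ω) :
    AnalyticAt Ω (fun p => evalAt₂ p f) (ζ, x) := by
  simp only [evalAt₂_eq_sum]
  refine Finset.analyticAt_fun_sum _ fun i _ => ?_
  have h1 : AnalyticAt Ω (f.coeff i : Ω → Ω) ((ζ, x) : Ω × Ω).1 := holRing_analyticAt hB (f.coeff i).2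
  exact (h1.comp analyticAt_fst).mul (analyticAt_snd.pow i)

theorem evalAt_mem {k : Subfield Ω} (hk : IsClosed (k : Set Ω)) (hKk : K ≤ k) (hζ : ζ ∈ k)
    (f : holRing K ζ B) {t : Ω} (ht : t ∈ k) (htB : t ∈ B) : evalAt t f ∈ k :=
  holRing_apply_mem hk hKk hζ f.2 ht htB

theorem evalAt₂_mem {k : Subfield Ω} (hk : IsClosed (k : Set Ω)) (hKk : K ≤ k) (hζ : ζ ∈ k)
    (f : (holRing K ζ B)[X]) {p : Ω × Ω} (ht : p.1 ∈ k) (hx : p.2 ∈ k) (htB : p.1 ∈ B) :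
    evalAt₂ p f ∈ k := by
  rw [evalAt₂_eq_sum]
  exact sum_mem fun i _ => k.mul_mem (holRing_apply_mem hk hKk hζ (f.coeff i).2 ht htB)
    (k.pow_mem hx i)

/-- The divided difference `(f x - f y) / (x - y)`. -/
def divDiff (f : (holRing K ζ B)[X]) (p : Ω × Ω × Ω) : Ω :=
  ∑ n ∈ Finset.range (f.natDegree + 1), (f.coeff n : Ω → Ω) p.1 *
    ∑ i ∈ Finset.range n, p.2.1 ^ i * p.2.2 ^ (n - 1 - i)

theorem divDiff_mul (f : (holRing K ζ B)[X]) (t x y : Ω) :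
    divDiff f (t, x, y) * (x - y) = evalAt₂ (t, x) f - evalAt₂ (t, y) f := by
  rw [evalAt₂_eq_sum, evalAt₂_eq_sum, ← Finset.sum_sub_distrib, divDiff, Finset.sum_mul]
  refine Finset.sum_congr rfl fun n _ => ?_
  rw [mul_assoc, (Commute.all x y).geom_sum₂_mul, mul_sub]

theorem divDiff_zero (f : (holRing K ζ B)[X]) (t : Ω) :
    divDiff f (t, 0, 0) = evalAt t (f.coeff 1) := by
  have hterm : ∀ n, ∑ i ∈ Finset.range n, (0 : Ω) ^ i * 0 ^ (n - 1 - i) = if n = 1 then 1 else 0 := by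
    intro n
    split_ifs with h
    · subst h; simp
    · refine Finset.sum_eq_zero fun i hi => ?_
      have := Finset.mem_range.1 hi
      rw [← pow_add, zero_pow (by omega)]
  simp only [divDiff, hterm, mul_ite, mul_one, mul_zero]
  rw [Finset.sum_ite_eq']
  split_ifs with h
  · rfl
  · rw [Finset.mem_range, not_lt] at h
    rw [coeff_eq_zero_of_natDegree_lt (by omega), map_zero]

theorem divDiff_analyticAt (hB : B ∈ 𝓝 ζ) (f : (holRing K ζ B)[X]) (x y : Ω) :
    AnalyticAt Ω (divDiff f) (ζ, x, y) := by
  refine Finset.analyticAt_fun_sum _ fun n _ => ?_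
  have h1 : AnalyticAt Ω (f.coeff n : Ω → Ω) ((ζ, x, y) : Ω × Ω × Ω).1 :=
    holRing_analyticAt hB (f.coeff n).2
  refine (h1.comp analyticAt_fst).mul (Finset.analyticAt_fun_sum _ fun i _ => ?_)
  exact ((analyticAt_fst.comp analyticAt_snd).pow i).mul
    ((analyticAt_snd.comp analyticAt_snd).pow (n - 1 - i))

theorem divDiff_mem {k : Subfield Ω} (hk : IsClosed (k : Set Ω)) (hKk : K ≤ k) (hζ : ζ ∈ k)
    (f : (holRing K ζ B)[X]) {t x y : Ω} (ht : t ∈ k) (hx : x ∈ k) (hy : y ∈ k) (htB : t ∈ B) :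
    divDiff f (t, x, y) ∈ k :=
  sum_mem fun i _ => k.mul_mem (holRing_apply_mem hk hKk hζ (f.coeff i).2 ht htB)
    (sum_mem fun _ _ => k.mul_mem (k.pow_mem hx _) (k.pow_mem hy _))

end Families

section Curves

variable {A A' : Type*} [CommRing A] [CommRing A']

/-- The evaluation of the image of a line under an iterate. -/
theorem mapV_iterate_line (φ : A →+* A') (y : A') (G : FormPair A) (n : ℕ) (v w : A × A) :
    mapV (eval₂RingHom φ y) ((G.map C).app^[n] (line v w)) =
      (G.map φ).app^[n] (mapV φ v + y • mapV φ w) := by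
  have hC : (eval₂RingHom φ y).comp C = φ := by ext; simp
  rw [← FormPair.map_iterate, FormPair.map_map, hC, line, mapV_add, mapV_smul, mapV_mapV, mapV_mapV,
    hC]
  simp

theorem mapV_mapRingHom_iterate_line (φ : A →+* A') (G : FormPair A) (n : ℕ) (v w : A × A) :
    mapV (mapRingHom φ) ((G.map C).app^[n] (line v w)) =
      ((G.map φ).map C).app^[n] (line (mapV φ v) (mapV φ w)) := by
  have hC : (mapRingHom φ).comp C = (C : A' →+* A'[X]).comp φ := by ext; simp
  rw [← FormPair.map_iterate, FormPair.map_map, hC, line, mapV_add, mapV_smul, mapV_mapV, mapV_mapV,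
    hC]
  simp [line, FormPair.map_map, mapV_mapV]

theorem pt_eq_pt_add_smul {F : Type*} [Field F] {V b w : F × F} {x : F} (hV : V ≠ 0)
    (hbw : wedge b w ≠ 0) (h : x * wedge V w = wedge b V) : pt V = pt (b + x • w) := by
  have hne : b + x • w ≠ 0 := by
    intro h0
    have : wedge (b + x • w) w = wedge b w := by
      rw [wedge_add_left, wedge_smul_left, wedge_self, mul_zero, add_zero]
    rw [h0] at this
    exact hbw (by rw [← this]; simp [wedge])
  rw [pt_eq_iff hV hne, wedge_add_right, wedge_smul_right, h, wedge_swap b V]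
  ring

end Curves

/-! ### The local form of an analytic family -/

section LocalForm

variable {Ω : Type*} [NontriviallyNormedField Ω] [IsUltrametricDist Ω]

section Evaluation

variable {K : Subfield Ω} {t₀ : Ω} {B : Set Ω}

theorem mapV_evalAt₂_C (p : Ω × Ω) (v : holRing K t₀ B × holRing K t₀ B) :
    mapV (evalAt₂ p) (mapV C v) = mapV (evalAt p.1) v := by
  have hC : (evalAt₂ p).comp C = (evalAt p.1 : holRing K t₀ B →+* Ω) := by
    ext f
    simp [evalAt₂]
  rw [mapV_mapV, hC]

theorem evalAt₂_X (p : Ω × Ω) : evalAt₂ p (X : (holRing K t₀ B)[X]) = p.2 := by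
  simp [evalAt₂]

theorem mapV_evalAt₂_iterate (p : Ω × Ω) (G : FormPair (holRing K t₀ B)) (n : ℕ)
    (v w : holRing K t₀ B × holRing K t₀ B) :
    mapV (evalAt₂ p) ((G.map C).app^[n] (line v w)) =
      (G.map (evalAt p.1)).app^[n] (mapV (evalAt p.1) v + p.2 • mapV (evalAt p.1) w) :=
  mapV_iterate_line (evalAt p.1) p.2 G n v w

theorem hasDerivAt_evalAt₂ (f : (holRing K t₀ B)[X]) (t x : Ω) :
    HasDerivAt (fun x => evalAt₂ (t, x) f) ((f.map (evalAt t)).derivative.eval x) x := by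
  simp only [evalAt₂_eq_eval]
  exact (f.map (evalAt t)).hasDerivAt x

theorem evalAt_continuousAt (hB : B ∈ 𝓝 t₀) (f : holRing K t₀ B) :
    ContinuousAt (fun t => evalAt t f) t₀ := (evalAt_analyticAt hB f).continuousAt

theorem evalAt₂_continuousAt (hB : B ∈ 𝓝 t₀) (f : (holRing K t₀ B)[X]) (x : Ω) :
    ContinuousAt (fun p => evalAt₂ p f) (t₀, x) := (evalAt₂_analyticAt hB f x).continuousAt

omit [IsUltrametricDist Ω] in
theorem exists_wedge_map_ne {A : Type*} [CommRing A] (φ : A →+* Ω) {v : Ω × Ω} (hv : v ≠ 0) :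
    ∃ w : A × A, wedge v (mapV φ w) ≠ 0 := by
  by_contra! h
  have h1 := h (1, 0)
  have h2 := h (0, 1)
  simp only [wedge, mapV, map_one, map_zero, mul_zero, mul_one, zero_sub, sub_zero,
    neg_eq_zero] at h1 h2
  exact hv (Prod.ext h2 h1)

end Evaluation

/-- A family of rational maps over a neighborhood `B` of `t₀`, given by homogeneous lifts whose
coefficients have expansions around `t₀` with coefficients in `K`. The collection `𝒞` consists of
closed subfields. -/
structure AnalyticFamily (𝒞 : Set (Subfield Ω)) (K : Subfield Ω) (t₀ : Ω) (B : Set Ω)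
    (G : FormPair (holRing K t₀ B)) (R : Ω → RatFunc Ω) : Prop where
  closed : ∀ k ∈ 𝒞, IsClosed (k : Set Ω)
  le : ∀ k ∈ 𝒞, K ≤ k
  mem : t₀ ∈ K
  nhds : B ∈ 𝓝 t₀
  deg_pos : 0 < G.deg
  lift : ∀ t ∈ B, IsLift (G.map (evalAt t)) (R t)

variable {𝒞 : Set (Subfield Ω)} {K : Subfield Ω} {t₀ : Ω} {B : Set Ω}
  {G : FormPair (holRing K t₀ B)} {R : Ω → RatFunc Ω}

namespace AnalyticFamily

theorem eventually_fst (H : AnalyticFamily 𝒞 K t₀ B G R) (x : Ω) :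
    ∀ᶠ p : Ω × Ω in 𝓝 (t₀, x), p.1 ∈ B :=
  (continuousAt_fst (p := (t₀, x))).eventually H.nhds

theorem eventually_wedge_ne (H : AnalyticFamily 𝒞 K t₀ B G R)
    {v w : holRing K t₀ B × holRing K t₀ B}
    (h : wedge (mapV (evalAt t₀) v) (mapV (evalAt t₀) w) ≠ 0) :
    ∀ᶠ t in 𝓝 t₀, wedge (mapV (evalAt t) v) (mapV (evalAt t) w) ≠ 0 := by
  simp only [← map_wedge] at h ⊢
  exact (evalAt_continuousAt H.nhds _).eventually_ne h

theorem iterate_line_pt [IsAlgClosed Ω] (H : AnalyticFamily 𝒞 K t₀ B G R) (n : ℕ) {p : Ω × Ω}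
    (hp : p.1 ∈ B) {v w v' w' : holRing K t₀ B × holRing K t₀ B}
    (hvw : wedge (mapV (evalAt p.1) v) (mapV (evalAt p.1) w) ≠ 0)
    (hvw' : wedge (mapV (evalAt p.1) v') (mapV (evalAt p.1) w') ≠ 0) {y : Ω}
    (hy : y * evalAt₂ p (wedge ((G.map C).app^[n] (line v w)) (mapV C w')) =
      evalAt₂ p (wedge (mapV C v') ((G.map C).app^[n] (line v w)))) :
    (toMap (R p.1))^[n] (pt (mapV (evalAt p.1) v + p.2 • mapV (evalAt p.1) w)) =
      pt (mapV (evalAt p.1) v' + y • mapV (evalAt p.1) w') := by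
  have hne : mapV (evalAt p.1) v + p.2 • mapV (evalAt p.1) w ≠ 0 := by
    intro h0
    have : wedge (mapV (evalAt p.1) v + p.2 • mapV (evalAt p.1) w) (mapV (evalAt p.1) w) =
        wedge (mapV (evalAt p.1) v) (mapV (evalAt p.1) w) := by
      rw [wedge_add_left, wedge_smul_left, wedge_self, mul_zero, add_zero]
    rw [h0] at this
    exact hvw (by rw [← this]; simp [wedge])
  rw [(H.lift _ hp).iterate_pt n hne]
  refine pt_eq_pt_add_smul ((H.lift _ hp).iterate_ne n hne) hvw' ?_
  rw [map_wedge, map_wedge, mapV_evalAt₂_C, mapV_evalAt₂_C, mapV_evalAt₂_iterate] at hy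
  exact hy

/-- The coordinate near the repelling fixed point: the fixed point is `b + α t * w`, and the map
multiplies the coordinate `X` of `b + (α t + X) * w` by `q t X`. -/
theorem exists_fixed_point_coordinate [IsAlgClosed Ω] [CompleteSpace Ω]
    (H : AnalyticFamily 𝒞 K t₀ B G R)
    {b w : holRing K t₀ B × holRing K t₀ B} (hb : ∀ t ∈ B, mapV (evalAt t) b ≠ 0)
    (hbw : wedge (mapV (evalAt t₀) b) (mapV (evalAt t₀) w) ≠ 0)
    (hfix : toMap (R t₀) (pt (mapV (evalAt t₀) b)) = pt (mapV (evalAt t₀) b))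
    (hrep : 1 < ‖multiplier (R t₀) (pt (mapV (evalAt t₀) b))‖)
    (hne : ∃ t ∈ B, toMap (R t) (pt (mapV (evalAt t) b)) ≠ pt (mapV (evalAt t) b)) :
    ∃ (α : Ω → Ω) (q : Ω × Ω → Ω) (U : Ω → Ω) (m : ℕ),
      (α t₀ = 0 ∧ LipNear α t₀ ∧ ∀ᶠ t in 𝓝 t₀, ∀ k ∈ 𝒞, t ∈ k → α t ∈ k) ∧
      (q (t₀, 0) = multiplier (R t₀) (pt (mapV (evalAt t₀) b)) ∧ LipNear q (t₀, 0) ∧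
        (∀ᶠ p in 𝓝 (t₀, (0 : Ω)), ∀ k ∈ 𝒞, p.1 ∈ k → p.2 ∈ k → q p ∈ k) ∧
        ∀ᶠ p in 𝓝 (t₀, (0 : Ω)),
          toMap (R p.1) (pt (mapV (evalAt p.1) b + (α p.1 + p.2) • mapV (evalAt p.1) w)) =
            pt (mapV (evalAt p.1) b + (α p.1 + p.2 * q p) • mapV (evalAt p.1) w)) ∧
      1 ≤ m ∧ U t₀ ≠ 0 ∧ LipNear U t₀ ∧ (∀ᶠ t in 𝓝 t₀, ∀ k ∈ 𝒞, t ∈ k → U t ∈ k) ∧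
        ∀ᶠ t in 𝓝 t₀, (t - t₀) ^ m * U t = -α t := by
  have hB₀ : t₀ ∈ B := mem_of_mem_nhds H.nhds
  -- the quotient of `wedge (mapV C b) V` by `Dn` is the coordinate of the image of `b + x • w`, so
  -- that `Hp` vanishes at the fixed points; the implicit function theorem then yields `α`
  set V := (G.map C).app^[1] (line b w) with hV
  set Dn := wedge V (mapV C w) with hDn
  set Hp := wedge (mapV C b) V - X * Dn with hHp
  set lam := multiplier (R t₀) (pt (mapV (evalAt t₀) b)) with hlam
  obtain ⟨κ, hκ0, hκ⟩ := exists_smul_of_wedge_eq_zero (hb t₀ hB₀)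
    ((H.lift t₀ hB₀).app_ne _ (hb t₀ hB₀))
    ((pt_eq_iff (hb t₀ hB₀) ((H.lift t₀ hB₀).app_ne _ (hb t₀ hB₀))).1
      (by rw [← (H.lift t₀ hB₀).toMap_pt (hb t₀ hB₀)]; exact hfix.symm))
  obtain ⟨c, hc, h1, h2⟩ := (H.lift t₀ hB₀).iterate_coeff_one H.deg_pos hbw hκ 1
  rw [pow_one, ← hlam] at h2
  have hDn0 : evalAt₂ (t₀, 0) Dn = c * wedge (mapV (evalAt t₀) b) (mapV (evalAt t₀) w) := by
    rw [hDn, map_wedge, mapV_evalAt₂_C, hV, mapV_evalAt₂_iterate, zero_smul, add_zero, h1,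
      wedge_smul_left]
  have hDn0ne : evalAt₂ (t₀, 0) Dn ≠ 0 := by rw [hDn0]; exact mul_ne_zero hc hbw
  set L := evalAt t₀ (Hp.coeff 1) with hL
  have hLval : L = c * (lam - 1) * wedge (mapV (evalAt t₀) b) (mapV (evalAt t₀) w) := by
    have e1 : L = (wedge (mapV C (mapV (evalAt t₀) b))
        (((G.map (evalAt t₀)).map C).app^[1]
          (line (mapV (evalAt t₀) b) (mapV (evalAt t₀) w)))).coeff 1 - evalAt₂ (t₀, 0) Dn := by
      rw [hL, hHp, coeff_sub, coeff_X_mul, map_sub, evalAt₂_eq_eval, ← coeff_zero_eq_eval_zero,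
        coeff_map, ← coeff_map, ← coe_mapRingHom, map_wedge, hV, mapV_mapRingHom_iterate_line]
      congr 3
      simp [mapV]
    rw [e1, h2, hDn0]
    ring
  have hlam1 : lam - 1 ≠ 0 := by
    intro h0
    rw [sub_eq_zero.1 h0, norm_one] at hrep
    exact lt_irrefl _ hrep
  have hL0 : L ≠ 0 := by rw [hLval]; exact mul_ne_zero (mul_ne_zero hc hlam1) hbw
  have hder : HasDerivAt (fun x => evalAt₂ (t₀, x) Hp) L 0 := by
    have := hasDerivAt_evalAt₂ Hp t₀ 0
    rw [← coeff_zero_eq_eval_zero, coeff_derivative, coeff_map] at this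
    simpa [hL] using this
  have hH0 : ∀ t, evalAt₂ (t, 0) Hp = wedge (mapV (evalAt t) b) ((G.map (evalAt t)).app (mapV (evalAt t) b)) := by
    intro t
    rw [hHp, map_sub, map_mul, evalAt₂_X, zero_mul, sub_zero, map_wedge, mapV_evalAt₂_C, hV,
      mapV_evalAt₂_iterate, zero_smul, add_zero, Function.iterate_one]
  have hH00 : evalAt₂ (t₀, 0) Hp = 0 := by
    rw [hH0, hκ, wedge_smul_right, wedge_self, mul_zero]
  have hmemp : ∀ x : Ω, ∀ f : (holRing K t₀ B)[X], ∀ᶠ p in 𝓝 (t₀, x), ∀ k ∈ 𝒞, p.1 ∈ k →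
      p.2 ∈ k → evalAt₂ p f ∈ k := by
    intro x f
    filter_upwards [H.eventually_fst x] with p hp k hk h1 h2
    exact evalAt₂_mem (H.closed k hk) (H.le k hk) (H.le k hk H.mem) f h1 h2 hp
  obtain ⟨α, hα0, hαL, hαz, hαm⟩ := exists_implicit (𝒞 := 𝒞) H.closed
    (evalAt₂_analyticAt H.nhds Hp 0) hder hL0
    (fun k hk => evalAt_mem (H.closed k hk) (H.le k hk) (H.le k hk H.mem) _
      (H.le k hk H.mem) hB₀) hH00 (hmemp 0 Hp)
  -- the coordinate change
  have hαp : LipNear (fun p : Ω × Ω => α p.1) (t₀, 0) := LipNear.comp hαL (lipNear_fst _) rfl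
  have hφ : LipNear (fun p : Ω × Ω => (p.1, α p.1 + p.2, α p.1)) (t₀, 0) :=
    (lipNear_fst _).prodMk ((hαp.add (lipNear_snd _)).prodMk hαp)
  have hφ0 : ((t₀, (0 : Ω)).1, α (t₀, (0 : Ω)).1 + (t₀, (0 : Ω)).2, α (t₀, (0 : Ω)).1) =
      (t₀, 0, 0) := by simp [hα0]
  have hφ' : LipNear (fun p : Ω × Ω => (p.1, α p.1 + p.2)) (t₀, 0) :=
    (lipNear_fst _).prodMk (hαp.add (lipNear_snd _))
  have hφ'c : Tendsto (fun p : Ω × Ω => (p.1, α p.1 + p.2)) (𝓝 (t₀, 0)) (𝓝 (t₀, 0)) := by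
    have := hφ'.continuousAt
    rw [ContinuousAt, hα0, add_zero] at this
    exact this
  have hQ : AnalyticAt Ω (fun p : Ω × Ω × Ω => 1 + divDiff Hp p / evalAt₂ (p.1, p.2.1) Dn)
      (t₀, 0, 0) := by
    refine analyticAt_const.add ((divDiff_analyticAt H.nhds Hp 0 0).div ?_ hDn0ne)
    have h3 : AnalyticAt Ω (fun p : Ω × Ω × Ω => (p.1, p.2.1)) (t₀, 0, 0) :=
      analyticAt_fst.prod (analyticAt_fst.comp analyticAt_snd)
    exact AnalyticAt.comp (g := fun p => evalAt₂ p Dn) (evalAt₂_analyticAt H.nhds Dn 0) h3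
  have hDnev : ∀ᶠ p : Ω × Ω in 𝓝 (t₀, 0), evalAt₂ (p.1, α p.1 + p.2) Dn ≠ 0 :=
    hφ'c.eventually ((evalAt₂_continuousAt H.nhds Dn 0).eventually_ne hDn0ne)
  have hfstT : Tendsto (fun p : Ω × Ω => p.1) (𝓝 (t₀, (0 : Ω))) (𝓝 t₀) := continuousAt_fst
  -- `m` is the order of vanishing at `t₀` of `t ↦ Hp (t, 0)`, hence that of `α`
  obtain ⟨m, φ₁, hφ₁, hφ₁0, hφ₁f⟩ := holRing_exists_order (wedge b (G.app b)).2 (by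
    obtain ⟨t, ht, htne⟩ := hne
    refine ⟨t, ht, fun h0 => htne ?_⟩
    rw [(H.lift t ht).toMap_pt (hb t ht)]
    refine ((pt_eq_iff (hb t ht) ((H.lift t ht).app_ne _ (hb t ht))).2 ?_).symm
    rw [FormPair.map_app, ← map_wedge]
    exact h0)
  have hH0' : ∀ t ∈ B, evalAt₂ (t, 0) Hp = (t - t₀) ^ m * φ₁ t := by
    intro t ht
    rw [hH0, FormPair.map_app, ← map_wedge]
    exact hφ₁f t ht
  have hdd0 : divDiff Hp (t₀, 0, 0) = L := divDiff_zero Hp t₀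
  have hdα : AnalyticAt Ω (fun p : Ω × Ω => φ₁ p.1 / divDiff Hp (p.1, 0, p.2)) (t₀, 0) := by
    have h3 : AnalyticAt Ω (fun p : Ω × Ω => (p.1, (0 : Ω), p.2)) (t₀, 0) :=
      analyticAt_fst.prod (analyticAt_const.prod analyticAt_snd)
    have h4 : AnalyticAt Ω φ₁ ((t₀, (0 : Ω)) : Ω × Ω).1 := holRing_analyticAt H.nhds hφ₁
    refine (h4.comp analyticAt_fst).div
      (AnalyticAt.comp (g := divDiff Hp) (divDiff_analyticAt H.nhds Hp 0 0) h3) ?_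
    change divDiff Hp (t₀, 0, 0) ≠ 0
    rw [hdd0]
    exact hL0
  have hψ : LipNear (fun t : Ω => (t, α t)) t₀ := (lipNear_id t₀).prodMk hαL
  have hψ0 : (t₀, α t₀) = (t₀, (0 : Ω)) := by rw [hα0]
  have hddne : ∀ᶠ t in 𝓝 t₀, divDiff Hp (t, 0, α t) ≠ 0 := by
    have h3 : Tendsto (fun t : Ω => (t, (0 : Ω), α t)) (𝓝 t₀) (𝓝 (t₀, 0, 0)) := by
      have h4 := hαL.continuousAt
      rw [ContinuousAt, hα0] at h4
      exact tendsto_id.prodMk_nhds (tendsto_const_nhds.prodMk_nhds h4)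
    refine h3.eventually ((divDiff_analyticAt H.nhds Hp 0 0).continuousAt.eventually_ne ?_)
    rw [hdd0]
    exact hL0
  refine ⟨α, fun p => 1 + divDiff Hp (p.1, α p.1 + p.2, α p.1) / evalAt₂ (p.1, α p.1 + p.2) Dn,
    fun t => φ₁ t / divDiff Hp (t, 0, α t), m, ⟨hα0, hαL, hαm⟩, ⟨?_, ?_, ?_, ?_⟩, ?_, ?_, ?_, ?_, ?_⟩
  · dsimp only
    rw [hα0, add_zero, hdd0, hDn0, hLval]
    field_simp
    ring
  · exact LipNear.comp (g := fun p : Ω × Ω × Ω => 1 + divDiff Hp p / evalAt₂ (p.1, p.2.1) Dn)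
      (lipNear_of_analyticAt hQ) hφ hφ0
  · filter_upwards [H.eventually_fst 0, hfstT.eventually hαm] with p hpB hpα k hk h3 h4
    have hα' := hpα k hk h3
    refine k.add_mem k.one_mem (k.div_mem ?_ ?_)
    · exact divDiff_mem (H.closed k hk) (H.le k hk) (H.le k hk H.mem) _ h3 (k.add_mem hα' h4) hα'
        hpB
    · exact evalAt₂_mem (H.closed k hk) (H.le k hk) (H.le k hk H.mem) _ h3 (k.add_mem hα' h4) hpB
  · filter_upwards [H.eventually_fst 0, hfstT.eventually hαz, hDnev,
      hfstT.eventually (H.eventually_wedge_ne hbw)] with p hpB hpz hpD hpw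
    refine H.iterate_line_pt 1 (p := (p.1, α p.1 + p.2)) hpB hpw hpw ?_
    have h3 := divDiff_mul Hp p.1 (α p.1 + p.2) (α p.1)
    rw [hpz, sub_zero, add_sub_cancel_left] at h3
    have h4 : evalAt₂ (p.1, α p.1 + p.2) Hp = evalAt₂ (p.1, α p.1 + p.2) (wedge (mapV C b) V) -
        (α p.1 + p.2) * evalAt₂ (p.1, α p.1 + p.2) Dn := by
      rw [hHp, map_sub, map_mul, evalAt₂_X]
    rw [h4] at h3
    rw [← hV, ← hDn]
    field_simp
    linear_combination h3
  · rcases Nat.eq_zero_or_pos m with h0 | h0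
    · have := hH0' t₀ hB₀
      rw [hH00, h0, pow_zero, one_mul] at this
      exact absurd this.symm (hφ₁0 hB₀)
    · exact h0
  · change φ₁ t₀ / divDiff Hp (t₀, 0, α t₀) ≠ 0
    rw [hα0, hdd0]
    exact div_ne_zero (hφ₁0 hB₀) hL0
  · exact LipNear.comp (g := fun p : Ω × Ω => φ₁ p.1 / divDiff Hp (p.1, 0, p.2))
      (lipNear_of_analyticAt hdα) hψ hψ0
  · filter_upwards [H.nhds, hαm] with t htB htα k hk h3
    refine k.div_mem (holRing_apply_mem (H.closed k hk) (H.le k hk) (H.le k hk H.mem) hφ₁ h3 htB) ?_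
    exact divDiff_mem (H.closed k hk) (H.le k hk) (H.le k hk H.mem) _ h3 k.zero_mem (htα k hk h3)
      htB
  · filter_upwards [H.nhds, hαz, hddne] with t htB htz htd
    have h3 := divDiff_mul Hp t 0 (α t)
    rw [htz, sub_zero, hH0' t htB, zero_sub] at h3
    rw [← mul_div_assoc, ← h3]
    field_simp

/-- The coordinate change from the critical point to the fixed point: the iterate has the form
`y ↦ y ^ d * u t y`. -/
theorem exists_critical_coordinate [IsAlgClosed Ω] (H : AnalyticFamily 𝒞 K t₀ B G R)
    {e e' w : holRing K t₀ B × holRing K t₀ B} {ℓ d : ℕ}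
    (hee : wedge (mapV (evalAt t₀) e) (mapV (evalAt t₀) e') ≠ 0)
    (hbw : wedge (mapV (evalAt t₀) (G.app^[ℓ] e)) (mapV (evalAt t₀) w) ≠ 0)
    (hd : ∀ᶠ t in 𝓝 t₀, localDegree (ratIterate (R t) ℓ) (pt (mapV (evalAt t) e)) = d) :
    1 ≤ d ∧ ∃ u : Ω × Ω → Ω, u (t₀, 0) ≠ 0 ∧ LipNear u (t₀, 0) ∧
      (∀ᶠ p in 𝓝 (t₀, (0 : Ω)), ∀ k ∈ 𝒞, p.1 ∈ k → p.2 ∈ k → u p ∈ k) ∧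
      ∀ᶠ p in 𝓝 (t₀, (0 : Ω)),
        (toMap (R p.1))^[ℓ] (pt (mapV (evalAt p.1) e + p.2 • mapV (evalAt p.1) e')) =
          pt (mapV (evalAt p.1) (G.app^[ℓ] e) + (p.2 ^ d * u p) • mapV (evalAt p.1) w) := by
  have hB₀ : t₀ ∈ B := mem_of_mem_nhds H.nhds
  set V := (G.map C).app^[ℓ] (line e e') with hV
  set Num := wedge (mapV C (G.app^[ℓ] e)) V with hNum
  set Den := wedge V (mapV C w) with hDen
  have hNt : ∀ t, Num.map (evalAt t) = wedge (mapV C ((G.map (evalAt t)).app^[ℓ] (mapV (evalAt t) e)))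
      (((G.map (evalAt t)).map C).app^[ℓ] (line (mapV (evalAt t) e) (mapV (evalAt t) e'))) := by
    intro t
    rw [← coe_mapRingHom, hNum, map_wedge, hV, mapV_mapRingHom_iterate_line, FormPair.map_iterate]
    congr 1
    simp [mapV]
  have hord : ∀ᶠ t in 𝓝 t₀, Num.map (evalAt t) ≠ 0 ∧ (Num.map (evalAt t)).natTrailingDegree = d := by
    filter_upwards [hd, H.nhds, H.eventually_wedge_ne hee] with t h1 h2 h3
    rw [hNt, ← h1]
    obtain ⟨h4, h5⟩ := (H.lift t h2).localDegree_iterate H.deg_pos ℓ h3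
    exact ⟨h4, h5.symm⟩
  have he₀ : mapV (evalAt t₀) e ≠ 0 := by
    intro h0
    rw [h0] at hee
    simp [wedge] at hee
  obtain ⟨hN0, hNd⟩ := hord.self_of_nhds
  have hDen0 : evalAt₂ (t₀, 0) Den = wedge (mapV (evalAt t₀) (G.app^[ℓ] e)) (mapV (evalAt t₀) w) := by
    rw [hDen, map_wedge, mapV_evalAt₂_C, hV, mapV_evalAt₂_iterate, zero_smul, add_zero,
      FormPair.map_iterate]
  have hDen0ne : evalAt₂ (t₀, 0) Den ≠ 0 := by rw [hDen0]; exact hbw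
  have hmon : (X ^ d : (holRing K t₀ B)[X]).Monic := monic_X_pow d
  set N₁ := Num /ₘ X ^ d with hN₁
  have hdiv : ∀ t, Num.map (evalAt t) ≠ 0 → (Num.map (evalAt t)).natTrailingDegree = d →
      Num.map (evalAt t) = X ^ d * N₁.map (evalAt t) := by
    intro t h1 h2
    rw [hN₁, map_divByMonic _ hmon, Polynomial.map_pow, map_X]
    have hdvd : (X ^ d : Polynomial Ω) ∣ Num.map (evalAt t) := by
      rw [X_pow_dvd_iff]
      intro i hi
      exact coeff_eq_zero_of_lt_natTrailingDegree (by omega)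
    obtain ⟨g, hg⟩ := hdvd
    rw [hg, mul_divByMonic_cancel_left _ (monic_X_pow d)]
  have hN₁0 : evalAt₂ (t₀, 0) N₁ ≠ 0 := by
    rw [evalAt₂_eq_eval, ← coeff_zero_eq_eval_zero]
    have h1 := mem_support_iff.1 (natTrailingDegree_mem_support_of_nonzero hN0)
    rw [hNd, hdiv t₀ hN0 hNd, coeff_X_pow_mul' , if_pos le_rfl, Nat.sub_self] at h1
    exact h1
  have hfstT : Tendsto (fun p : Ω × Ω => p.1) (𝓝 (t₀, (0 : Ω))) (𝓝 t₀) := continuousAt_fst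
  refine ⟨?_, fun p => evalAt₂ p N₁ / evalAt₂ p Den, div_ne_zero hN₁0 hDen0ne, ?_, ?_, ?_⟩
  · have h1 := hd.self_of_nhds
    rw [← h1, (H.lift t₀ hB₀).localDegree_iterate_eq_prod H.deg_pos ℓ he₀]
    refine Nat.succ_le_of_lt (Finset.prod_pos fun i _ => ?_)
    rw [(H.lift t₀ hB₀).iterate_pt i he₀]
    exact (H.lift t₀ hB₀).localDegree_pos H.deg_pos ((H.lift t₀ hB₀).iterate_ne i he₀)
  · exact lipNear_of_analyticAt ((evalAt₂_analyticAt H.nhds N₁ 0).div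
      (evalAt₂_analyticAt H.nhds Den 0) hDen0ne)
  · filter_upwards [H.eventually_fst 0] with p hp k hk h1 h2
    exact k.div_mem (evalAt₂_mem (H.closed k hk) (H.le k hk) (H.le k hk H.mem) _ h1 h2 hp)
      (evalAt₂_mem (H.closed k hk) (H.le k hk) (H.le k hk H.mem) _ h1 h2 hp)
  · filter_upwards [H.eventually_fst 0, hfstT.eventually hord,
      (evalAt₂_continuousAt H.nhds Den 0).eventually_ne hDen0ne,
      hfstT.eventually (H.eventually_wedge_ne hee),
      hfstT.eventually (H.eventually_wedge_ne hbw)] with p hpB hpo hpD hpe hpb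
    refine H.iterate_line_pt ℓ hpB hpe hpb ?_
    rw [← hV, ← hDen, ← hNum, mul_assoc, div_mul_cancel₀ _ hpD]
    have h1 := congrArg (eval p.2) (hdiv p.1 hpo.1 hpo.2)
    rw [eval_mul, eval_pow, eval_X, ← evalAt₂_eq_eval, ← evalAt₂_eq_eval] at h1
    exact h1.symm

/-- The coordinate change from an unramified preimage of the critical point near the fixed point
to the critical point. -/
theorem exists_return_coordinate [IsAlgClosed Ω] (H : AnalyticFamily 𝒞 K t₀ B G R)
    {e e' b w : holRing K t₀ B × holRing K t₀ B} {N : ℕ} {z₀ : Ω}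
    (hee : wedge (mapV (evalAt t₀) e) (mapV (evalAt t₀) e') ≠ 0)
    (hbw : wedge (mapV (evalAt t₀) b) (mapV (evalAt t₀) w) ≠ 0)
    (hz : wedge (mapV (evalAt t₀) e)
      ((G.map (evalAt t₀)).app^[N] (mapV (evalAt t₀) b + z₀ • mapV (evalAt t₀) w)) = 0)
    (hz' : (wedge (mapV C (mapV (evalAt t₀) e)) (((G.map (evalAt t₀)).map C).app^[N]
      (line (mapV (evalAt t₀) b) (mapV (evalAt t₀) w)))).derivative.eval z₀ ≠ 0)
    {θ : ℝ} (hθ : 0 < θ) :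
    ∃ (s : Ω × Ω → Ω) (M : Ω), M ≠ 0 ∧ (∀ k ∈ 𝒞, z₀ ∈ k → M ∈ k) ∧ s (t₀, z₀) = 0 ∧
      (∃ Λ : ℝ, 0 ≤ Λ ∧ ∃ r : ℝ, 0 < r ∧ ∀ p p', ‖p - (t₀, z₀)‖ ≤ r → ‖p' - (t₀, z₀)‖ ≤ r →
        ‖s p - s p' - M * (p.2 - p'.2)‖ ≤
          max (θ * (‖M‖ * ‖p.2 - p'.2‖)) (Λ * ‖p.1 - p'.1‖)) ∧
      (∀ᶠ p in 𝓝 (t₀, z₀), ∀ k ∈ 𝒞, p.1 ∈ k → p.2 ∈ k → s p ∈ k) ∧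
      ∀ᶠ p in 𝓝 (t₀, z₀),
        (toMap (R p.1))^[N] (pt (mapV (evalAt p.1) b + p.2 • mapV (evalAt p.1) w)) =
          pt (mapV (evalAt p.1) e + s p • mapV (evalAt p.1) e') := by
  have hB₀ : t₀ ∈ B := mem_of_mem_nhds H.nhds
  set V := (G.map C).app^[N] (line b w) with hV
  set Num := wedge (mapV C e) V with hNum
  set Den := wedge V (mapV C e') with hDen
  have hNum0 : evalAt₂ (t₀, z₀) Num = 0 := by
    rw [hNum, map_wedge, mapV_evalAt₂_C, hV, mapV_evalAt₂_iterate]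
    exact hz
  have hNum' : ((Num.map (evalAt t₀)).derivative).eval z₀ ≠ 0 := by
    have : Num.map (evalAt t₀) = wedge (mapV C (mapV (evalAt t₀) e)) (((G.map (evalAt t₀)).map C).app^[N]
        (line (mapV (evalAt t₀) b) (mapV (evalAt t₀) w))) := by
      rw [← coe_mapRingHom, hNum, map_wedge, hV, mapV_mapRingHom_iterate_line]
      congr 1
      simp [mapV]
    rw [this]
    exact hz'
  have hne : mapV (evalAt t₀) b + z₀ • mapV (evalAt t₀) w ≠ 0 := by
    intro h0
    have : wedge (mapV (evalAt t₀) b + z₀ • mapV (evalAt t₀) w) (mapV (evalAt t₀) w) =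
        wedge (mapV (evalAt t₀) b) (mapV (evalAt t₀) w) := by
      rw [wedge_add_left, wedge_smul_left, wedge_self, mul_zero, add_zero]
    rw [h0] at this
    exact hbw (by rw [← this]; simp [wedge])
  have he₀ : mapV (evalAt t₀) e ≠ 0 := by
    intro h0
    rw [h0] at hee
    simp [wedge] at hee
  obtain ⟨μ, hμ0, hμ⟩ := exists_smul_of_wedge_eq_zero he₀ ((H.lift t₀ hB₀).iterate_ne N hne) hz
  have hDen0 : evalAt₂ (t₀, z₀) Den ≠ 0 := by
    rw [hDen, map_wedge, mapV_evalAt₂_C, hV, mapV_evalAt₂_iterate]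
    dsimp only
    rw [hμ, wedge_smul_left]
    exact mul_ne_zero hμ0 hee
  set s : Ω × Ω → Ω := fun p => evalAt₂ p Num / evalAt₂ p Den with hs
  set M := ((Num.map (evalAt t₀)).derivative).eval z₀ / evalAt₂ (t₀, z₀) Den with hM
  have hsA : AnalyticAt Ω s (t₀, z₀) :=
    (evalAt₂_analyticAt H.nhds Num z₀).div (evalAt₂_analyticAt H.nhds Den z₀) hDen0
  have hsD : HasDerivAt (fun x => s (t₀, x)) M z₀ := by
    have h1 := (hasDerivAt_evalAt₂ Num t₀ z₀).div (hasDerivAt_evalAt₂ Den t₀ z₀) hDen0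
    rw [hNum0, zero_mul, sub_zero] at h1
    refine h1.congr_deriv ?_
    rw [hM]
    field_simp
  have hM0 : M ≠ 0 := div_ne_zero hNum' hDen0
  refine ⟨s, M, hM0, fun k hk hzk => ?_, ?_, exists_approxLinear hsA hsD hM0 hθ, ?_, ?_⟩
  · have ht₀k := H.le k hk H.mem
    refine k.div_mem ?_ (evalAt₂_mem (H.closed k hk) (H.le k hk) ht₀k _ ht₀k hzk hB₀)
    rw [eval_eq_sum_range]
    refine sum_mem fun i _ => k.mul_mem ?_ (k.pow_mem hzk i)
    rw [coeff_derivative, coeff_map]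
    refine k.mul_mem (evalAt_mem (H.closed k hk) (H.le k hk) ht₀k _ ht₀k hB₀) ?_
    exact k.add_mem (natCast_mem k i) k.one_mem
  · rw [hs]
    dsimp only
    rw [hNum0, zero_div]
  · filter_upwards [H.eventually_fst z₀] with p hp k hk h1 h2
    exact k.div_mem (evalAt₂_mem (H.closed k hk) (H.le k hk) (H.le k hk H.mem) _ h1 h2 hp)
      (evalAt₂_mem (H.closed k hk) (H.le k hk) (H.le k hk H.mem) _ h1 h2 hp)
  · have hfstT : Tendsto (fun p : Ω × Ω => p.1) (𝓝 (t₀, z₀)) (𝓝 t₀) := continuousAt_fst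
    filter_upwards [H.eventually_fst z₀,
      (evalAt₂_continuousAt H.nhds Den z₀).eventually_ne hDen0,
      hfstT.eventually (H.eventually_wedge_ne hee),
      hfstT.eventually (H.eventually_wedge_ne hbw)] with p hpB hpD hpe hpb
    refine H.iterate_line_pt N hpB hpb hpe ?_
    rw [← hV, ← hDen, ← hNum]
    exact div_mul_cancel₀ _ hpD

end AnalyticFamily

end LocalForm

/-! ### Recurrent parameters in analytic families -/

section Recurrent

variable {Ω : Type*} [NontriviallyNormedField Ω] [IsUltrametricDist Ω]

theorem eventually_radius {E : Type*} [NormedAddCommGroup E] {p₀ : E} {Q : E → Prop}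
    (h : ∀ᶠ p in 𝓝 p₀, Q p) : ∀ᶠ r : ℝ in 𝓝[>] 0, ∀ p, ‖p - p₀‖ ≤ r → Q p := by
  obtain ⟨r, hr, hQ⟩ := exists_radius h
  filter_upwards [Ioc_mem_nhdsGT hr] with r' hr' p hp
  exact hQ p (hp.trans hr'.2)

theorem LipNear.eventually {E E' : Type*} [NormedAddCommGroup E] [NormedAddCommGroup E']
    {g : E → E'} {p₀ : E} (h : LipNear g p₀) : ∃ Λ : ℝ, 0 ≤ Λ ∧ ∀ᶠ r : ℝ in 𝓝[>] 0, ∀ p p',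
      ‖p - p₀‖ ≤ r → ‖p' - p₀‖ ≤ r → ‖g p - g p'‖ ≤ Λ * ‖p - p'‖ := by
  obtain ⟨Λ, hΛ, r, hr, hL⟩ := h
  refine ⟨Λ, hΛ, ?_⟩
  filter_upwards [Ioc_mem_nhdsGT hr] with r' hr' p p' hp hp'
  exact hL p p' (hp.trans hr'.2) (hp'.trans hr'.2)

variable {𝒞 : Set (Subfield Ω)} {K : Subfield Ω} {t₀ : Ω} {B : Set Ω}
  {G : FormPair (holRing K t₀ B)} {R : Ω → RatFunc Ω}

/-- An analytic family with a marked critical point that bifurcates at a Misiurewicz parameter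
contains maps for which the marked critical point returns arbitrarily close to itself, without ever
returning to itself. -/
theorem AnalyticFamily.exists_recurrent [IsAlgClosed Ω] [CompleteSpace Ω] [CharZero Ω]
    (H : AnalyticFamily 𝒞 K t₀ B G R) (hK : K ∈ 𝒞)
    (hroot : ∀ k ∈ 𝒞, ∀ f : Polynomial Ω, f ≠ 0 → (∀ i, f.coeff i ∈ k) → ∀ x, f.eval x = 0 →
      ∃ k' ∈ 𝒞, k ≤ k' ∧ x ∈ k')
    {e : holRing K t₀ B × holRing K t₀ B} (he : ∀ t ∈ B, mapV (evalAt t) e ≠ 0) {ℓ d : ℕ}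
    (hrep : IsRepellingFixedPt (R t₀) ((toMap (R t₀))^[ℓ] (pt (mapV (evalAt t₀) e))))
    (hcrit : IsCriticalPt (R t₀) (pt (mapV (evalAt t₀) e)))
    (hunr : IsUnramified (R t₀) (pt (mapV (evalAt t₀) e)))
    (hne : ∃ t ∈ B, toMap (R t) ((toMap (R t))^[ℓ] (pt (mapV (evalAt t) e))) ≠
      (toMap (R t))^[ℓ] (pt (mapV (evalAt t) e)))
    (hd : ∀ᶠ t in 𝓝 t₀, localDegree (ratIterate (R t) ℓ) (pt (mapV (evalAt t) e)) = d) :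
    ∃ k ∈ 𝒞, ∃ t ∈ k, t ∈ B ∧ ∃ v v' : Ω × Ω, wedge v v' ≠ 0 ∧ pt v = pt (mapV (evalAt t) e) ∧
      ∀ ε > 0, ∃ (n : ℕ) (y : Ω), y ≠ 0 ∧ ‖y‖ < ε ∧ (toMap (R t))^[n] (pt v) = pt (v + y • v') := by
  have hB₀ : t₀ ∈ B := mem_of_mem_nhds H.nhds
  have hbt : ∀ t ∈ B, (toMap (R t))^[ℓ] (pt (mapV (evalAt t) e)) =
      pt (mapV (evalAt t) (G.app^[ℓ] e)) := by
    intro t ht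
    rw [(H.lift t ht).iterate_pt ℓ (he t ht), FormPair.map_iterate]
  have hb : ∀ t ∈ B, mapV (evalAt t) (G.app^[ℓ] e) ≠ 0 := by
    intro t ht
    rw [← FormPair.map_iterate]
    exact (H.lift t ht).iterate_ne ℓ (he t ht)
  set b := G.app^[ℓ] e with hbdef
  obtain ⟨e', hee⟩ := exists_wedge_map_ne (evalAt t₀ : holRing K t₀ B →+* Ω) (he t₀ hB₀)
  obtain ⟨w, hbw⟩ := exists_wedge_map_ne (evalAt t₀ : holRing K t₀ B →+* Ω) (hb t₀ hB₀)
  rw [hbt t₀ hB₀] at hrep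
  obtain ⟨hfix, hrep⟩ := hrep
  obtain ⟨α, q, U, m, ⟨hα0, hαL, hαm⟩, ⟨hq0, hqL, hqm, hqd⟩, hm1, hU0, hUL, hUm, hUα⟩ :=
    H.exists_fixed_point_coordinate hb hbw hfix hrep (by
      obtain ⟨t, ht, h⟩ := hne
      rw [hbt t ht] at h
      exact ⟨t, ht, h⟩)
  obtain ⟨hd1, u, hu0, huL, hum, hud⟩ := H.exists_critical_coordinate hee hbw hd
  have hdp : 0 < ‖(d : Ω)‖ := norm_pos_iff.2 (Nat.cast_ne_zero.2 (by omega))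
  set θ : ℝ := ‖(d : Ω)‖ * (‖(d : Ω)‖ / 2) with hθ
  have hθ0 : 0 < θ := by positivity
  have hd_le : ‖(d : Ω)‖ ≤ 1 := IsUltrametricDist.norm_natCast_le_one Ω d
  have hθ1 : θ ≤ 1 := by rw [hθ]; nlinarith
  rw [← hq0] at hrep
  set lam := q (t₀, 0) with hlam
  have hlamp : 0 < ‖lam‖ := zero_lt_one.trans hrep
  obtain ⟨Λq, hΛq, hqr⟩ := hqL.eventually
  have hsmall : ∀ᶠ r : ℝ in 𝓝[>] 0, Λq * r ≤ θ * ‖lam‖ := by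
    have : Tendsto (fun x : ℝ => Λq * x) (𝓝 0) (𝓝 (Λq * 0)) := (continuous_const_mul Λq).tendsto 0
    rw [mul_zero] at this
    exact ((this.eventually (gt_mem_nhds (by positivity : 0 < θ * ‖lam‖))).filter_mono
      nhdsWithin_le_nhds).mono fun x hx => hx.le
  have hposr : ∀ᶠ r : ℝ in 𝓝[>] 0, 0 < r := eventually_mem_nhdsWithin
  obtain ⟨δ, hδ0, hδs, hδL, hδm, hδd⟩ := (hposr.and (hsmall.and (hqr.and
    ((eventually_radius hqm).and (eventually_radius hqd))))).exists
  have hqball : ∀ t x : Ω, ‖t - t₀‖ ≤ δ → ‖x‖ ≤ δ → ‖(t, x) - (t₀, 0)‖ ≤ δ := by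
    intro t x ht hx
    rw [Prod.mk_sub_mk, Prod.norm_mk, sub_zero]
    exact max_le ht hx
  obtain ⟨N, z₀, hz0, hzδ, hz, hz'⟩ := (H.lift t₀ hB₀).exists_unramified_preimage_near H.deg_pos
    hbw (he t₀ hB₀) (hbt t₀ hB₀) hfix (by rw [← hq0]; exact hrep) hcrit hunr hδ0
  obtain ⟨s, M, hM0, hMm, hs0, ⟨Λs, hΛs, rs, hrs, hsE⟩, hsm, hsd⟩ :=
    H.exists_return_coordinate hee hbw hz hz' hθ0
  -- a field of definition for everything
  obtain ⟨K₁, hK₁, hKK₁, hzK₁⟩ := hroot K hK (wedge (mapV C (mapV (evalAt t₀) e))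
    (((G.map (evalAt t₀)).map C).app^[N] (line (mapV (evalAt t₀) b) (mapV (evalAt t₀) w))))
    (fun h0 => hz' (by rw [h0, derivative_zero, eval_zero]))
    (fun i => by
      have h1 : wedge (mapV C (mapV (evalAt t₀) e)) (((G.map (evalAt t₀)).map C).app^[N]
          (line (mapV (evalAt t₀) b) (mapV (evalAt t₀) w))) =
          (wedge (mapV C e) ((G.map C).app^[N] (line b w))).map (evalAt t₀) := by
        rw [← coe_mapRingHom, map_wedge, mapV_mapRingHom_iterate_line]
        congr 1
        simp [mapV]
      rw [h1, coeff_map]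
      exact evalAt_mem (H.closed K hK) le_rfl H.mem _ H.mem hB₀) z₀
    (by
      have h1 := mapV_iterate_line (RingHom.id Ω) z₀ (G.map (evalAt t₀)) N (mapV (evalAt t₀) b)
        (mapV (evalAt t₀) w)
      have h2 : ∀ f : Polynomial Ω, f.eval z₀ = eval₂RingHom (RingHom.id Ω) z₀ f := fun f => rfl
      rw [h2, map_wedge, h1]
      have hid : ∀ v : Ω × Ω, mapV (RingHom.id Ω) v = v := fun v => rfl
      have hGid : (G.map (evalAt t₀)).map (RingHom.id Ω) = G.map (evalAt t₀) := rfl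
      rw [hid, hid, hGid]
      have h3 : mapV (eval₂RingHom (RingHom.id Ω) z₀) (mapV C (mapV (evalAt t₀) e)) =
          mapV (evalAt t₀) e := by simp [mapV]
      rw [h3]
      exact hz)
  have hαT : Tendsto (fun p : Ω × Ω => (p.1, α p.1 + p.2)) (𝓝 (t₀, z₀)) (𝓝 (t₀, z₀)) := by
    have h1 : Tendsto (fun p : Ω × Ω => α p.1) (𝓝 (t₀, z₀)) (𝓝 0) := by
      have h2 := hαL.continuousAt
      rw [ContinuousAt, hα0] at h2
      exact h2.comp continuousAt_fst
    have h3 : Tendsto (fun p : Ω × Ω => p.2) (𝓝 (t₀, z₀)) (𝓝 z₀) := continuousAt_snd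
    have h4 : Tendsto (fun p : Ω × Ω => p.1) (𝓝 (t₀, z₀)) (𝓝 t₀) := continuousAt_fst
    have h5 := h1.add h3
    rw [zero_add] at h5
    exact h4.prodMk_nhds h5
  obtain ⟨Λα, hΛα, hαr⟩ := hαL.eventually
  obtain ⟨ΛU, hΛU, hUr⟩ := hUL.eventually
  obtain ⟨Λu, hΛu, hur⟩ := huL.eventually
  have hIoc : ∀ᶠ r : ℝ in 𝓝[>] 0, r ∈ Set.Ioc 0 δ := Ioc_mem_nhdsGT hδ0
  have hBr : ∀ᶠ r : ℝ in 𝓝[>] 0, ∀ t : Ω, ‖t - t₀‖ ≤ r → t ∈ B :=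
    eventually_radius (Q := fun t => t ∈ B) H.nhds
  obtain ⟨r, hr0, hrδ, hrB, hrα, hrαm, hrU, hrUm, hrUα, hru, hrum, hrud, hrw, hrs₁, hrsm, hrsd⟩ :=
    (hposr.and (hIoc.and
      (hBr.and (hαr.and ((eventually_radius hαm).and (hUr.and
      ((eventually_radius hUm).and ((eventually_radius hUα).and (hur.and
      ((eventually_radius hum).and ((eventually_radius hud).and
      ((eventually_radius (H.eventually_wedge_ne hee)).and
      ((eventually_radius (hαT.eventually (eventually_norm_le (t₀, z₀) hrs))).and
      ((eventually_radius (hαT.eventually hsm)).and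
      (eventually_radius (hαT.eventually hsd)))))))))))))))).exists
  have hball : ∀ t x x₀ : Ω, ‖t - t₀‖ ≤ r → ‖x - x₀‖ ≤ r → ‖(t, x) - (t₀, x₀)‖ ≤ r := by
    intro t x x₀ ht hx
    rw [Prod.mk_sub_mk, Prod.norm_mk]
    exact max_le ht hx
  have hball0 : ∀ t x : Ω, ‖t - t₀‖ ≤ r → ‖x‖ ≤ r → ‖(t, x) - (t₀, 0)‖ ≤ r := by
    intro t x ht hx
    exact hball t x 0 ht (by rwa [sub_zero])
  have ht₀r : ‖t₀ - t₀‖ ≤ r := by simpa using hr0.le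
  set Λ := max (max Λu ΛU) (max Λα (max Λs (‖M‖ * Λα))) with hΛ
  have hΛ0 : 0 ≤ Λ := le_max_of_le_left (le_max_of_le_left hΛu)
  have hX : ∀ t, ‖t - t₀‖ ≤ r → (t - t₀) ^ m * U t = -α t := hrUα
  have hqu : ∀ p : Ω × Ω, ‖p.1 - t₀‖ ≤ r → ‖p.2‖ ≤ ‖z₀‖ → ‖p - (t₀, 0)‖ ≤ δ := by
    intro p h1 h2
    exact hqball p.1 p.2 (h1.trans hrδ.2) (h2.trans hzδ.le)
  have model : LocalModel {k | k ∈ 𝒞 ∧ K₁ ≤ k} K₁ (fun t => toMap (R t))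
      (fun t y => pt (mapV (evalAt t) e + y • mapV (evalAt t) e'))
      (fun t x => pt (mapV (evalAt t) b + (α t + x) • mapV (evalAt t) w))
      (fun t y => u (t, y)) (fun t x => q (t, x)) (fun t x => s (t, α t + x)) U ℓ N d m t₀ z₀
      (u (t₀, 0)) lam M (U t₀) θ r Λ Λq := by
    have hmemK : ∀ k ∈ 𝒞, t₀ ∈ k := fun k hk => H.le k hk H.mem
    constructor
    case closed => exact fun k hk => H.closed k hk.1
    case le => exact fun k hk => hk.2
    case K_mem => exact ⟨hK₁, le_rfl⟩
    case ext =>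
      intro k hk x n hn hxn
      obtain ⟨k', hk', hkk', hx⟩ := hroot k hk.1 (X ^ n - C (x ^ n)) (X_pow_sub_C_ne_zero
        (Nat.pos_of_ne_zero hn) _) (fun i => by
          rw [coeff_sub, coeff_X_pow, coeff_C]
          refine k.sub_mem ?_ ?_
          · split_ifs
            exacts [k.one_mem, k.zero_mem]
          · split_ifs
            exacts [hxn, k.zero_mem]) x (by simp)
      exact ⟨k', ⟨hk', hk.2.trans hkk'⟩, hkk', hx⟩
    case t₀_mem => exact hmemK K₁ hK₁
    case z₀_mem => exact hzK₁
    case A_mem =>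
      exact hrum (t₀, 0) (by simpa using hr0.le) K₁ hK₁ (hmemK K₁ hK₁) K₁.zero_mem
    case lam_mem =>
      exact hδm (t₀, 0) (by simpa using hδ0.le) K₁ hK₁ (hmemK K₁ hK₁) K₁.zero_mem
    case M_mem => exact hMm K₁ hK₁ hzK₁
    case U₀_mem => exact hrUm t₀ ht₀r K₁ hK₁ (hmemK K₁ hK₁)
    case z₀_ne => exact hz0
    case A_ne => exact hu0
    case M_ne => exact hM0
    case U₀_ne => exact hU0
    case one_lt_lam => exact hrep
    case d_pos => exact hd1
    case m_pos => exact hm1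
    case θ_pos => exact hθ0
    case θ_le => exact le_rfl
    case r_pos => exact hr0
    case Λ_nonneg => exact hΛ0
    case Λq_nonneg => exact hΛq
    case Λq_le => exact (mul_le_mul_of_nonneg_left hzδ.le hΛq).trans hδs
    case u_val => rfl
    case u_lip =>
      intro t t' y y' ht ht' hy hy'
      have h1 := hru (t, y) (t', y') (hball0 t y ht hy) (hball0 t' y' ht' hy')
      rw [Prod.mk_sub_mk, Prod.norm_mk] at h1
      refine h1.trans ?_
      gcongr
      exact le_max_of_le_left (le_max_left _ _)
    case q_near =>
      intro t x ht hx
      have h1 := hδL (t, x) (t₀, 0) (hqu (t, x) ht hx) (by simpa using hδ0.le)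
      exact h1.trans ((mul_le_mul_of_nonneg_left (hqu (t, x) ht hx) hΛq).trans hδs)
    case q_lip =>
      intro t t' x x' ht ht' hx hx'
      have h1 := hδL (t, x) (t', x') (hqu (t, x) ht hx) (hqu (t', x') ht' hx')
      rwa [Prod.mk_sub_mk, Prod.norm_mk] at h1
    case s_val => simp only [hα0, zero_add, hs0]
    case s_est =>
      intro t t' x x' ht ht' hx hx'
      have h1 := hsE (t, α t + x) (t', α t' + x') (hrs₁ (t, x) (hball t x z₀ ht hx))
        (hrs₁ (t', x') (hball t' x' z₀ ht' hx'))
      have h2 : ‖α t - α t'‖ ≤ Λα * ‖t - t'‖ := hrα t t' ht ht'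
      dsimp only at h1 ⊢
      have e1 : s (t, α t + x) - s (t', α t' + x') - M * (x - x') =
          (s (t, α t + x) - s (t', α t' + x') - M * (α t + x - (α t' + x'))) +
            M * (α t - α t') := by ring
      have h3 : ‖M‖ * ‖α t - α t'‖ ≤ Λ * ‖t - t'‖ := by
        calc ‖M‖ * ‖α t - α t'‖ ≤ ‖M‖ * (Λα * ‖t - t'‖) := by gcongr
          _ = ‖M‖ * Λα * ‖t - t'‖ := by ring
          _ ≤ Λ * ‖t - t'‖ := by
            gcongr
            exact le_max_of_le_right (le_max_of_le_right (le_max_right _ _))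
      rw [e1]
      refine norm_add_le_of_le (h1.trans (max_le ?_ (le_max_of_le_right ?_)))
        (le_max_of_le_right (by rw [norm_mul]; exact h3))
      · have h4 : ‖α t + x - (α t' + x')‖ ≤ max ‖α t - α t'‖ ‖x - x'‖ := by
          rw [add_sub_add_comm]
          exact IsUltrametricDist.norm_add_le_max _ _
        rcases le_max_iff.1 h4 with h5 | h5
        · refine le_max_of_le_right (le_trans ?_ h3)
          calc θ * (‖M‖ * ‖α t + x - (α t' + x')‖) ≤ 1 * (‖M‖ * ‖α t - α t'‖) := by gcongr
            _ = _ := one_mul _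
        · exact le_max_of_le_left (by gcongr)
      · gcongr
        exact le_max_of_le_right (le_max_of_le_right (le_max_left _ _))
    case U_val => rfl
    case U_lip =>
      intro t t' ht ht'
      refine (hrU t t' ht ht').trans ?_
      gcongr
      exact le_max_of_le_left (le_max_right _ _)
    case X_lip =>
      intro t t' ht ht'
      rw [hX t ht, hX t' ht', ← neg_sub', norm_neg]
      refine (hrα t t' ht ht').trans ?_
      gcongr
      exact le_max_of_le_right (le_max_left _ _)
    case u_mem =>
      intro k hk t ht y hy htr hyr
      exact hrum (t, y) (hball0 t y htr hyr) k hk.1 ht hy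
    case q_mem =>
      intro k hk t ht x hx htr hxr
      exact hδm (t, x) (hqu (t, x) htr hxr) k hk.1 ht hx
    case s_mem =>
      intro k hk t ht x hx htr hxr
      exact hrsm (t, x) (hball t x z₀ htr hxr) k hk.1 ht (k.add_mem (hrαm t htr k hk.1 ht) hx)
    case U_mem =>
      intro k hk t ht htr
      exact hrUm t htr k hk.1 ht
    case dyn_u =>
      intro t y ht hy
      have h1 := hrud (t, y) (hball0 t y ht hy)
      have h2 : α t + ((t - t₀) ^ m * U t + y ^ d * u (t, y)) = y ^ d * u (t, y) := by
        rw [hX t ht]; ring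
      dsimp only at h1 ⊢
      rw [h2]
      exact h1
    case dyn_q =>
      intro t x ht hx
      exact hδd (t, x) (hqu (t, x) ht hx)
    case dyn_s =>
      intro t x ht hx
      exact hrsd (t, x) (hball t x z₀ ht hx)
  obtain ⟨k, hk, t, htk, htr, hret⟩ := model.exists_parameter
    (Nat.cast_ne_zero.2 (by omega))
  refine ⟨k, hk.1, t, htk, hrB t htr, mapV (evalAt t) e, mapV (evalAt t) e', hrw t htr, rfl, ?_⟩
  intro ε hε
  obtain ⟨n, y, hy0, hyε, hn⟩ := hret ε hε
  refine ⟨n, y, hy0, hyε, ?_⟩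
  rwa [zero_smul, add_zero] at hn

end Recurrent

/-! ### Recurrence from small returns -/

section Chordal

variable {F : Type*} [NormedField F]

theorem exists_eq_smul_of_ne_zero {v : F × F} (hv : v ≠ 0) :
    ∃ c : F, c ≠ 0 ∧ ((∃ x : F, v = c • (x, 1)) ∨ v = c • ((1 : F), (0 : F))) := by
  obtain ⟨x, y⟩ := v
  by_cases hy : y = 0
  · subst hy
    exact ⟨x, fun h => hv (by rw [h]; rfl), Or.inr (by simp)⟩
  · exact ⟨y, hy, Or.inl ⟨x / y, by simp [mul_div_cancel₀ x hy]⟩⟩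

/-- The chordal distance in homogeneous coordinates; the norm of a vector is the maximum of the
norms of its coordinates. -/
theorem chordal_pt {v w : F × F} (hv : v ≠ 0) (hw : w ≠ 0) :
    chordal (pt v) (pt w) = ‖wedge v w‖ / (‖v‖ * ‖w‖) := by
  obtain ⟨c, hc, hv⟩ := exists_eq_smul_of_ne_zero hv
  obtain ⟨c', hc', hw⟩ := exists_eq_smul_of_ne_zero hw
  have hcc : ‖c‖ * ‖c'‖ ≠ 0 := by simp [hc, hc']
  have key : ∀ a b : F × F, ‖wedge (c • a) (c' • b)‖ / (‖c • a‖ * ‖c' • b‖) =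
      ‖wedge a b‖ / (‖a‖ * ‖b‖) := by
    intro a b
    rw [wedge_smul_left, wedge_smul_right, norm_mul, norm_mul, norm_smul, norm_smul,
      ← mul_assoc, mul_mul_mul_comm, mul_div_mul_left _ _ hcc]
  rcases hv with ⟨x, rfl⟩ | rfl <;> rcases hw with ⟨x', rfl⟩ | rfl <;>
    rw [key, pt_smul hc, pt_smul hc'] <;>
    simp [pt_infty, pt_coe, chordal, wedge, Prod.norm_mk, max_comm]

/-- A point that returns arbitrarily close to itself, each time without being equal to itself, is
recurrent and not periodic. -/
theorem isRecurrent_and_not_isPeriodic {R : RatFunc F} {v v' : F × F} (hw : wedge v v' ≠ 0)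
    (h : ∀ ε > 0, ∃ (n : ℕ) (y : F), y ≠ 0 ∧ ‖y‖ < ε ∧
      (toMap R)^[n] (pt v) = pt (v + y • v')) :
    IsRecurrent R (pt v) ∧ ¬ IsPeriodic R (pt v) := by
  have hv : v ≠ 0 := by rintro rfl; simp [wedge] at hw
  have hvy : ∀ y : F, v + y • v' ≠ 0 := by
    intro y hy
    have h1 := wedge_add_left v (y • v') v'
    rw [hy, wedge_smul_left, wedge_self, mul_zero, add_zero] at h1
    exact hw (by rw [← h1]; simp [wedge])
  have hdist : ∀ y : F, chordal (pt (v + y • v')) (pt v) =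
      ‖y‖ * ‖wedge v v'‖ / (‖v + y • v'‖ * ‖v‖) := by
    intro y
    rw [chordal_pt (hvy y) hv, wedge_add_left, wedge_self, zero_add, wedge_smul_left, wedge_swap,
      norm_mul, norm_neg]
  have hreturn : ∀ ε > 0, ∃ n : ℕ, 0 < chordal ((toMap R)^[n] (pt v)) (pt v) ∧
      chordal ((toMap R)^[n] (pt v)) (pt v) < ε := by
    intro ε hε
    have hcont : ContinuousAt (fun y : F => ‖y‖ * ‖wedge v v'‖ / (‖v + y • v'‖ * ‖v‖)) 0 := by
      refine ContinuousAt.div (by fun_prop) (by fun_prop) ?_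
      exact mul_ne_zero (norm_ne_zero_iff.2 (hvy 0)) (norm_ne_zero_iff.2 hv)
    have hlim := hcont.tendsto
    rw [norm_zero, zero_mul, zero_div] at hlim
    obtain ⟨δ, hδ, hball⟩ := Metric.eventually_nhds_iff_ball.1
      (hlim.eventually (gt_mem_nhds hε))
    obtain ⟨n, y, hy0, hyδ, hn⟩ := h δ hδ
    refine ⟨n, ?_, ?_⟩
    · rw [hn, hdist]
      have h1 := norm_pos_iff.2 hw
      have h2 := norm_pos_iff.2 (hvy y)
      have h3 := norm_pos_iff.2 hv
      have h4 := norm_pos_iff.2 hy0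
      positivity
    · rw [hn, hdist]
      exact hball y (by rwa [mem_ball_zero_iff])
  have hgap : ∀ N : ℕ, ∃ η > 0, ∀ n < N, 0 < chordal ((toMap R)^[n] (pt v)) (pt v) →
      η ≤ chordal ((toMap R)^[n] (pt v)) (pt v) := by
    intro N
    induction N with
    | zero => exact ⟨1, one_pos, fun n hn => absurd hn (Nat.not_lt_zero n)⟩
    | succ N ih =>
      obtain ⟨η, hη, hle⟩ := ih
      by_cases h0 : 0 < chordal ((toMap R)^[N] (pt v)) (pt v)
      · refine ⟨min η (chordal ((toMap R)^[N] (pt v)) (pt v)), lt_min hη h0, fun n hn hpos => ?_⟩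
        rcases Nat.lt_succ_iff_lt_or_eq.1 hn with hn | rfl
        · exact (min_le_left _ _).trans (hle n hn hpos)
        · exact min_le_right _ _
      · refine ⟨η, hη, fun n hn hpos => ?_⟩
        rcases Nat.lt_succ_iff_lt_or_eq.1 hn with hn | rfl
        · exact hle n hn hpos
        · exact absurd hpos h0
  constructor
  · intro ε hε
    rw [frequently_atTop]
    intro N
    obtain ⟨η, hη, hle⟩ := hgap N
    obtain ⟨n, hn0, hn⟩ := hreturn (min ε η) (lt_min hε hη)
    refine ⟨n, ?_, hn.trans_le (min_le_left _ _)⟩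
    by_contra hlt
    exact absurd (hle n (not_le.1 hlt) hn0) (not_le.2 (hn.trans_le (min_le_right _ _)))
  · rintro ⟨m, hm, hper⟩
    obtain ⟨η, hη, hle⟩ := hgap m
    obtain ⟨n, hn0, hn⟩ := hreturn η hη
    have hmod : (toMap R)^[n % m] (pt v) = (toMap R)^[n] (pt v) :=
      Function.IsPeriodicPt.iterate_mod_apply (f := toMap R) hper n
    have h1 := hle (n % m) (Nat.mod_lt n hm)
    rw [hmod] at h1
    exact absurd (h1 hn0) (not_le.2 hn)

end Chordal

/-! ### Families given by coprime polynomials -/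

section Lift

variable {F : Type*} [Field F]

theorem isLift_of_isCoprime {G : FormPair F} {R : RatFunc F} {P Q : F[X]}
    (hnum : ∀ i, G.num i = P.coeff i) (hden : ∀ i, G.den i = Q.coeff i) (hQ : Q ≠ 0)
    (hPQ : IsCoprime P Q)
    (hR : R = algebraMap F[X] (RatFunc F) P / algebraMap F[X] (RatFunc F) Q)
    (hdeg : ratDegree R = G.deg) : IsLift G R := by
  have hlc : Q.leadingCoeff⁻¹ ≠ 0 := inv_ne_zero (leadingCoeff_ne_zero.2 hQ)
  obtain ⟨h1, h2⟩ := num_denom_of_isCoprime hPQ hQ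
  rw [← hR] at h1 h2
  rw [ratDegree, h1, h2, natDegree_C_mul hlc, natDegree_C_mul hlc] at hdeg
  have hP1 : G.polys.1 = P := by
    ext i
    rcases le_or_gt i G.deg with hi | hi
    · rw [G.coeff_polys_fst hi, hnum]
    · rw [coeff_eq_zero_of_natDegree_lt (G.natDegree_polys_fst.trans_lt hi),
        coeff_eq_zero_of_natDegree_lt (((le_max_left _ _).trans hdeg.le).trans_lt hi)]
  have hQ1 : G.polys.2 = Q := by
    ext i
    rcases le_or_gt i G.deg with hi | hi
    · rw [G.coeff_polys_snd hi, hden]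
    · rw [coeff_eq_zero_of_natDegree_lt (G.natDegree_polys_snd.trans_lt hi),
        coeff_eq_zero_of_natDegree_lt (((le_max_right _ _).trans hdeg.le).trans_lt hi)]
  refine ⟨?_, by rwa [hQ1], by rw [hP1, hQ1, hR]⟩
  have hone : G.app (1, 0) ≠ 0 := by
    rw [G.app_inf, hP1, hQ1]
    intro h
    obtain ⟨hPD, hQD⟩ := Prod.mk_eq_zero.1 h
    by_cases hlt : Q.natDegree = G.deg
    · rw [← hlt, coeff_natDegree, leadingCoeff_eq_zero] at hQD
      exact hQ hQD
    · have hQlt : Q.natDegree < G.deg := lt_of_le_of_ne ((le_max_right _ _).trans hdeg.le) hlt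
      have hPD' : P.natDegree = G.deg := by omega
      rw [← hPD', coeff_natDegree, leadingCoeff_eq_zero] at hPD
      rw [hPD, natDegree_zero] at hPD'
      omega
  have hfin : ∀ x : F, G.app (x, 1) ≠ 0 := by
    intro x
    rw [G.app_eval, hP1, hQ1]
    intro h
    obtain ⟨hPx, hQx⟩ := Prod.mk_eq_zero.1 h
    obtain ⟨a, b, hab⟩ := hPQ
    have := congrArg (eval x) hab
    rw [eval_add, eval_mul, eval_mul, hPx, hQx, mul_zero, mul_zero, add_zero, eval_one] at this
    exact zero_ne_one this
  rintro ⟨x, y⟩ hv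
  by_cases hy : y = 0
  · subst hy
    have hx : x ≠ 0 := fun h => hv (by rw [h]; rfl)
    have h1 : ((x, (0 : F)) : F × F) = x • ((1 : F), (0 : F)) := by simp
    rw [h1, FormPair.app_smul]
    exact smul_ne_zero (pow_ne_zero _ hx) hone
  · have h1 : ((x, y) : F × F) = y • (x / y, (1 : F)) := by simp [mul_div_cancel₀ x hy]
    rw [h1, FormPair.app_smul]
    exact smul_ne_zero (pow_ne_zero _ hy) (hfin _)

/-- A constant map has no critical points. -/
theorem ratDegree_pos_of_isCriticalPt {R : RatFunc F} {z : OnePoint F} (h : IsCriticalPt R z) :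
    0 < ratDegree R := by
  have hdeg : ∀ w, (fiberPoly R w).natDegree ≤ ratDegree R := by
    intro w
    induction w using OnePoint.rec with
    | infty => exact le_max_right _ _
    | coe w =>
      refine (natDegree_sub_le _ _).trans (max_le_max le_rfl ?_)
      exact natDegree_C_mul_le _ _
  by_contra h0
  have hD : ratDegree R = 0 := by omega
  rw [hD] at hdeg
  unfold IsCriticalPt at h
  induction z using OnePoint.rec with
  | infty =>
    change 1 < ratDegree R - _ at h
    omega
  | coe x =>
    change 1 < (fiberPoly R (toMap R x)).rootMultiplicity x at h
    have h1 := hdeg (toMap R x)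
    rw [eq_C_of_natDegree_le_zero h1, rootMultiplicity_C] at h
    omega

end Lift

/-! ### Families over the `p`-adic complex numbers -/

section PadicFamilies

variable {p : ℕ} [Fact p.Prime]

theorem IsBall.mem_nhds {B : Set ℂ_[p]} (hB : IsBall B) {t : ℂ_[p]} (ht : t ∈ B) : B ∈ 𝓝 t := by
  obtain ⟨a, r, hr, rfl | rfl⟩ := hB
  · exact Metric.isOpen_ball.mem_nhds ht
  · exact (IsUltrametricDist.isOpen_closedBall a hr.ne').mem_nhds ht

theorem isClosed_of_finiteDimensional (L : IntermediateField ℚ_[p] ℂ_[p])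
    [FiniteDimensional ℚ_[p] L] : IsClosed (L.toSubfield : Set ℂ_[p]) := by
  have : FiniteDimensional ℚ_[p] (Subalgebra.toSubmodule L.toSubalgebra) :=
    inferInstanceAs (FiniteDimensional ℚ_[p] L)
  exact Submodule.closed_of_finiteDimensional (Subalgebra.toSubmodule L.toSubalgebra)

theorem isAlgebraic_of_mem (L : IntermediateField ℚ_[p] ℂ_[p]) [FiniteDimensional ℚ_[p] L]
    {x : ℂ_[p]} (hx : x ∈ L) : IsAlgebraic ℚ_[p] x :=
  (IntermediateField.isAlgebraic_iff (x := (⟨x, hx⟩ : L))).1 (Algebra.IsAlgebraic.isAlgebraic _)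

theorem exists_finiteDimensional_extension (L : IntermediateField ℚ_[p] ℂ_[p])
    [FiniteDimensional ℚ_[p] L] {x : ℂ_[p]} (hx : IsAlgebraic ℚ_[p] x) :
    ∃ L' : IntermediateField ℚ_[p] ℂ_[p], FiniteDimensional ℚ_[p] L' ∧ L ≤ L' ∧ x ∈ L' := by
  have := IntermediateField.adjoin.finiteDimensional hx.isIntegral
  exact ⟨L ⊔ IntermediateField.adjoin ℚ_[p] {x}, inferInstance, le_sup_left,
    (le_sup_right : IntermediateField.adjoin ℚ_[p] {x} ≤ _)
      (IntermediateField.mem_adjoin_simple_self _ x)⟩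

theorem isAlgebraic_of_root (L : IntermediateField ℚ_[p] ℂ_[p]) [FiniteDimensional ℚ_[p] L]
    {f : ℂ_[p][X]} (hf : f ≠ 0) (hfL : ∀ i, f.coeff i ∈ L) {x : ℂ_[p]} (hx : f.eval x = 0) :
    IsAlgebraic ℚ_[p] x := by
  obtain ⟨g, rfl⟩ := (mem_lifts f).1 ((lifts_iff_coeff_lifts (f := algebraMap L ℂ_[p]) f).2
    fun n => ⟨⟨f.coeff n, hfL n⟩, rfl⟩)
  have h1 : IsAlgebraic L x := by
    refine ⟨g, fun h => hf (by rw [h, Polynomial.map_zero]), ?_⟩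
    rwa [aeval_def, ← eval_map]
  exact h1.restrictScalars ℚ_[p]

theorem HolomorphicOver.mem_holRing {K : IntermediateField ℚ_[p] ℂ_[p]}
    [FiniteDimensional ℚ_[p] K] {B : Set ℂ_[p]} {f : ℂ_[p] → ℂ_[p]} (hf : HolomorphicOver K B f)
    {ζ : ℂ_[p]} (hζ : ζ ∈ K) (hζB : ζ ∈ B) : f ∈ holRing K.toSubfield ζ B := by
  obtain ⟨ζ', -, hζ', a, ha, hs⟩ := hf
  exact holRing_recenter (isClosed_of_finiteDimensional K) hζ' hζ hζB ⟨a, ha, hs⟩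

/-- The pair of forms of degree `D` whose coefficients are those of the polynomials `P t` and
`Q t`. -/
def familyForm {K : Subfield ℂ_[p]} {ζ : ℂ_[p]} {B : Set ℂ_[p]} {P Q : ℂ_[p] → ℂ_[p][X]}
    (hP : ∀ i, (fun t => (P t).coeff i) ∈ holRing K ζ B)
    (hQ : ∀ i, (fun t => (Q t).coeff i) ∈ holRing K ζ B) (D : ℕ) : FormPair (holRing K ζ B) where
  deg := D
  num i := ⟨_, hP i⟩
  den i := ⟨_, hQ i⟩

/-- A parameter for which the orbit of the marked point lands on a fixed point after `ℓ` steps is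
algebraic, unless this happens for all parameters. -/
theorem isAlgebraic_parameter {K : IntermediateField ℚ_[p] ℂ_[p]} [FiniteDimensional ℚ_[p] K]
    {B : Set ℂ_[p]} {ζ : ℂ_[p]} (hζ : ζ ∈ K) {G : FormPair (holRing K.toSubfield ζ B)}
    {R : ℂ_[p] → RatFunc ℂ_[p]} (hG : ∀ t ∈ B, IsLift (G.map (evalAt t)) (R t))
    {e : holRing K.toSubfield ζ B × holRing K.toSubfield ζ B}
    (he : ∀ t ∈ B, mapV (evalAt t) e ≠ 0) {ℓ : ℕ} {t₀ : ℂ_[p]} (ht₀ : t₀ ∈ B)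
    (hfix : toMap (R t₀) ((toMap (R t₀))^[ℓ] (pt (mapV (evalAt t₀) e))) =
      (toMap (R t₀))^[ℓ] (pt (mapV (evalAt t₀) e)))
    (hne : ∃ t ∈ B, toMap (R t) ((toMap (R t))^[ℓ] (pt (mapV (evalAt t) e))) ≠
      (toMap (R t))^[ℓ] (pt (mapV (evalAt t) e))) : IsAlgebraic ℚ_[p] t₀ := by
  set φ := wedge (G.app^[ℓ + 1] e) (G.app^[ℓ] e) with hφ
  have hzero : ∀ t ∈ B, (φ : ℂ_[p] → ℂ_[p]) t = 0 ↔
      toMap (R t) ((toMap (R t))^[ℓ] (pt (mapV (evalAt t) e))) =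
        (toMap (R t))^[ℓ] (pt (mapV (evalAt t) e)) := by
    intro t ht
    rw [← Function.iterate_succ_apply' (toMap (R t)), (hG t ht).iterate_pt _ (he t ht),
      (hG t ht).iterate_pt _ (he t ht),
      pt_eq_iff ((hG t ht).iterate_ne _ (he t ht)) ((hG t ht).iterate_ne _ (he t ht)),
      FormPair.map_iterate, FormPair.map_iterate, ← map_wedge]
    rfl
  obtain ⟨a, haK, ha⟩ := φ.2
  have h0 := ha t₀ ht₀
  rw [(hzero t₀ ht₀).2 hfix] at h0
  have halg : IsAlgebraic ℚ_[p] (t₀ - ζ) := by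
    refine isAlgebraic_of_hasSum_zero K haK h0 ?_
    by_contra! h
    obtain ⟨t, ht, hne⟩ := hne
    refine hne ((hzero t ht).1 ((ha t ht).unique ?_))
    simp [h]
  have := halg.add (isAlgebraic_of_mem K hζ)
  rwa [sub_add_cancel] at this

end PadicFamilies

end PadicDyn

end

open PadicDyn in
theorem theoremA (p : ℕ) [Fact p.Prime]
    (K : IntermediateField ℚ_[p] ℂ_[p]) [FiniteDimensional ℚ_[p] K]
    (B : Set ℂ_[p]) (hB : PadicDyn.IsBall B)
    (R : ℂ_[p] → RatFunc ℂ_[p]) (c : ℂ_[p] → OnePoint ℂ_[p])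
    (hRc : PadicDyn.IsMarkedFamilyOver K B R c)
    (hM : ∃ t₀ : ℂ_[p], PadicDyn.HasMisiurewiczBifurcation B R c t₀) :
    ∃ t ∈ B, PadicDyn.HasAlgebraicCoeffs (R t) ∧
      ∃ z : OnePoint ℂ_[p], PadicDyn.IsCriticalPt (R t) z ∧
        PadicDyn.IsRecurrent (R t) z ∧ ¬ PadicDyn.IsPeriodic (R t) z := by
  obtain ⟨t₀, ht₀, ℓ, -, hrep, hunr, hne, d, hd⟩ := hM
  obtain ⟨⟨P, Q, hP, hQ, hPQ, D, hD⟩, ⟨f, g, hf, hg, hfg⟩, hcrit⟩ := hRc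
  have hD0 : 0 < D := by
    rw [← hD t₀ ht₀]
    exact ratDegree_pos_of_isCriticalPt (hcrit t₀ ht₀)
  have hB₀ : B ∈ 𝓝 t₀ := hB.mem_nhds ht₀
  rw [nhdsWithin_eq_nhds.2 hB₀] at hd
  have hlift : ∀ {k : Subfield ℂ_[p]} {ζ : ℂ_[p]}
      (hP' : ∀ i, (fun t => (P t).coeff i) ∈ holRing k ζ B)
      (hQ' : ∀ i, (fun t => (Q t).coeff i) ∈ holRing k ζ B), ∀ t ∈ B,
      IsLift ((familyForm hP' hQ' D).map (evalAt t)) (R t) := fun hP' hQ' t ht =>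
    isLift_of_isCoprime (fun _ => rfl) (fun _ => rfl) (hPQ t ht).1 (hPQ t ht).2.1 (hPQ t ht).2.2
      (hD t ht)
  have hfg0 : ∀ t ∈ B, ((f t, g t) : ℂ_[p] × ℂ_[p]) ≠ 0 := fun t ht h =>
    (hfg t ht).1.elim (fun h1 => h1 (Prod.mk_eq_zero.1 h).1) (fun h1 => h1 (Prod.mk_eq_zero.1 h).2)
  have hc : ∀ t ∈ B, c t = pt (f t, g t) := fun t ht => (hfg t ht).2
  replace hne : ∃ t ∈ B, toMap (R t) ((toMap (R t))^[ℓ] (pt (f t, g t))) ≠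
      (toMap (R t))^[ℓ] (pt (f t, g t)) := by
    obtain ⟨t, ht, h⟩ := hne
    exact ⟨t, ht, by rwa [hc t ht] at h⟩
  rw [hc t₀ ht₀] at hrep hunr
  -- the Misiurewicz parameter is algebraic, and so may serve as the center of the expansions
  have halg : IsAlgebraic ℚ_[p] t₀ := by
    obtain ⟨ζ, hζB, hζ, -⟩ := id hf
    exact isAlgebraic_parameter hζ
      (hlift (fun i => (hP i).mem_holRing hζ hζB) (fun i => (hQ i).mem_holRing hζ hζB))
      (e := (⟨f, hf.mem_holRing hζ hζB⟩, ⟨g, hg.mem_holRing hζ hζB⟩)) hfg0 ht₀ hrep.1 hne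
  obtain ⟨K₁, hK₁, hKK₁, ht₀K₁⟩ := exists_finiteDimensional_extension K halg
  have hol : ∀ φ, HolomorphicOver K B φ → φ ∈ holRing K₁.toSubfield t₀ B := by
    rintro φ ⟨ζ, hζB, hζ, a, ha, hs⟩
    exact HolomorphicOver.mem_holRing (K := K₁) ⟨ζ, hζB, hKK₁ hζ, a, fun n => hKK₁ (ha n), hs⟩
      ht₀K₁ ht₀
  have H : AnalyticFamily {k | ∃ L : IntermediateField ℚ_[p] ℂ_[p],
      FiniteDimensional ℚ_[p] L ∧ K₁ ≤ L ∧ k = L.toSubfield} K₁.toSubfield t₀ B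
      (familyForm (fun i => hol _ (hP i)) (fun i => hol _ (hQ i)) D) R := by
    refine ⟨?_, ?_, ht₀K₁, hB₀, hD0, hlift _ _⟩
    · rintro k ⟨L, hL, -, rfl⟩
      exact isClosed_of_finiteDimensional L
    · rintro k ⟨L, -, hL, rfl⟩
      exact hL
  obtain ⟨k, ⟨L, hL, hK₁L, rfl⟩, t, htL, htB, v, v', hvv, hv, hret⟩ := H.exists_recurrent
    ⟨K₁, hK₁, le_rfl, rfl⟩
    (by
      rintro k ⟨L, hL, hK₁L, rfl⟩ φ hφ hφL x hx
      obtain ⟨L', hL', hLL', hxL'⟩ :=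
        exists_finiteDimensional_extension L (isAlgebraic_of_root L hφ hφL hx)
      exact ⟨L'.toSubfield, ⟨L', hL', hK₁L.trans hLL', rfl⟩, hLL', hxL'⟩)
    (e := (⟨f, hol f hf⟩, ⟨g, hol g hg⟩)) hfg0 hrep
    (by
      have := hcrit t₀ ht₀
      rwa [hc t₀ ht₀] at this)
    hunr hne
    (d := d) (by
      filter_upwards [hd, hB₀] with t ht htB
      rwa [hc t htB] at ht)
  have hmem : ∀ φ, HolomorphicOver K B φ → φ t ∈ L := fun φ hφ =>
    holRing_apply_mem (isClosed_of_finiteDimensional L) hK₁L (hK₁L ht₀K₁) (hol φ hφ) htL htB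
  refine ⟨t, htB, fun i => ?_, c t, hcrit t htB, ?_⟩
  · obtain ⟨hnum, hden⟩ := num_denom_of_isCoprime (hPQ t htB).2.1 (hPQ t htB).1
    rw [← (hPQ t htB).2.2] at hnum hden
    have hlc : (Q t).leadingCoeff⁻¹ ∈ L := L.inv_mem (hmem _ (hQ _))
    rw [hnum, hden, coeff_C_mul, coeff_C_mul]
    exact ⟨isAlgebraic_of_mem L (L.mul_mem hlc (hmem _ (hP i))),
      isAlgebraic_of_mem L (L.mul_mem hlc (hmem _ (hQ i)))⟩
  · rw [hc t htB]
    have := isRecurrent_and_not_isPeriodic hvv hret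
    rwa [hv] at this
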